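/- Let $\alpha>0$ and $r>1+\alpha$ be real numbers. Let $F$ be a $C^r$ Anosov diffeomorphism of $\mathbb T^2=\mathbb R^2/\mathbb Z^2$: there are a $DF$-invariant splitting $T_x\mathbb T^2=E^s(x)\oplus E^u(x)$ into nontrivial subspaces and constants $c>0$, $\lambda>1$ such that, for all $n\ge 0$ and $x\in\mathbb T^2$, $\|D_xF^nv\|\le c\lambda^{-n}\|v\|$ for $v\in E^s(x)$ and $\|D_xF^nv\|\ge c^{-1}\lambda^{n}\|v\|$ for $v\in E^u(x)$. Let $V\in C^{1+\alpha}(\mathbb T^2,\mathbb R^2)$ be a vector field such that $\|V\|\in C^r(\mathbb T^2,\mathbb R)$ and, for all $x$, $V(x)\neq 0$ and $V(x)\in E^s(x)$, and let $(\phi_t)_{t\in\mathbb R}$ be the flow on $\mathbb T^2$ generated by $V$. Then there exist constants $C,\beta>0$ such that, for every $x\in\mathbb T^2$, each $\phi_s$, $s\in\mathbb R$, is differentiable at $x$ with invertible derivative $\xi(s):=D_x\phi_s\in GL(2,\mathbb R)$ and, for every $t>0$, $\xi$ is of class $C^{r-1}$ on $(0,t)$ with \[ \|\xi\|_{C^{r-1}((0,t),GL(2,\mathbb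 R))}\le C\max\{1,t\}^{\beta}. \] Here, for real $\rho\ge 0$ and $k=\lfloor\rho\rfloor$, $\|\xi\|_{C^\rho((0,t))}=\sum_{j=0}^{k}2^{k-j}\sup_{(0,t)}\|\xi^{(j)}\|$, to which, if $\rho$ is not an integer, the Hölder seminorm $\sup_{s\ne s'}\|\xi^{(k)}(s)-\xi^{(k)}(s')\|/|s-s'|^{\rho-k}$ over $s,s'\in(0,t)$ is added. Likewise, $C^\rho$ with non-integer $\rho$ means $C^{k}$ with $(\rho-k)$-Hölder derivatives of order $k$. -/

import Mathlib

open Set Filter Topology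
open scoped ENNReal

noncomputable section

/-- The Euclidean plane `ℝ²`, the tangent space of the torus at every point. -/
abbrev Plane : Type := EuclideanSpace ℝ (Fin 2)

/-- The torus `𝕋² = ℝ² / ℤ²`. -/
abbrev Torus2 : Type := UnitAddTorus (Fin 2)

/-- The covering projection `ℝ² → 𝕋²`. -/
def torusProj (x : Plane) : Torus2 := fun i => (x i : UnitAddCircle)

/-- `A` is the derivative `D_x f` of `f : 𝕋² → 𝕋²` at `x`: some local lift of `f` to the plane
near a preimage of `x` has derivative `A` there. -/
def HasTorusFDerivAt (f : Torus2 → Torus2) (A : Plane →L[ℝ] Plane) (x : Torus2) : Prop :=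
  ∃ (p : Plane) (g : Plane → Plane), torusProj p = x ∧
    (∀ᶠ y in 𝓝 p, torusProj (g y) = f (torusProj y)) ∧ HasFDerivAt g A p

/-- `f` is of class `C^r` for a real number `r ≥ 0`, with uniform modulus: `f` is `⌊r⌋` times
continuously differentiable and its derivative of order `⌊r⌋` is Hölder continuous of exponent
`r - ⌊r⌋`. If `r` is an integer, the second condition only says that the top derivative has bounded
oscillation; it then holds automatically for `ℤ²`-periodic `C^r` functions and, if `r ≥ 1`, for
lifts of `C^r` maps of the torus. -/
def IsHolderClass {E G : Type*} [NormedAddCommGroup E] [NormedSpace ℝ E]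
    [NormedAddCommGroup G] [NormedSpace ℝ G] (r : ℝ) (f : E → G) : Prop :=
  ContDiff ℝ (⌊r⌋₊ : ℕ) f ∧
    ∃ K : ℝ, ∀ x y : E,
      ‖iteratedFDeriv ℝ ⌊r⌋₊ f x - iteratedFDeriv ℝ ⌊r⌋₊ f y‖ ≤ K * ‖x - y‖ ^ (r - (⌊r⌋₊ : ℝ))

/-- A function on the torus with values in a normed space is of class `C^r`. -/
def IsTorusHolderFun {G : Type*} [NormedAddCommGroup G] [NormedSpace ℝ G]
    (r : ℝ) (f : Torus2 → G) : Prop :=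
  IsHolderClass r (fun p : Plane => f (torusProj p))

/-- A self-map of the torus is of class `C^r`: it has a lift to the plane of class `C^r`. -/
def IsTorusHolderMap (r : ℝ) (f : Torus2 → Torus2) : Prop :=
  ∃ g : Plane → Plane, (∀ p, torusProj (g p) = f (torusProj p)) ∧ IsHolderClass r g

/-- `F` is a `C^r` Anosov diffeomorphism of the torus with stable distribution `Es` and unstable
distribution `Eu`. -/
structure IsAnosov (r : ℝ) (F : Torus2 ≃ Torus2) (Es Eu : Torus2 → Submodule ℝ Plane) : Prop where
  smooth : IsTorusHolderMap r F
  smooth_symm : IsTorusHolderMap r F.symm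
  stable_ne_bot : ∀ x, Es x ≠ ⊥
  unstable_ne_bot : ∀ x, Eu x ≠ ⊥
  isCompl : ∀ x, IsCompl (Es x) (Eu x)
  map_stable : ∀ x A, HasTorusFDerivAt F A x → (Es x).map (A : Plane →ₗ[ℝ] Plane) = Es (F x)
  map_unstable : ∀ x A, HasTorusFDerivAt F A x → (Eu x).map (A : Plane →ₗ[ℝ] Plane) = Eu (F x)
  hyperbolic : ∃ C lam : ℝ, 0 < C ∧ 1 < lam ∧
    ∀ (n : ℕ) (x : Torus2) (A : Plane →L[ℝ] Plane), HasTorusFDerivAt (F^[n]) A x →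
      (∀ v ∈ Es x, ‖A v‖ ≤ C * lam⁻¹ ^ n * ‖v‖) ∧
      (∀ v ∈ Eu x, C⁻¹ * lam ^ n * ‖v‖ ≤ ‖A v‖)

/-- The flow `φ` on the torus is generated by the vector field `V`: every orbit, lifted to the
plane, solves the differential equation `γ' = V(γ)`. -/
def IsFlowGeneratedBy (φ : Flow ℝ Torus2) (V : Torus2 → Plane) : Prop :=
  ∀ x, ∃ γ : ℝ → Plane, ∀ t, torusProj (γ t) = φ t x ∧ HasDerivAt γ (V (φ t x)) t

/-- The `C^ρ` norm on a set `U ⊆ ℝ`, with values in `[0, ∞]`: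
`∑_{j ≤ ⌊ρ⌋} 2^(⌊ρ⌋ - j) sup_U ‖f^(j)‖`, plus, if `ρ` is not an integer, the Hölder seminorm of
exponent `ρ - ⌊ρ⌋` of the derivative of order `⌊ρ⌋`. -/
def holderNormOn {E : Type*} [NormedAddCommGroup E] [NormedSpace ℝ E]
    (ρ : ℝ) (U : Set ℝ) (f : ℝ → E) : ℝ≥0∞ :=
  (∑ j ∈ Finset.range (⌊ρ⌋₊ + 1),
      (2 : ℝ≥0∞) ^ (⌊ρ⌋₊ - j) * ⨆ s ∈ U, ‖iteratedDerivWithin j f U s‖ₑ) +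
    open scoped Classical in
    if ρ = (⌊ρ⌋₊ : ℝ) then 0 else
      ⨆ s ∈ U, ⨆ s' ∈ U \ {s},
        ‖iteratedDerivWithin ⌊ρ⌋₊ f U s - iteratedDerivWithin ⌊ρ⌋₊ f U s'‖ₑ /
          ENNReal.ofReal (|s - s'| ^ (ρ - (⌊ρ⌋₊ : ℝ)))

end

/-! Let `W` and `T` be lifts of V and F to the plane and `Φ` the flow of `W`. Invariance of the
stable direction gives DT W = σ (W ∘ T), hence W(Tp) × DT v = J(p) (W(p) × v), with σ =
`speedFactor` and J = `transverseFactor`. By hyperbolicity the products of σ along orbits of `T`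
tend uniformly to 0, while those of J stay away from 0.

In the frames (W, rot W) at p and at Φ_s p the derivative of Φ_s is triangular (`flowDeriv`). Its
entries are built from ‖W‖, the Jacobian exp ∫ div W and an integral of `shear`. Smoothness of ξ in
s thus needs smoothness of W, div W and the shear along orbits only, although W is a priori no
better than C^(1+α) in the plane.

The component of the acceleration DW·W along W, and the shear up to its bending term, are read off
from the differential of ‖W‖, which is of class C^(r-1). What remains is the bending K = W × (DW·W).
Differentiating (W ∘ T) × DT W = 0 along orbits yields J K + (W ∘ T) × D²T(W, W) = σ² (K ∘ T)
(`bending_cohomological`), so K is a bounded solution of an equation whose multiplier σ²/J is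
eventually contracting. Such a solution is as smooth along orbits as the coefficients
(`leafClass_of_cohomological_iterate`). This starts a bootstrap: regularity of W along orbits passes
to K, hence to the acceleration, and W gains one derivative (`fieldClass_succ`). In the same way div
W = σ (div W ∘ T) - J'/J, with J' the derivative of J along orbits (`divergence_cohomological`).

Growth in time comes from renormalization. If τ(s) is the time along the image orbit, then Jac(p, s)
J(Φ_s p) = J(p) Jac(Tp, τ(s)) (`flowJacobian_mul_transverseFactor`). A fixed iterate of `T` at least
halves times at the cost of a bounded factor, so about log₂ s repetitions reach bounded time and the
Jacobian grows at most polynomially. Products and primitives preserve polynomial growth, which gives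
the bound for ξ. -/

section CurveClass

/-! ### Calculus of curves of class C^(k+η) with explicit bounds -/

variable {E E₂ : Type*} [NormedAddCommGroup E] [NormedSpace ℝ E]
  [NormedAddCommGroup E₂] [NormedSpace ℝ E₂]

/-- `f` is `k` times differentiable at the points of `I`, with all derivatives bounded by `B` and
the `k`-th one continuous and `η`-Hölder with constant `B` on `I`. -/
def CurveClass (η : ℝ) : ℕ → ℝ → Set ℝ → (ℝ → E) → Prop
  | 0, B, I, f => ContinuousOn f I ∧ (∀ s ∈ I, ‖f s‖ ≤ B) ∧
      ∀ s ∈ I, ∀ s' ∈ I, ‖f s - f s'‖ ≤ B * |s - s'| ^ η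
  | k + 1, B, I, f => (∀ s ∈ I, ‖f s‖ ≤ B) ∧
      ∃ g : ℝ → E, (∀ s ∈ I, HasDerivAt f (g s) s) ∧ CurveClass η k B I g

namespace CurveClass

variable {η : ℝ} {k : ℕ} {B B' : ℝ} {I : Set ℝ} {f g : ℝ → E}

theorem norm_le (h : CurveClass η k B I f) : ∀ s ∈ I, ‖f s‖ ≤ B := by
  cases k with
  | zero => exact h.2.1
  | succ k => exact h.1

theorem mono (hB : B ≤ B') : ∀ {k : ℕ} {f : ℝ → E}, CurveClass η k B I f → CurveClass η k B' I f
  | 0, _, h => ⟨h.1, fun s hs => (h.2.1 s hs).trans hB, fun s hs s' hs' =>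
      (h.2.2 s hs s' hs').trans (by gcongr)⟩
  | _ + 1, _, ⟨h, g, hg, hk⟩ => ⟨fun s hs => (h s hs).trans hB, g, hg, mono hB hk⟩

theorem mono_set {I' : Set ℝ} (hI : I' ⊆ I) :
    ∀ {k : ℕ} {f : ℝ → E}, CurveClass η k B I f → CurveClass η k B I' f
  | 0, _, h => ⟨h.1.mono hI, fun s hs => h.2.1 s (hI hs), fun s hs s' hs' =>
      h.2.2 s (hI hs) s' (hI hs')⟩
  | _ + 1, _, ⟨h, g, hg, hk⟩ =>
      ⟨fun s hs => h s (hI hs), g, fun s hs => hg s (hI hs), mono_set hI hk⟩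

theorem continuousOn (h : CurveClass η k B I f) : ContinuousOn f I := by
  cases k with
  | zero => exact h.1
  | succ k =>
    obtain ⟨-, g, hg, -⟩ := h
    exact fun s hs => (hg s hs).continuousAt.continuousWithinAt

end CurveClass

/-- A bound by `B` and by `L * d` interpolates to a Hölder bound. -/
theorem le_mul_rpow_of_le_of_le_mul {η x L d : ℝ} (hη0 : 0 ≤ η) (hη1 : η ≤ 1) (hL : 0 ≤ L)
    (hd : 0 ≤ d) (h1 : x ≤ L) (h2 : x ≤ L * d) : x ≤ L * d ^ η := by
  rcases le_total d 1 with h | h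
  · rcases hd.eq_or_lt with rfl | hd'
    · calc x ≤ L * 0 := h2
        _ ≤ _ := by rw [mul_zero]; positivity
    · calc x ≤ L * d := h2
        _ = L * d ^ (1 : ℝ) := by rw [Real.rpow_one]
        _ ≤ L * d ^ η := by
          gcongr L * ?_
          exact Real.rpow_le_rpow_of_exponent_ge hd' h hη1
  · calc x ≤ L * 1 := by simpa using h1
      _ ≤ L * d ^ η := by
        gcongr
        exact Real.one_le_rpow h hη0

namespace CurveClass

variable {η : ℝ} {k : ℕ} {B B' : ℝ} {I : Set ℝ} {f g : ℝ → E}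

/-- The factor 2 pays for distant points, where only the trivial bound on the difference is
available; the Lipschitz bound handles nearby ones. -/
theorem of_hasDerivAt_of_bounded (hη0 : 0 ≤ η) (hη1 : η ≤ 1) (hI : Convex ℝ I) (hB : 0 ≤ B)
    (hf : ∀ s ∈ I, ‖f s‖ ≤ B) (hg : ∀ s ∈ I, HasDerivAt f (g s) s) (hgB : ∀ s ∈ I, ‖g s‖ ≤ B) :
    CurveClass η 0 (2 * B) I f := by
  refine ⟨fun s hs => (hg s hs).continuousAt.continuousWithinAt,
    fun s hs => (hf s hs).trans (by linarith), fun s hs s' hs' => ?_⟩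
  refine le_mul_rpow_of_le_of_le_mul hη0 hη1 (by linarith) (abs_nonneg _) ?_ ?_
  · calc ‖f s - f s'‖ ≤ ‖f s‖ + ‖f s'‖ := norm_sub_le _ _
      _ ≤ 2 * B := by linarith [hf s hs, hf s' hs']
  · have := hI.norm_image_sub_le_of_norm_hasDerivWithin_le
      (fun x hx => (hg x hx).hasDerivWithinAt) hgB hs' hs
    rw [Real.norm_eq_abs] at this
    nlinarith [mul_nonneg hB (abs_nonneg (s - s'))]

theorem lower (hη0 : 0 ≤ η) (hη1 : η ≤ 1) (hI : Convex ℝ I) (hB : 0 ≤ B) :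
    ∀ {k : ℕ} {f : ℝ → E}, CurveClass η (k + 1) B I f → CurveClass η k (2 * B) I f
  | 0, _, ⟨h, _, hg, hk⟩ => of_hasDerivAt_of_bounded hη0 hη1 hI hB h hg hk.norm_le
  | _ + 1, _, ⟨h, g, hg, hk⟩ =>
      ⟨fun s hs => (h s hs).trans (by linarith), g, hg, lower hη0 hη1 hI hB hk⟩

theorem add {k : ℕ} : ∀ {f g : ℝ → E}, CurveClass η k B I f → CurveClass η k B' I g →
    CurveClass η k (B + B') I (fun s => f s + g s) := by
  induction k with
  | zero =>
    intro f g hf hg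
    refine ⟨hf.1.add hg.1, fun s hs => (norm_add_le _ _).trans
      (add_le_add (hf.2.1 s hs) (hg.2.1 s hs)), fun s hs s' hs' => ?_⟩
    calc ‖f s + g s - (f s' + g s')‖ = ‖(f s - f s') + (g s - g s')‖ := by congr 1; abel
      _ ≤ _ := norm_add_le _ _
      _ ≤ _ := by rw [add_mul]; exact add_le_add (hf.2.2 s hs s' hs') (hg.2.2 s hs s' hs')
  | succ k ih =>
    rintro f g ⟨hf, f', hf', hfk⟩ ⟨hg, g', hg', hgk⟩
    exact ⟨fun s hs => (norm_add_le _ _).trans (add_le_add (hf s hs) (hg s hs)),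
      fun s => f' s + g' s, fun s hs => (hf' s hs).add (hg' s hs), ih hfk hgk⟩

theorem clm_apply (A : E →L[ℝ] E₂) {k : ℕ} : ∀ {f : ℝ → E}, CurveClass η k B I f →
    CurveClass η k (‖A‖ * B) I (fun s => A (f s)) := by
  induction k with
  | zero =>
    intro f hf
    refine ⟨A.continuous.comp_continuousOn hf.1, fun s hs => A.le_opNorm_of_le (hf.2.1 s hs),
      fun s hs s' hs' => ?_⟩
    rw [← map_sub, mul_assoc]
    exact A.le_opNorm_of_le (hf.2.2 s hs s' hs')
  | succ k ih =>
    rintro f ⟨hf, f', hf', hfk⟩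
    exact ⟨fun s hs => A.le_opNorm_of_le (hf s hs), fun s => A (f' s),
      fun s hs => A.hasFDerivAt.comp_hasDerivAt s (hf' s hs), ih hfk⟩

theorem const (c : E) : CurveClass η k ‖c‖ I (fun _ => c) := by
  induction k generalizing c with
  | zero => exact ⟨continuousOn_const, fun _ _ => le_rfl, fun s _ s' _ => by simp; positivity⟩
  | succ k ih =>
    refine ⟨fun _ _ => le_rfl, fun _ => 0, fun s _ => hasDerivAt_const s c, ?_⟩
    exact (ih 0).mono (by simp)

/-- The constant satisfies its own recursion: Leibniz gives two terms, and in each the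
undifferentiated factor is lowered by one order, which doubles its bound. Hence a factor 4 per
order, starting from 2 for the Hölder estimate of a product. -/
theorem smul (hη0 : 0 ≤ η) (hη1 : η ≤ 1) (hI : Convex ℝ I) {k : ℕ} :
    ∀ {B B' : ℝ} {f : ℝ → ℝ} {g : ℝ → E}, 0 ≤ B → 0 ≤ B' → CurveClass η k B I f →
    CurveClass η k B' I g → CurveClass η k (2 * 4 ^ k * (B * B')) I (fun s => f s • g s) := by
  induction k with
  | zero =>
    intro B B' f g hB hB' hf hg
    refine ⟨hf.1.smul hg.1, fun s hs => ?_, fun s hs s' hs' => ?_⟩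
    · rw [norm_smul]
      have := mul_le_mul (hf.2.1 s hs) (hg.2.1 s hs) (norm_nonneg _) hB
      nlinarith [mul_nonneg hB hB']
    · calc ‖f s • g s - f s' • g s'‖ = ‖(f s - f s') • g s + f s' • (g s - g s')‖ := by
            congr 1; rw [sub_smul, smul_sub]; abel
        _ ≤ ‖f s - f s'‖ * ‖g s‖ + ‖f s'‖ * ‖g s - g s'‖ := by
            refine (norm_add_le _ _).trans ?_
            rw [norm_smul, norm_smul]
        _ ≤ (B * |s - s'| ^ η) * B' + B * (B' * |s - s'| ^ η) := by
            gcongr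
            · exact hf.2.2 s hs s' hs'
            · exact hg.2.1 s hs
            · exact hf.2.1 s' hs'
            · exact hg.2.2 s hs s' hs'
        _ = _ := by ring
  | succ k ih =>
    intro B B' f g hB hB' hf hg
    have hfl := lower hη0 hη1 hI hB hf
    have hgl := lower hη0 hη1 hI hB' hg
    obtain ⟨hf0, f', hf', hfk⟩ := hf
    obtain ⟨hg0, g', hg', hgk⟩ := hg
    refine ⟨fun s hs => ?_, fun s => f s • g' s + f' s • g s,
      fun s hs => (hf' s hs).smul (hg' s hs), ?_⟩
    · rw [norm_smul]
      have := mul_le_mul (hf0 s hs) (hg0 s hs) (norm_nonneg _) hB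
      have h4 : (1 : ℝ) ≤ 4 ^ (k + 1) := one_le_pow₀ (by norm_num)
      nlinarith [mul_nonneg hB hB']
    · refine ((ih (by positivity) hB' hfl hgk).add (ih hB (by positivity) hfk hgl)).mono ?_
      rw [pow_succ]; nlinarith [mul_nonneg hB hB']

/-- The derivative -f⁻² f' involves f⁻¹ at one order less, so the bound is built recursively. It
does not depend on f, which makes it usable on all orbits at once. -/
theorem inv (hη0 : 0 ≤ η) (hη1 : η ≤ 1) (hI : Convex ℝ I) {c : ℝ} (hc : 0 < c) (k : ℕ) :
    ∀ B : ℝ, 0 ≤ B → ∃ B' : ℝ, 0 ≤ B' ∧ ∀ f : ℝ → ℝ, CurveClass η k B I f →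
      (∀ s ∈ I, c ≤ |f s|) → CurveClass η k B' I (fun s => (f s)⁻¹) := by
  have key : ∀ f : ℝ → ℝ, (∀ s ∈ I, c ≤ |f s|) → ∀ s ∈ I, ‖(f s)⁻¹‖ ≤ c⁻¹ := by
    intro f hf s hs
    rw [norm_inv]
    exact inv_anti₀ hc (hf s hs)
  have hne : ∀ f : ℝ → ℝ, (∀ s ∈ I, c ≤ |f s|) → ∀ s ∈ I, f s ≠ 0 := by
    intro f hf s hs h0
    have := hf s hs
    rw [h0, abs_zero] at this
    linarith
  induction k with
  | zero =>
    intro B hB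
    refine ⟨c⁻¹ + c⁻¹ * c⁻¹ * B, by positivity, fun f hf hfc => ⟨hf.1.inv₀ (hne f hfc),
      fun s hs => (key f hfc s hs).trans (le_add_of_nonneg_right (by positivity)),
      fun s hs s' hs' => ?_⟩⟩
    have h1 := hne f hfc s hs
    have h2 := hne f hfc s' hs'
    calc ‖(f s)⁻¹ - (f s')⁻¹‖ = ‖(f s)⁻¹‖ * ‖(f s')⁻¹‖ * ‖f s - f s'‖ := by
          rw [← norm_mul, norm_sub_rev (f s), ← norm_mul]; congr 1; field_simp
      _ ≤ c⁻¹ * c⁻¹ * (B * |s - s'| ^ η) := by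
          gcongr
          · exact key f hfc s hs
          · exact key f hfc s' hs'
          · exact hf.2.2 s hs s' hs'
      _ ≤ _ := by
          have : 0 ≤ c⁻¹ * |s - s'| ^ η := by positivity
          nlinarith
  | succ k ih =>
    intro B hB
    obtain ⟨B', hB', h⟩ := ih (2 * B) (by positivity)
    refine ⟨c⁻¹ + (2 * 4 ^ k * ((2 * 4 ^ k * (B' * B')) * B)), by positivity, fun f hf hfc => ?_⟩
    have hi := h f (hf.lower hη0 hη1 hI hB) hfc
    obtain ⟨hf0, f', hf', hfk⟩ := hf
    refine ⟨fun s hs => (key f hfc s hs).trans (le_add_of_nonneg_right (by positivity)),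
      fun s => -(((f s)⁻¹ * (f s)⁻¹) * f' s), fun s hs => ?_, ?_⟩
    · have h1 := hne f hfc s hs
      refine ((hf' s hs).inv h1).congr_deriv ?_
      rw [div_eq_mul_inv, pow_two, mul_inv]
      ring
    · have := (smul hη0 hη1 hI (by positivity) hB (smul hη0 hη1 hI hB' hB' hi hi) hfk).clm_apply
        (-ContinuousLinearMap.id ℝ ℝ)
      simp only [norm_neg, smul_eq_mul, neg_apply,
        ContinuousLinearMap.id_apply] at this
      refine this.mono ?_
      rw [ContinuousLinearMap.norm_id, one_mul]
      exact le_add_of_nonneg_left (by positivity)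

theorem contDiffOn (hI : IsOpen I) {k : ℕ} :
    ∀ {f : ℝ → E}, CurveClass η k B I f → ContDiffOn ℝ k f I := by
  induction k with
  | zero => intro f h; exact contDiffOn_zero.2 h.1
  | succ k ih =>
    rintro f ⟨-, g, hg, hk⟩
    have hd : ∀ s ∈ I, deriv f s = g s := fun s hs => (hg s hs).deriv
    rw [Nat.cast_add, Nat.cast_one, contDiffOn_succ_iff_deriv_of_isOpen hI]
    refine ⟨fun s hs => (hg s hs).differentiableAt.differentiableWithinAt, by simp, ?_⟩
    exact (ih hk).congr hd

theorem norm_iteratedDerivWithin_le (hI : IsOpen I) {k : ℕ} :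
    ∀ {f : ℝ → E}, CurveClass η k B I f →
      (∀ j ≤ k, ∀ s ∈ I, ‖iteratedDerivWithin j f I s‖ ≤ B) ∧
      ∀ s ∈ I, ∀ s' ∈ I, ‖iteratedDerivWithin k f I s - iteratedDerivWithin k f I s'‖ ≤
        B * |s - s'| ^ η := by
  induction k with
  | zero =>
    intro f h
    refine ⟨fun j hj s hs => ?_, fun s hs s' hs' => ?_⟩
    · obtain rfl := Nat.le_zero.1 hj
      simpa using h.2.1 s hs
    · simpa using h.2.2 s hs s' hs'
  | succ k ih =>
    rintro f ⟨hf, g, hg, hk⟩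
    have hd : EqOn (derivWithin f I) g I := fun s hs =>
      (hg s hs).hasDerivWithinAt.derivWithin (hI.uniqueDiffWithinAt hs)
    have hsucc : ∀ j, EqOn (iteratedDerivWithin (j + 1) f I) (iteratedDerivWithin j g I) I := by
      intro j s hs
      rw [iteratedDerivWithin_succ']
      exact iteratedDerivWithin_congr hd hs
    obtain ⟨h1, h2⟩ := ih hk
    refine ⟨fun j hj s hs => ?_, fun s hs s' hs' => ?_⟩
    · cases j with
      | zero => simpa using hf s hs
      | succ j => rw [hsucc j hs]; exact h1 j (by omega) s hs
    · rw [hsucc k hs, hsucc k hs']; exact h2 s hs s' hs'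

end CurveClass

theorem holderNormOn_le_of_curveClass {ρ B : ℝ} {I : Set ℝ} {f : ℝ → E} (hI : IsOpen I)
    (hB : 0 ≤ B) (h : CurveClass (ρ - ⌊ρ⌋₊) ⌊ρ⌋₊ B I f) :
    holderNormOn ρ I f ≤ ENNReal.ofReal
      ((∑ j ∈ Finset.range (⌊ρ⌋₊ + 1), 2 ^ (⌊ρ⌋₊ - j) + 1) * B) := by
  obtain ⟨h1, h2⟩ := h.norm_iteratedDerivWithin_le hI
  rw [holderNormOn, add_mul, one_mul, ENNReal.ofReal_add (by positivity) hB, Finset.sum_mul,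
    ENNReal.ofReal_sum_of_nonneg (fun _ _ => by positivity)]
  refine add_le_add (Finset.sum_le_sum fun j hj => ?_) ?_
  · rw [ENNReal.ofReal_mul (by positivity), ENNReal.ofReal_pow (by norm_num)]
    gcongr
    · simp
    · refine iSup₂_le fun s hs => ?_
      rw [← ofReal_norm]
      exact ENNReal.ofReal_le_ofReal (h1 j (by simpa [Nat.lt_succ_iff] using hj) s hs)
  · split_ifs
    · exact zero_le
    · refine iSup₂_le fun s hs => iSup₂_le fun s' hs' => ?_
      have hne : s - s' ≠ 0 := sub_ne_zero.2 fun h => hs'.2 h.symm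
      have hpos : 0 < |s - s'| ^ (ρ - (⌊ρ⌋₊ : ℝ)) := Real.rpow_pos_of_pos (abs_pos.2 hne) _
      rw [ENNReal.div_le_iff (by simpa using hpos) ENNReal.ofReal_ne_top,
        ← ENNReal.ofReal_mul hB, ← ofReal_norm]
      exact ENNReal.ofReal_le_ofReal (h2 s hs s' hs'.1)

end CurveClass

/-! ### Flows of C¹ vector fields and their variational equation -/

open scoped NNReal in
/-- `Φ` is the global flow of the bounded, Lipschitz, continuously differentiable vector field
`W`. -/
structure IsC1Flow {E : Type*} [NormedAddCommGroup E] [NormedSpace ℝ E]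
    (W : E → E) (Φ : ℝ → E → E) (M : ℝ) (L : ℝ≥0) : Prop where
  contDiff : ContDiff ℝ 1 W
  norm_le : ∀ p, ‖W p‖ ≤ M
  lipschitz : LipschitzWith L W
  map_zero : ∀ p, Φ 0 p = p
  hasDerivAt : ∀ p s, HasDerivAt (fun s => Φ s p) (W (Φ s p)) s

namespace IsC1Flow

open scoped NNReal

variable {E : Type*} [NormedAddCommGroup E] [NormedSpace ℝ E]
  {W : E → E} {Φ : ℝ → E → E} {M : ℝ} {L : ℝ≥0}

theorem map_add (h : IsC1Flow W Φ M L) (p : E) (s u : ℝ) : Φ (s + u) p = Φ u (Φ s p) := by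
  have key : (fun u => Φ (s + u) p) = fun u => Φ u (Φ s p) := by
    refine ODE_solution_unique_univ (v := fun _ => W) (K := L) (s := fun _ => univ) (t₀ := 0)
      (fun _ => h.lipschitz.lipschitzOnWith) (fun u => ⟨?_, trivial⟩)
      (fun u => ⟨h.hasDerivAt _ u, trivial⟩) ?_
    · exact (h.hasDerivAt p (s + u)).comp_const_add s u
    · simp [h.map_zero]
  exact congrFun key u

theorem map_neg_map (h : IsC1Flow W Φ M L) (p : E) (s : ℝ) : Φ (-s) (Φ s p) = p := by
  rw [← h.map_add, add_neg_cancel, h.map_zero]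

theorem reverse (h : IsC1Flow W Φ M L) : IsC1Flow (fun p => -W p) (fun s => Φ (-s)) M L where
  contDiff := h.contDiff.neg
  norm_le p := by rw [norm_neg]; exact h.norm_le p
  lipschitz := h.lipschitz.neg
  map_zero p := by simp [h.map_zero]
  hasDerivAt p s := by
    have := (h.hasDerivAt p (-s)).scomp s (hasDerivAt_neg s)
    simpa [Function.comp_def] using this

theorem continuous_orbit (h : IsC1Flow W Φ M L) (p : E) : Continuous fun s => Φ s p :=
  continuous_iff_continuousAt.2 fun s => (h.hasDerivAt p s).continuousAt

theorem norm_sub_le (h : IsC1Flow W Φ M L) (p : E) (s u : ℝ) : ‖Φ s p - Φ u p‖ ≤ M * |s - u| := by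
  have := convex_univ.norm_image_sub_le_of_norm_hasDerivWithin_le (f := fun s => Φ s p)
    (fun x _ => (h.hasDerivAt p x).hasDerivWithinAt) (fun x _ => h.norm_le _)
    (mem_univ u) (mem_univ s)
  simpa using this

theorem norm_map_sub_map_le (h : IsC1Flow W Φ M L) (p q : E) (s : ℝ) :
    ‖Φ s p - Φ s q‖ ≤ ‖p - q‖ * Real.exp (L * |s|) := by
  have main : ∀ {W : E → E} {Φ : ℝ → E → E}, IsC1Flow W Φ M L → ∀ s, 0 ≤ s →
      ‖Φ s p - Φ s q‖ ≤ ‖p - q‖ * Real.exp (L * s) := by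
    intro W Φ h s hs
    have := dist_le_of_trajectories_ODE (v := fun _ => W) (K := L) (f := fun s => Φ s p)
      (g := fun s => Φ s q) (a := 0) (b := s) (δ := ‖p - q‖) (fun _ => h.lipschitz)
      (h.continuous_orbit p).continuousOn (fun t _ => (h.hasDerivAt p t).hasDerivWithinAt)
      (h.continuous_orbit q).continuousOn (fun t _ => (h.hasDerivAt q t).hasDerivWithinAt)
      (by simp [h.map_zero, dist_eq_norm]) s (right_mem_Icc.2 hs)
    simpa [dist_eq_norm] using this
  rcases le_total 0 s with hs | hs
  · simpa [abs_of_nonneg hs] using main h s hs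
  · simpa [abs_of_nonpos hs] using main h.reverse (-s) (by linarith)

theorem continuous_map (h : IsC1Flow W Φ M L) : Continuous fun x : E × ℝ => Φ x.2 x.1 := by
  rw [continuous_iff_continuousAt]
  rintro ⟨p, s⟩
  have hlim : Tendsto (fun x : E × ℝ => ‖x.1 - p‖ * Real.exp (L * |x.2|) + M * |x.2 - s|)
      (𝓝 (p, s)) (𝓝 0) := by
    have : Continuous fun x : E × ℝ => ‖x.1 - p‖ * Real.exp (L * |x.2|) + M * |x.2 - s| := by
      fun_prop
    simpa using this.tendsto (p, s)
  rw [ContinuousAt, tendsto_iff_norm_sub_tendsto_zero]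
  refine squeeze_zero (fun _ => norm_nonneg _) (fun x => ?_) hlim
  calc ‖Φ x.2 x.1 - Φ s p‖ = ‖(Φ x.2 x.1 - Φ x.2 p) + (Φ x.2 p - Φ s p)‖ := by
        rw [sub_add_sub_cancel]
    _ ≤ _ := (norm_add_le _ _).trans
        (add_le_add (h.norm_map_sub_map_le _ _ _) (h.norm_sub_le _ _ _))

theorem norm_fderiv_le (h : IsC1Flow W Φ M L) (p : E) : ‖fderiv ℝ W p‖ ≤ L :=
  norm_fderiv_le_of_lipschitz ℝ h.lipschitz

/-- Grönwall's inequality applied to the error Φ_s(p+v) - Φ_s(p) - ξ_s v, whose derivative is at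
most L times the error plus a term small compared with ‖v‖, by uniform continuity of DW on a compact
ball. -/
theorem hasFDerivAt_of_nonneg [ProperSpace E] (h : IsC1Flow W Φ M L) (p : E) (ξ : ℝ → E →L[ℝ] E)
    (h0 : ξ 0 = ContinuousLinearMap.id ℝ E)
    (hξ : ∀ v s, HasDerivAt (fun s => ξ s v) (fderiv ℝ W (Φ s p) (ξ s v)) s) (S : ℝ) (hS : 0 ≤ S) :
    HasFDerivAt (Φ S) (ξ S) p := by
  have hM : 0 ≤ M := (norm_nonneg _).trans (h.norm_le p)
  rw [hasFDerivAt_iff_isLittleO_nhds_zero, Asymptotics.isLittleO_iff]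
  intro ε hε
  set c : ℝ := Real.exp ((L + 1) * S) with hc
  set d : ℝ := Real.exp (L * S) with hd
  have hcpos : 0 < c := Real.exp_pos _
  have hdpos : 0 < d := Real.exp_pos _
  set ε' : ℝ := ε / (c * d) with hε'
  have hε'pos : 0 < ε' := by positivity
  -- Up to time S, orbits starting within distance 1 of p remain in the ball of this radius.
  set R : ℝ := 1 + M * S with hR
  have huc : UniformContinuousOn (fderiv ℝ W) (Metric.closedBall p R) :=
    (isCompact_closedBall p R).uniformContinuousOn_of_continuous
      (h.contDiff.continuous_fderiv one_ne_zero).continuousOn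
  rw [Metric.uniformContinuousOn_iff] at huc
  obtain ⟨δ, hδ, huc⟩ := huc ε' hε'pos
  have hball : ∀ᶠ v : E in 𝓝 0, ‖v‖ < min 1 (δ / d) := by
    have := Metric.ball_mem_nhds (0 : E) (show 0 < min 1 (δ / d) by positivity)
    filter_upwards [this] with v hv using by simpa using hv
  filter_upwards [hball] with v hv
  have hv1 : ‖v‖ < 1 := hv.trans_le (min_le_left _ _)
  have hvδ : ‖v‖ * d < δ := by
    rw [← lt_div_iff₀ hdpos]; exact hv.trans_le (min_le_right _ _)
  have hmem : ∀ s ∈ Ico 0 S, ∀ w : E, ‖w‖ ≤ 1 → Φ s (p + w) ∈ Metric.closedBall p R := by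
    intro s hs w hw
    rw [Metric.mem_closedBall, dist_eq_norm]
    have h1 := h.norm_sub_le (p + w) s 0
    rw [h.map_zero, sub_zero, abs_of_nonneg hs.1] at h1
    calc ‖Φ s (p + w) - p‖ = ‖(Φ s (p + w) - (p + w)) + w‖ := by congr 1; abel
      _ ≤ M * s + 1 := (norm_add_le _ _).trans (add_le_add h1 hw)
      _ ≤ R := by rw [hR]; nlinarith [hs.2]
  have hdiff : ∀ x, DifferentiableAt ℝ W x := h.contDiff.differentiable one_ne_zero
  -- The rate L + 1 instead of L is nonzero even if L = 0, so that the closed formula for the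
  -- Grönwall bound applies.
  have hgron := norm_le_gronwallBound_of_norm_deriv_right_le
    (f := fun s => Φ s (p + v) - Φ s p - ξ s v)
    (f' := fun s => W (Φ s (p + v)) - W (Φ s p) - fderiv ℝ W (Φ s p) (ξ s v))
    (δ := 0) (K := L + 1) (ε := ε' * (‖v‖ * d)) (a := 0) (b := S)
    (fun s _ => (((h.hasDerivAt (p + v) s).sub (h.hasDerivAt p s)).sub
      (hξ v s)).continuousAt.continuousWithinAt)
    (fun s _ => (((h.hasDerivAt (p + v) s).sub (h.hasDerivAt p s)).sub (hξ v s)).hasDerivWithinAt)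
    (by simp [h.map_zero, h0]) ?_ S (right_mem_Icc.2 hS)
  · have hL1 : (L : ℝ) + 1 ≠ 0 := by positivity
    rw [gronwallBound_of_K_ne_0 hL1] at hgron
    refine hgron.trans ?_
    simp only [zero_mul, zero_add, sub_zero]
    have h1 : ε' * (‖v‖ * d) / (L + 1) ≤ ε' * (‖v‖ * d) :=
      div_le_self (by positivity) (by simp)
    calc ε' * (‖v‖ * d) / (L + 1) * (c - 1) ≤ ε' * (‖v‖ * d) * c := by
          have hc1 : 1 ≤ c := Real.one_le_exp (by positivity)
          exact mul_le_mul h1 (by linarith) (by linarith) (by positivity)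
      _ = ε * ‖v‖ := by rw [hε']; field_simp
  · intro s hs
    have hpb : Φ s p ∈ Metric.closedBall p R := by simpa using hmem s hs 0 (by simp)
    have hvb := hmem s hs v hv1.le
    have hdist : ‖Φ s (p + v) - Φ s p‖ ≤ ‖v‖ * d := by
      refine (h.norm_map_sub_map_le _ _ s).trans ?_
      rw [add_sub_cancel_left, abs_of_nonneg hs.1, hd]
      gcongr
      exact hs.2.le
    -- On this convex intersection DW stays within ε' of its value at Φ_s p, so the mean value
    -- inequality bounds the Taylor remainder of W.
    have hT := ((convex_closedBall p R).inter (convex_ball (Φ s p) δ)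
      ).norm_image_sub_le_of_norm_fderiv_le' (f := W) (φ := fderiv ℝ W (Φ s p)) (C := ε')
      (fun x _ => hdiff x) (fun x hx => ?_) ⟨hpb, Metric.mem_ball_self hδ⟩
      (y := Φ s (p + v)) ⟨hvb, ?_⟩
    · calc ‖W (Φ s (p + v)) - W (Φ s p) - fderiv ℝ W (Φ s p) (ξ s v)‖
          = ‖fderiv ℝ W (Φ s p) (Φ s (p + v) - Φ s p - ξ s v) + (W (Φ s (p + v)) - W (Φ s p) -
              fderiv ℝ W (Φ s p) (Φ s (p + v) - Φ s p))‖ := by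
            congr 1; rw [_root_.map_sub]; abel
        _ ≤ L * ‖Φ s (p + v) - Φ s p - ξ s v‖ + ε' * (‖v‖ * d) := by
            refine (norm_add_le _ _).trans (add_le_add ?_ (hT.trans (by gcongr)))
            exact ContinuousLinearMap.le_of_opNorm_le _ (h.norm_fderiv_le _) _
        _ ≤ _ := by
            have := norm_nonneg (Φ s (p + v) - Φ s p - ξ s v)
            linarith
    · have := huc x hx.1 (Φ s p) hpb (Metric.mem_ball.1 hx.2)
      rw [dist_eq_norm] at this
      exact this.le
    · rw [Metric.mem_ball, dist_eq_norm]
      exact hdist.trans_lt hvδ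

/-- A solution of the variational equation along an orbit is the derivative of the flow with
respect to the initial point. -/
theorem hasFDerivAt [ProperSpace E] (h : IsC1Flow W Φ M L) (p : E) (ξ : ℝ → E →L[ℝ] E)
    (h0 : ξ 0 = ContinuousLinearMap.id ℝ E)
    (hξ : ∀ v s, HasDerivAt (fun s => ξ s v) (fderiv ℝ W (Φ s p) (ξ s v)) s) (S : ℝ) :
    HasFDerivAt (Φ S) (ξ S) p := by
  rcases le_total 0 S with hS | hS
  · exact h.hasFDerivAt_of_nonneg p ξ h0 hξ S hS
  · have := h.reverse.hasFDerivAt_of_nonneg p (fun s => ξ (-s)) (by simpa using h0)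
      (fun v s => ?_) (-S) (by linarith)
    · simpa using this
    · have hd := (hξ v (-s)).scomp s (hasDerivAt_neg s)
      rw [fderiv_fun_neg]
      simpa [Function.comp_def] using hd

end IsC1Flow

/-! ### Planar vector calculus -/

/-- Rotation of the plane by a right angle. -/
def rot (v : Plane) : Plane := !₂[-v 1, v 0]

/-- The determinant of two vectors of the plane. -/
def cross (u v : Plane) : ℝ := u 0 * v 1 - u 1 * v 0

/-- The scalar product of two vectors of the plane, in coordinates. -/
def dot (u v : Plane) : ℝ := u 0 * v 0 + u 1 * v 1

@[simp] theorem rot_zero_apply (v : Plane) : rot v 0 = -v 1 := rfl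

@[simp] theorem rot_one_apply (v : Plane) : rot v 1 = v 0 := rfl

theorem plane_ext {u v : Plane} (h0 : u 0 = v 0) (h1 : u 1 = v 1) : u = v := by
  ext i
  fin_cases i
  · exact h0
  · exact h1

theorem dot_self (v : Plane) : dot v v = ‖v‖ ^ 2 := by
  rw [EuclideanSpace.norm_sq_eq, Fin.sum_univ_two, dot]
  simp [pow_two]

theorem norm_rot (v : Plane) : ‖rot v‖ = ‖v‖ := by
  have : ‖rot v‖ ^ 2 = ‖v‖ ^ 2 := by
    rw [← dot_self, ← dot_self, dot, dot]; simp only [rot_zero_apply, rot_one_apply]; ring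
  exact (sq_eq_sq₀ (norm_nonneg _) (norm_nonneg _)).1 this

theorem inner_eq_dot (u v : Plane) : inner ℝ u v = dot u v := by
  rw [PiLp.inner_apply, Fin.sum_univ_two, dot]
  simp [mul_comm]

theorem inner_rot_eq_cross (u v : Plane) : inner ℝ (rot u) v = cross u v := by
  rw [inner_eq_dot, dot, cross]; simp only [rot_zero_apply, rot_one_apply]; ring

theorem abs_dot_le (u v : Plane) : |dot u v| ≤ ‖u‖ * ‖v‖ := by
  rw [← inner_eq_dot]; exact abs_real_inner_le_norm u v

theorem abs_cross_le (u v : Plane) : |cross u v| ≤ ‖u‖ * ‖v‖ := by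
  rw [← inner_rot_eq_cross, ← norm_rot u]; exact abs_real_inner_le_norm _ v

theorem cross_rot_self (u : Plane) : cross u (rot u) = ‖u‖ ^ 2 := by
  rw [← dot_self, cross, dot]; simp only [rot_zero_apply, rot_one_apply]; ring

/-- The first basis vector of the plane. -/
def ex : Plane := !₂[1, 0]

/-- The second basis vector of the plane. -/
def ey : Plane := !₂[0, 1]

theorem eq_smul_ex_add_smul_ey (v : Plane) : v = v 0 • ex + v 1 • ey :=
  plane_ext (by simp [ex, ey]) (by simp [ex, ey])

theorem clm_apply_coord (A : Plane →L[ℝ] Plane) (v : Plane) (i : Fin 2) :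
    A v i = v 0 * A ex i + v 1 * A ey i := by
  conv_lhs => rw [eq_smul_ex_add_smul_ey v, map_add, map_smul, map_smul]
  simp

/-- Decomposition of a vector along `u` and `rot u`. -/
theorem decompose (u v : Plane) (hu : u ≠ 0) :
    v = (dot u v / ‖u‖ ^ 2) • u + (cross u v / ‖u‖ ^ 2) • rot u := by
  have h : ‖u‖ ^ 2 ≠ 0 := by positivity
  rw [← dot_self] at h ⊢
  rw [dot, ← pow_two, ← pow_two] at h
  refine plane_ext ?_ ?_ <;> simp only [dot, cross, PiLp.add_apply, PiLp.smul_apply, smul_eq_mul,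
    rot_zero_apply, rot_one_apply] <;> field_simp <;> ring

theorem hasDerivAt_coord {γ : ℝ → Plane} {v : Plane} {s : ℝ} (h : HasDerivAt γ v s) (i : Fin 2) :
    HasDerivAt (fun s => γ s i) (v i) s :=
  (EuclideanSpace.proj (𝕜 := ℝ) i).hasFDerivAt.comp_hasDerivAt s h

theorem hasDerivAt_of_coord {γ : ℝ → Plane} {v : Plane} {s : ℝ}
    (h0 : HasDerivAt (fun s => γ s 0) (v 0) s) (h1 : HasDerivAt (fun s => γ s 1) (v 1) s) :
    HasDerivAt γ v s := by
  rw [eq_smul_ex_add_smul_ey v, show γ = fun s => γ s 0 • ex + γ s 1 • ey from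
    funext fun s => eq_smul_ex_add_smul_ey (γ s)]
  exact (h0.smul_const ex).add (h1.smul_const ey)

/-- The divergence of a planar vector field. -/
noncomputable def divergence (W : Plane → Plane) (p : Plane) : ℝ :=
  fderiv ℝ W p ex 0 + fderiv ℝ W p ey 1

/-- The acceleration of the orbits of a planar vector field. -/
noncomputable def acceleration (W : Plane → Plane) (p : Plane) : Plane := fderiv ℝ W p (W p)

/-- The transverse part of the acceleration of the orbits of `W`. -/
noncomputable def bending (W : Plane → Plane) (p : Plane) : ℝ := cross (W p) (acceleration W p)

/-- The rate at which vectors orthogonal to `W` are sheared along `W` by the flow of `W`. -/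
noncomputable def shear (W : Plane → Plane) (p : Plane) : ℝ :=
  (dot (fderiv ℝ W p (rot (W p))) (W p) + bending W p) / ‖W p‖ ^ 2

namespace IsC1Flow

open scoped NNReal

variable {W : Plane → Plane} {Φ : ℝ → Plane → Plane} {M : ℝ} {L : ℝ≥0}

theorem continuous_divergence (h : IsC1Flow W Φ M L) : Continuous (divergence W) := by
  have := h.contDiff.continuous_fderiv one_ne_zero
  unfold divergence
  fun_prop

theorem continuous_acceleration (h : IsC1Flow W Φ M L) : Continuous (acceleration W) :=
  (h.contDiff.continuous_fderiv one_ne_zero).clm_apply h.contDiff.continuous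

theorem continuous_bending (h : IsC1Flow W Φ M L) : Continuous (bending W) := by
  have h1 := h.continuous_acceleration
  have h2 := h.contDiff.continuous
  unfold bending cross
  fun_prop

theorem continuous_shear (h : IsC1Flow W Φ M L) (h0 : ∀ p, W p ≠ 0) : Continuous (shear W) := by
  have h1 := h.continuous_bending
  have h2 := h.contDiff.continuous
  have hr : Continuous fun p => rot (W p) := by
    unfold rot
    fun_prop
  have h3 := (h.contDiff.continuous_fderiv one_ne_zero).clm_apply hr
  unfold shear dot
  refine Continuous.div (by fun_prop) (by fun_prop) fun p => ?_
  have := h0 p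
  positivity

theorem hasDerivAt_field (h : IsC1Flow W Φ M L) (p : Plane) (s : ℝ) :
    HasDerivAt (fun s => W (Φ s p)) (acceleration W (Φ s p)) s :=
  ((h.contDiff.differentiable one_ne_zero (Φ s p)).hasFDerivAt).comp_hasDerivAt s
    (h.hasDerivAt p s)

end IsC1Flow

/-! ### The derivative of a planar flow in the moving frame (W, rot W) -/

/-- The determinant of the derivative of the flow `Φ` of `W` at time `s`. -/
noncomputable def flowJacobian (W : Plane → Plane) (Φ : ℝ → Plane → Plane) (p : Plane) (s : ℝ) :
    ℝ :=
  Real.exp (∫ u in (0 : ℝ)..s, divergence W (Φ u p))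

/-- The component along `rot W` of the image of `rot W` under the derivative of the flow. -/
noncomputable def flowNormal (W : Plane → Plane) (Φ : ℝ → Plane → Plane) (p : Plane) (s : ℝ) : ℝ :=
  flowJacobian W Φ p s * ‖W p‖ ^ 2 / ‖W (Φ s p)‖ ^ 2

/-- The component along `W` of the image of `rot W` under the derivative of the flow. -/
noncomputable def flowShear (W : Plane → Plane) (Φ : ℝ → Plane → Plane) (p : Plane) (s : ℝ) : ℝ :=
  ∫ u in (0 : ℝ)..s, flowNormal W Φ p u * shear W (Φ u p)

/-- The derivative of the flow of `W` with respect to the initial point. -/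
noncomputable def flowDeriv (W : Plane → Plane) (Φ : ℝ → Plane → Plane) (p : Plane) (s : ℝ) :
    Plane →L[ℝ] Plane :=
  ((‖W p‖ ^ 2)⁻¹ • innerSL ℝ (W p)).smulRight (W (Φ s p)) +
    ((‖W p‖ ^ 2)⁻¹ • innerSL ℝ (rot (W p))).smulRight
      (flowShear W Φ p s • W (Φ s p) + flowNormal W Φ p s • rot (W (Φ s p)))

theorem flowDeriv_apply (W : Plane → Plane) (Φ : ℝ → Plane → Plane) (p : Plane) (s : ℝ)
    (v : Plane) : flowDeriv W Φ p s v = (dot (W p) v / ‖W p‖ ^ 2) • W (Φ s p) +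
      (cross (W p) v / ‖W p‖ ^ 2) •
        (flowShear W Φ p s • W (Φ s p) + flowNormal W Φ p s • rot (W (Φ s p))) := by
  simp only [flowDeriv, add_apply, ContinuousLinearMap.smulRight_apply, smul_apply,
    innerSL_apply_apply, inner_eq_dot (W p), inner_rot_eq_cross, smul_eq_mul]
  congr 2 <;> ring

namespace IsC1Flow

open scoped NNReal

variable {W : Plane → Plane} {Φ : ℝ → Plane → Plane} {M : ℝ} {L : ℝ≥0}

theorem hasDerivAt_flowJacobian (h : IsC1Flow W Φ M L) (p : Plane) (s : ℝ) :
    HasDerivAt (flowJacobian W Φ p) (flowJacobian W Φ p s * divergence W (Φ s p)) s := by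
  have hc : Continuous fun u => divergence W (Φ u p) :=
    h.continuous_divergence.comp (h.continuous_orbit p)
  exact (intervalIntegral.integral_hasDerivAt_right (hc.intervalIntegrable _ _)
    (hc.stronglyMeasurableAtFilter _ _) hc.continuousAt).exp

theorem flowJacobian_pos (p : Plane) (s : ℝ) : 0 < flowJacobian W Φ p s := Real.exp_pos _

theorem hasDerivAt_normSq (h : IsC1Flow W Φ M L) (p : Plane) (s : ℝ) :
    HasDerivAt (fun s => ‖W (Φ s p)‖ ^ 2) (2 * dot (W (Φ s p)) (acceleration W (Φ s p))) s := by
  have h0 := hasDerivAt_coord (h.hasDerivAt_field p s) 0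
  have h1 := hasDerivAt_coord (h.hasDerivAt_field p s) 1
  simp only [← dot_self, dot]
  refine ((h0.mul h0).add (h1.mul h1)).congr_deriv ?_
  ring

theorem hasDerivAt_flowNormal (h : IsC1Flow W Φ M L) (h0 : ∀ p, W p ≠ 0) (p : Plane) (s : ℝ) :
    HasDerivAt (flowNormal W Φ p) (flowNormal W Φ p s * (divergence W (Φ s p) -
      2 * dot (W (Φ s p)) (acceleration W (Φ s p)) / ‖W (Φ s p)‖ ^ 2)) s := by
  have hn : ‖W (Φ s p)‖ ≠ 0 := norm_ne_zero_iff.2 (h0 _)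
  have hne : ‖W (Φ s p)‖ ^ 2 ≠ 0 := pow_ne_zero 2 hn
  refine (((h.hasDerivAt_flowJacobian p s).mul_const (‖W p‖ ^ 2)).div
    (h.hasDerivAt_normSq p s) hne).congr_deriv ?_
  rw [flowNormal]
  field_simp

theorem hasDerivAt_flowShear (h : IsC1Flow W Φ M L) (h0 : ∀ p, W p ≠ 0) (p : Plane) (s : ℝ) :
    HasDerivAt (flowShear W Φ p) (flowNormal W Φ p s * shear W (Φ s p)) s := by
  have hc : Continuous fun u => flowNormal W Φ p u * shear W (Φ u p) :=
    (continuous_iff_continuousAt.2 fun u => (h.hasDerivAt_flowNormal h0 p u).continuousAt).mul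
      ((h.continuous_shear h0).comp (h.continuous_orbit p))
  exact intervalIntegral.integral_hasDerivAt_right (hc.intervalIntegrable _ _)
    (hc.stronglyMeasurableAtFilter _ _) hc.continuousAt

/-- The explicit frame formula solves the variational equation. The curve W(Φ_s p) does so on its
own, and the two scalar coefficients were chosen so that the image of rot W does as well. -/
theorem hasDerivAt_flowDeriv (h : IsC1Flow W Φ M L) (h0 : ∀ p, W p ≠ 0) (p v : Plane) (s : ℝ) :
    HasDerivAt (fun s => flowDeriv W Φ p s v)
      (fderiv ℝ W (Φ s p) (flowDeriv W Φ p s v)) s := by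
  have hne : ‖W (Φ s p)‖ ^ 2 ≠ 0 := by have := h0 (Φ s p); positivity
  have hW := h.hasDerivAt_field p s
  have hW0 := hasDerivAt_coord hW 0
  have hW1 := hasDerivAt_coord hW 1
  have hR : HasDerivAt (fun s => rot (W (Φ s p))) (rot (acceleration W (Φ s p))) s :=
    hasDerivAt_of_coord hW1.neg hW0
  have hS := h.hasDerivAt_flowShear h0 p s
  have hN := h.hasDerivAt_flowNormal h0 p s
  simp only [flowDeriv_apply]
  refine ((hW.const_smul (dot (W p) v / ‖W p‖ ^ 2)).add
    (((hS.smul hW).add (hN.smul hR)).const_smul (cross (W p) v / ‖W p‖ ^ 2))).congr_deriv ?_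
  simp only [_root_.map_add, map_smul, smul_add, smul_smul]
  set a := flowShear W Φ p s
  set c := flowNormal W Φ p s
  set w := W (Φ s p) with hw
  set A := fderiv ℝ W (Φ s p) with hA
  have hacc : acceleration W (Φ s p) = A w := rfl
  -- Planar linear algebra: A (rot w) is expressed in the frame through rot (A w), the trace of A,
  -- and scalar products with w.
  have key : c • rot (acceleration W (Φ s p)) + (c * (divergence W (Φ s p) -
      2 * dot w (acceleration W (Φ s p)) / ‖w‖ ^ 2)) • rot w +
      (c * shear W (Φ s p)) • w = c • A (rot w) := by
    simp only [shear, bending, divergence, ← hA, ← hw, hacc]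
    rw [← dot_self] at hne ⊢
    refine plane_ext ?_ ?_
    all_goals
      simp only [PiLp.add_apply, PiLp.smul_apply, smul_eq_mul, rot_zero_apply, rot_one_apply, dot,
        cross, clm_apply_coord A w, clm_apply_coord A (rot w)]
      simp only [dot, ← pow_two] at hne
      field_simp
      ring
  rw [hacc] at key ⊢
  have := congrArg (fun z => (cross (W p) v / ‖W p‖ ^ 2) • z) key
  simp only [smul_add, smul_smul] at this
  rw [← this]
  abel

theorem flowDeriv_zero (h : IsC1Flow W Φ M L) (h0 : ∀ p, W p ≠ 0) (p : Plane) :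
    flowDeriv W Φ p 0 = ContinuousLinearMap.id ℝ Plane := by
  ext1 v
  have hne : ‖W p‖ ^ 2 ≠ 0 := by have := h0 p; positivity
  rw [flowDeriv_apply, h.map_zero, flowNormal, flowShear, flowJacobian, h.map_zero]
  simp only [intervalIntegral.integral_same, Real.exp_zero, one_mul, div_self hne, zero_smul,
    zero_add, one_smul]
  exact (decompose (W p) v (h0 p)).symm

theorem hasFDerivAt_flowDeriv (h : IsC1Flow W Φ M L) (h0 : ∀ p, W p ≠ 0) (p : Plane) (s : ℝ) :
    HasFDerivAt (Φ s) (flowDeriv W Φ p s) p :=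
  h.hasFDerivAt p _ (h.flowDeriv_zero h0 p) (h.hasDerivAt_flowDeriv h0 p) s

/-- Liouville's formula, read against the field: the components along W drop out, and the quotient
of squared norms in `flowNormal` cancels the lengths of the two frames. -/
theorem cross_flowDeriv (h0 : ∀ p, W p ≠ 0) (p v : Plane) (s : ℝ) :
    cross (W (Φ s p)) (flowDeriv W Φ p s v) = flowJacobian W Φ p s * cross (W p) v := by
  have h1 : ‖W (Φ s p)‖ ≠ 0 := norm_ne_zero_iff.2 (h0 _)
  have h2 : ‖W p‖ ≠ 0 := norm_ne_zero_iff.2 (h0 p)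
  have h3 : ∀ x y z : ℝ, ∀ u : Plane, cross u (x • u + y • (z • u + flowNormal W Φ p s • rot u)) =
      y * flowNormal W Φ p s * ‖u‖ ^ 2 := by
    intro x y z u
    rw [← dot_self]
    simp only [cross, dot, PiLp.add_apply, PiLp.smul_apply, smul_eq_mul, rot_zero_apply,
      rot_one_apply]
    ring
  rw [flowDeriv_apply, h3, flowNormal]
  field_simp

theorem isUnit_flowDeriv (h0 : ∀ p, W p ≠ 0) (p : Plane) (s : ℝ) :
    IsUnit (flowDeriv W Φ p s) := by
  have hinj : Function.Injective (flowDeriv W Φ p s) := by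
    rw [injective_iff_map_eq_zero]
    intro v hv
    have hc := cross_flowDeriv (Φ := Φ) h0 p v s
    rw [hv] at hc
    have hcr : cross (W p) v = 0 := by
      have : flowJacobian W Φ p s ≠ 0 := (flowJacobian_pos p s).ne'
      have h00 : cross (W (Φ s p)) 0 = 0 := by simp [cross]
      rw [h00] at hc
      exact (mul_eq_zero.1 hc.symm).resolve_left this
    rw [flowDeriv_apply, hcr, zero_div, zero_smul, add_zero] at hv
    have hd := (smul_eq_zero.1 hv).resolve_right (h0 _)
    rw [decompose (W p) v (h0 p), hcr, hd]
    simp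
  have hbij : Function.Bijective (flowDeriv W Φ p s : Plane →ₗ[ℝ] Plane) :=
    ⟨hinj, LinearMap.injective_iff_surjective.1 hinj⟩
  rw [ContinuousLinearMap.isUnit_iff_bijective]
  exact hbij

end IsC1Flow

/-! ### Functions that are smooth along the orbits of a flow -/

/-- The restrictions of `f` to the orbits of `Φ` are uniformly of class `C^(k+η)`. -/
def LeafClass (Φ : ℝ → Plane → Plane) (η : ℝ) (k : ℕ) (f : Plane → ℝ) : Prop :=
  ∃ B : ℝ, 0 ≤ B ∧ ∀ p, CurveClass η k B univ (fun s => f (Φ s p))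

namespace LeafClass

variable {Φ : ℝ → Plane → Plane} {η : ℝ} {k : ℕ} {f g : Plane → ℝ}

theorem add (hf : LeafClass Φ η k f) (hg : LeafClass Φ η k g) :
    LeafClass Φ η k (fun p => f p + g p) := by
  obtain ⟨B, hB, hf⟩ := hf
  obtain ⟨B', hB', hg⟩ := hg
  exact ⟨B + B', add_nonneg hB hB', fun p => (hf p).add (hg p)⟩

theorem neg (hf : LeafClass Φ η k f) : LeafClass Φ η k (fun p => -f p) := by
  obtain ⟨B, hB, hf⟩ := hf
  exact ⟨‖-ContinuousLinearMap.id ℝ ℝ‖ * B, by positivity,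
    fun p => (hf p).clm_apply (-ContinuousLinearMap.id ℝ ℝ)⟩

theorem sub (hf : LeafClass Φ η k f) (hg : LeafClass Φ η k g) :
    LeafClass Φ η k (fun p => f p - g p) := by
  simpa only [sub_eq_add_neg] using hf.add hg.neg

theorem const (c : ℝ) : LeafClass Φ η k (fun _ => c) :=
  ⟨‖c‖, norm_nonneg c, fun _ => CurveClass.const c⟩

theorem mul (hη : η ∈ Icc (0 : ℝ) 1) (hf : LeafClass Φ η k f) (hg : LeafClass Φ η k g) :
    LeafClass Φ η k (fun p => f p * g p) := by
  obtain ⟨B, hB, hf⟩ := hf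
  obtain ⟨B', hB', hg⟩ := hg
  exact ⟨_, by positivity,
    fun p => CurveClass.smul hη.1 hη.2 convex_univ hB hB' (hf p) (hg p)⟩

theorem inv (hη : η ∈ Icc (0 : ℝ) 1) (hf : LeafClass Φ η k f) {c : ℝ} (hc : 0 < c)
    (hfc : ∀ p, c ≤ |f p|) : LeafClass Φ η k (fun p => (f p)⁻¹) := by
  obtain ⟨B, hB, hf⟩ := hf
  obtain ⟨B', hB', h⟩ := CurveClass.inv hη.1 hη.2 convex_univ hc k B hB
  exact ⟨B', hB', fun p => h _ (hf p) fun s _ => hfc _⟩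

theorem lower (hη : η ∈ Icc (0 : ℝ) 1) (hf : LeafClass Φ η (k + 1) f) : LeafClass Φ η k f := by
  obtain ⟨B, hB, hf⟩ := hf
  exact ⟨2 * B, by positivity, fun p => (hf p).lower hη.1 hη.2 convex_univ hB⟩

theorem of_le (hη : η ∈ Icc (0 : ℝ) 1) {j : ℕ} (hjk : j ≤ k) (hf : LeafClass Φ η k f) :
    LeafClass Φ η j f := by
  induction hjk with
  | refl => exact hf
  | step _ ih => exact ih (hf.lower hη)

theorem continuous (hf : LeafClass Φ η k f) (p : Plane) : Continuous fun s => f (Φ s p) := by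
  obtain ⟨B, -, hf⟩ := hf
  exact continuousOn_univ.1 (hf p).continuousOn

theorem of_hasDerivAt {B : ℝ} (hB : ∀ p, |f p| ≤ B)
    (hfg : ∀ p s, HasDerivAt (fun s => f (Φ s p)) (g (Φ s p)) s) (hg : LeafClass Φ η k g) :
    LeafClass Φ η (k + 1) f := by
  obtain ⟨B', hB', hg⟩ := hg
  refine ⟨max B B', hB'.trans (le_max_right _ _), fun p =>
    ⟨fun s _ => (hB _).trans (le_max_left _ _), fun s => g (Φ s p), fun s _ => hfg p s,
      (hg p).mono (le_max_right _ _)⟩⟩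

end LeafClass

namespace IsC1Flow

open scoped NNReal

variable {W : Plane → Plane} {Φ : ℝ → Plane → Plane} {M : ℝ} {L : ℝ≥0} {η : ℝ} {k : ℕ}
  {f : Plane → ℝ}

theorem exists_abs_le (h : IsC1Flow W Φ M L) (hf : LeafClass Φ η k f) :
    ∃ B, 0 ≤ B ∧ ∀ p, |f p| ≤ B := by
  obtain ⟨B, hB, hf⟩ := hf
  refine ⟨B, hB, fun p => ?_⟩
  simpa [h.map_zero] using (hf p).norm_le 0 (mem_univ _)

/-- Differentiating at time 0 on each orbit defines a function of the point. The group law of the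
flow shows that it gives the derivative at all times. -/
theorem exists_leafDeriv (h : IsC1Flow W Φ M L) (hf : LeafClass Φ η (k + 1) f) :
    ∃ g, (∀ p s, HasDerivAt (fun s => f (Φ s p)) (g (Φ s p)) s) ∧ LeafClass Φ η k g := by
  obtain ⟨B, hB, hf⟩ := hf
  choose hb g' hg' hk using hf
  have key : ∀ p s, g' (Φ s p) 0 = g' p s := by
    intro p s
    have h1 := hg' (Φ s p) 0 (mem_univ _)
    have h2 := (hg' p (s + 0) (mem_univ _)).comp_const_add s 0
    simp only [h.map_add] at h2
    rw [add_zero] at h2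
    exact h1.unique h2
  refine ⟨fun p => g' p 0, fun p s => ?_, B, hB, fun p => ?_⟩
  · exact (hg' p s (mem_univ _)).congr_deriv (key p s).symm
  · simpa only [key] using hk p

end IsC1Flow

/-! ### Cohomological equations along orbits -/

/-- The map `T` sends orbits of `Φ` to orbits of `Φ`, changing the speed by the factor `σ`. -/
def Intertwines (Φ : ℝ → Plane → Plane) (T : Plane → Plane) (σ : Plane → ℝ) : Prop :=
  ∀ p, ∃ τ : ℝ → ℝ, τ 0 = 0 ∧ (∀ s, HasDerivAt τ (σ (Φ s p)) s) ∧
    ∀ s, T (Φ s p) = Φ (τ s) (T p)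

/-- The multiplicative cocycle over `T` generated by `m`. -/
def cocycle (T : Plane → Plane) (m : Plane → ℝ) : ℕ → Plane → ℝ
  | 0, _ => 1
  | n + 1, p => m p * cocycle T m n (T p)

namespace Intertwines

variable {Φ : ℝ → Plane → Plane} {T : Plane → Plane} {σ : Plane → ℝ} {η : ℝ} {f : Plane → ℝ}

theorem iterate (hT : Intertwines Φ T σ) (n : ℕ) : Intertwines Φ (T^[n]) (cocycle T σ n) := by
  induction n with
  | zero => exact fun p => ⟨id, rfl, fun s => hasDerivAt_id s, fun s => rfl⟩
  | succ n ih =>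
    intro p
    obtain ⟨τ, hτ0, hτ, hτT⟩ := hT p
    obtain ⟨τ', hτ0', hτ', hτT'⟩ := ih (T p)
    refine ⟨τ' ∘ τ, by simp [hτ0, hτ0'], fun s => ?_, fun s => ?_⟩
    · refine ((hτ' (τ s)).comp s (hτ s)).congr_deriv ?_
      rw [cocycle, hτT s, mul_comm]
    · rw [Function.iterate_succ_apply, Function.iterate_succ_apply, hτT s, hτT' (τ s)]
      rfl

theorem abs_sub_le {c : ℝ} (hσ : ∀ p, |σ p| ≤ c) {p : Plane} {τ : ℝ → ℝ}
    (hτ : ∀ s, HasDerivAt τ (σ (Φ s p)) s) (s s' : ℝ) : |τ s - τ s'| ≤ c * |s - s'| := by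
  have := convex_univ.norm_image_sub_le_of_norm_hasDerivWithin_le (f := τ)
    (fun x _ => (hτ x).hasDerivWithinAt) (fun x _ => hσ _) (mem_univ s') (mem_univ s)
  simpa using this

theorem continuous_comp (hT : Intertwines Φ T σ) (hf : ∀ p, Continuous fun s => f (Φ s p))
    (p : Plane) : Continuous fun s => f (T (Φ s p)) := by
  obtain ⟨τ, -, hτ, hτT⟩ := hT p
  simp only [hτT]
  exact (hf (T p)).comp (continuous_iff_continuousAt.2 fun s => (hτ s).continuousAt)

theorem hasDerivAt_comp (hT : Intertwines Φ T σ) {g : Plane → ℝ}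
    (hfg : ∀ p s, HasDerivAt (fun s => f (Φ s p)) (g (Φ s p)) s) (p : Plane) (s : ℝ) :
    HasDerivAt (fun s => f (T (Φ s p))) (g (T (Φ s p)) * σ (Φ s p)) s := by
  obtain ⟨τ, -, hτ, hτT⟩ := hT p
  simp only [hτT]
  exact (hfg (T p) (τ s)).comp s (hτ s)

end Intertwines

namespace IsC1Flow

open scoped NNReal

variable {W : Plane → Plane} {Φ : ℝ → Plane → Plane} {M : ℝ} {L : ℝ≥0} {η : ℝ}
  {T : Plane → Plane} {σ : Plane → ℝ}

/-- The derivative of f ∘ T along orbits is (f' ∘ T) σ, so order k of the composition uses σ only at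
orders below k. This gap lets σ itself be treated by induction later. -/
theorem leafClass_comp (h : IsC1Flow W Φ M L) (hη : η ∈ Icc (0 : ℝ) 1) (hT : Intertwines Φ T σ)
    {c : ℝ} (hc : 0 ≤ c) (hσ : ∀ p, |σ p| ≤ c) : ∀ {k : ℕ} {f : Plane → ℝ},
    (∀ j < k, LeafClass Φ η j σ) → LeafClass Φ η k f → LeafClass Φ η k (fun p => f (T p)) := by
  intro k
  induction k with
  | zero =>
    intro f _ hf
    have hcont := hT.continuous_comp hf.continuous
    obtain ⟨B, hB, hf⟩ := hf
    refine ⟨B + B * c ^ η, by positivity, fun p => ?_⟩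
    refine ⟨(hcont p).continuousOn, ?_, ?_⟩
    all_goals
      obtain ⟨τ, -, hτ, hτT⟩ := hT p
      simp only [hτT]
    · intro s _
      exact ((hf (T p)).2.1 (τ s) (mem_univ _)).trans (le_add_of_nonneg_right (by positivity))
    · intro s _ s' _
      refine ((hf (T p)).2.2 (τ s) (mem_univ _) (τ s') (mem_univ _)).trans ?_
      calc B * |τ s - τ s'| ^ η ≤ B * (c * |s - s'|) ^ η := by
            gcongr
            · exact hη.1
            · exact Intertwines.abs_sub_le hσ hτ s s'
        _ = B * c ^ η * |s - s'| ^ η := by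
            rw [Real.mul_rpow hc (abs_nonneg _), mul_assoc]
        _ ≤ _ := by gcongr; exact le_add_of_nonneg_left hB
  | succ k ih =>
    intro f hσk hf
    obtain ⟨B, hB, hfB⟩ := h.exists_abs_le hf
    obtain ⟨g, hfg, hg⟩ := h.exists_leafDeriv hf
    exact LeafClass.of_hasDerivAt (fun p => hfB (T p)) (hT.hasDerivAt_comp hfg)
      ((ih (fun j hj => hσk j (by omega)) hg).mul hη (hσk k (by omega)))

/-- A bounded solution of a contracting cohomological equation which is continuous along orbits
is Hölder along orbits. -/
theorem leafClass_zero_of_cohomological (hη : η ∈ Icc (0 : ℝ) 1)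
    (hT : Intertwines Φ T σ) (hσ : ∀ p, |σ p| ≤ 1) {f m u : Plane → ℝ}
    (hf : LeafClass Φ η 0 f) (hm : LeafClass Φ η 0 m) (hm2 : ∀ p, |m p| ≤ 1 / 2)
    {H : ℝ} (hH : ∀ p, |u p| ≤ H) (hcont : ∀ p, Continuous fun s => u (Φ s p))
    (heq : ∀ p, u p = f p + m p * u (T p)) : LeafClass Φ η 0 u := by
  obtain ⟨B₁, hB₁, hf⟩ := hf
  obtain ⟨B₂, hB₂, hm⟩ := hm
  have hH0 : 0 ≤ H := (abs_nonneg _).trans (hH 0)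
  set D := B₁ + B₂ * H with hD
  have hD0 : 0 ≤ D := by positivity
  -- One use of the equation turns a bound X for the oscillation into D |s - s'|^η + X/2, since `T`
  -- does not lengthen times. The fixed point is 2D |s - s'|^η, and the crude initial bound 2H is
  -- halved at each step.
  have key : ∀ n : ℕ, ∀ p s s', |u (Φ s p) - u (Φ s' p)| ≤
      2 * D * |s - s'| ^ η + (1 / 2) ^ n * (2 * H) := by
    intro n
    induction n with
    | zero =>
      intro p s s'
      have h1 : |u (Φ s p) - u (Φ s' p)| ≤ |u (Φ s p)| + |u (Φ s' p)| := abs_sub _ _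
      have h2 : 0 ≤ 2 * D * |s - s'| ^ η := by positivity
      have h3 := hH (Φ s p)
      have h4 := hH (Φ s' p)
      rw [pow_zero]; linarith
    | succ n ih =>
      intro p s s'
      obtain ⟨τ, -, hτ, hτT⟩ := hT p
      have h1 := (hf p).2.2 s (mem_univ _) s' (mem_univ _)
      have h2 := (hm p).2.2 s (mem_univ _) s' (mem_univ _)
      simp only [Real.norm_eq_abs] at h1 h2
      have h3 := ih (T p) (τ s) (τ s')
      have h4 : |τ s - τ s'| ^ η ≤ |s - s'| ^ η := by
        refine Real.rpow_le_rpow (abs_nonneg _) ?_ hη.1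
        simpa using Intertwines.abs_sub_le hσ hτ s s'
      calc |u (Φ s p) - u (Φ s' p)|
          = |(f (Φ s p) - f (Φ s' p)) + (m (Φ s p) - m (Φ s' p)) * u (T (Φ s p)) +
              m (Φ s' p) * (u (Φ (τ s) (T p)) - u (Φ (τ s') (T p)))| := by
            rw [heq (Φ s p), heq (Φ s' p), ← hτT s, ← hτT s']; congr 1; ring
        _ ≤ |f (Φ s p) - f (Φ s' p)| + |m (Φ s p) - m (Φ s' p)| * |u (T (Φ s p))| +
              |m (Φ s' p)| * |u (Φ (τ s) (T p)) - u (Φ (τ s') (T p))| := by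
            rw [← abs_mul, ← abs_mul]; exact abs_add_three _ _ _
        _ ≤ B₁ * |s - s'| ^ η + (B₂ * |s - s'| ^ η) * H +
              1 / 2 * (2 * D * |τ s - τ s'| ^ η + (1 / 2) ^ n * (2 * H)) := by
            gcongr
            · exact hH _
            · exact hm2 _
        _ ≤ B₁ * |s - s'| ^ η + (B₂ * |s - s'| ^ η) * H +
              1 / 2 * (2 * D * |s - s'| ^ η + (1 / 2) ^ n * (2 * H)) := by gcongr
        _ = _ := by rw [hD]; ring
  have key' : ∀ p s s', |u (Φ s p) - u (Φ s' p)| ≤ 2 * D * |s - s'| ^ η := by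
    intro p s s'
    have hlim : Tendsto (fun n : ℕ => 2 * D * |s - s'| ^ η + (1 / 2) ^ n * (2 * H)) atTop
        (𝓝 (2 * D * |s - s'| ^ η + 0 * (2 * H))) :=
      ((tendsto_pow_atTop_nhds_zero_of_lt_one (by norm_num) (by norm_num)).mul_const _).const_add _
    rw [zero_mul, add_zero] at hlim
    exact ge_of_tendsto' hlim fun n => key n p s s'
  refine ⟨H + 2 * D, by positivity, fun p => ⟨(hcont p).continuousOn, fun s _ => ?_,
    fun s _ s' _ => ?_⟩⟩
  · exact (hH _).trans (by linarith)
  · refine (key' p s s').trans ?_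
    gcongr
    linarith

/-- The terms of the series solving a contracting cohomological equation. -/
def cohomTerm (T : Plane → Plane) (f m : Plane → ℝ) : ℕ → Plane → ℝ
  | 0, p => f p
  | n + 1, p => m p * cohomTerm T f m n (T p)

/-- The derivatives along orbits of the terms `cohomTerm`. -/
def cohomTermDeriv (T : Plane → Plane) (σ f m f' m' : Plane → ℝ) : ℕ → Plane → ℝ
  | 0, p => f' p
  | n + 1, p => m' p * cohomTerm T f m n (T p) +
      m p * (cohomTermDeriv T σ f m f' m' n (T p) * σ p)

/-- A bounded solution of a contracting cohomological equation with coefficients differentiable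
along orbits is differentiable along orbits. -/
theorem exists_leafDeriv_of_cohomological (hT : Intertwines Φ T σ)
    (hσ : ∀ p, |σ p| ≤ 1) (hσc : ∀ p, Continuous fun s => σ (Φ s p))
    {f m f' m' u : Plane → ℝ} {B H : ℝ} (hB : 0 ≤ B)
    (hf : ∀ p s, HasDerivAt (fun s => f (Φ s p)) (f' (Φ s p)) s)
    (hm : ∀ p s, HasDerivAt (fun s => m (Φ s p)) (m' (Φ s p)) s)
    (hfc : ∀ p, Continuous fun s => f' (Φ s p)) (hmc : ∀ p, Continuous fun s => m' (Φ s p))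
    (hfB : ∀ p, |f p| ≤ B) (hfB' : ∀ p, |f' p| ≤ B) (hmB' : ∀ p, |m' p| ≤ B)
    (hm2 : ∀ p, |m p| ≤ 1 / 2) (hH : ∀ p, |u p| ≤ H) (heq : ∀ p, u p = f p + m p * u (T p)) :
    ∃ u' : Plane → ℝ, (∃ H', ∀ p, |u' p| ≤ H') ∧ (∀ p, Continuous fun s => u' (Φ s p)) ∧
      ∀ p s, HasDerivAt (fun s => u (Φ s p)) (u' (Φ s p)) s := by
  set d := cohomTerm T f m with hd
  set e := cohomTermDeriv T σ f m f' m' with he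
  have hdB : ∀ n p, |d n p| ≤ B * (1 / 2) ^ n := by
    intro n
    induction n with
    | zero => intro p; rw [pow_zero, mul_one]; exact hfB p
    | succ n ih =>
      intro p
      calc |d (n + 1) p| = |m p| * |d n (T p)| := abs_mul _ _
        _ ≤ 1 / 2 * (B * (1 / 2) ^ n) := by gcongr; exacts [hm2 p, ih (T p)]
        _ = _ := by ring
  -- Differentiating a product of n contracting factors costs a factor of order n, absorbed by
  -- weakening the rate 1/2 to 3/4. The constant 4B² is the solution X of B² + X/2 = 3X/4.
  have heB : ∀ n p, |e n p| ≤ (B + 4 * B * B) * (3 / 4) ^ n := by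
    intro n
    induction n with
    | zero =>
      intro p
      rw [pow_zero, mul_one]
      exact (hfB' p).trans (le_add_of_nonneg_right (by positivity))
    | succ n ih =>
      intro p
      have h12 : (1 / 2 : ℝ) ^ n ≤ (3 / 4) ^ n :=
        pow_le_pow_left₀ (by norm_num) (by norm_num) n
      have h34 : (0 : ℝ) ≤ (3 / 4) ^ n := by positivity
      calc |e (n + 1) p| ≤ |m' p| * |d n (T p)| + |m p| * (|e n (T p)| * |σ p|) := by
            rw [← abs_mul, ← abs_mul, ← abs_mul]; exact abs_add_le _ _
        _ ≤ B * (B * (1 / 2) ^ n) + 1 / 2 * ((B + 4 * B * B) * (3 / 4) ^ n * 1) := by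
            gcongr
            exacts [hmB' p, hdB n (T p), hm2 p, ih (T p), hσ p]
        _ ≤ B * (B * (3 / 4) ^ n) + 1 / 2 * ((B + 4 * B * B) * (3 / 4) ^ n * 1) := by gcongr
        _ ≤ _ := by rw [pow_succ]; nlinarith [mul_nonneg hB h34]
  have hde : ∀ n p s, HasDerivAt (fun s => d n (Φ s p)) (e n (Φ s p)) s := by
    intro n
    induction n with
    | zero => exact hf
    | succ n ih =>
      intro p s
      exact (hm p s).mul (hT.hasDerivAt_comp ih p s)
  have hec : ∀ n p, Continuous fun s => e n (Φ s p) := by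
    intro n
    induction n with
    | zero => exact hfc
    | succ n ih =>
      intro p
      have h1 : Continuous fun s => d n (T (Φ s p)) := hT.continuous_comp
        (fun q => continuous_iff_continuousAt.2 fun s => (hde n q s).continuousAt) p
      have h2 : Continuous fun s => m (Φ s p) :=
        continuous_iff_continuousAt.2 fun s => (hm p s).continuousAt
      exact ((hmc p).mul h1).add (h2.mul ((hT.continuous_comp ih p).mul (hσc p)))
  have hsum12 : Summable fun n : ℕ => B * (1 / 2 : ℝ) ^ n :=
    (summable_geometric_of_lt_one (by norm_num) (by norm_num)).mul_left _
  have hsum34 : Summable fun n : ℕ => (B + 4 * B * B) * (3 / 4 : ℝ) ^ n :=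
    (summable_geometric_of_lt_one (by norm_num) (by norm_num)).mul_left _
  have hds : ∀ p, Summable fun n => d n p := fun p => Summable.of_norm_bounded hsum12 (hdB · p)
  -- The remainder of the series is the n-fold product of m times u at the n-th image, so
  -- boundedness of u identifies it with the sum.
  have hrem : ∀ n p, |u p - ∑ i ∈ Finset.range n, d i p| ≤ H * (1 / 2) ^ n := by
    intro n
    induction n with
    | zero => intro p; simpa using hH p
    | succ n ih =>
      intro p
      have : u p - ∑ i ∈ Finset.range (n + 1), d i p =
          m p * (u (T p) - ∑ i ∈ Finset.range n, d i (T p)) := by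
        rw [Finset.sum_range_succ', mul_sub, Finset.mul_sum]
        have h1 : ∀ i, d (i + 1) p = m p * d i (T p) := fun i => rfl
        have h2 : d 0 p = f p := rfl
        simp only [h1, h2]
        rw [heq p]; ring
      rw [this, abs_mul]
      calc |m p| * |u (T p) - ∑ i ∈ Finset.range n, d i (T p)| ≤ 1 / 2 * (H * (1 / 2) ^ n) := by
            gcongr; exacts [hm2 p, ih (T p)]
        _ = _ := by ring
  have hu : ∀ p, u p = ∑' n, d n p := by
    intro p
    have h1 := (hds p).hasSum.tendsto_sum_nat
    have h2 : Tendsto (fun n => ∑ i ∈ Finset.range n, d i p) atTop (𝓝 (u p)) := by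
      rw [tendsto_iff_norm_sub_tendsto_zero]
      have hlim : Tendsto (fun n : ℕ => H * (1 / 2 : ℝ) ^ n) atTop (𝓝 (H * 0)) :=
        (tendsto_pow_atTop_nhds_zero_of_lt_one (by norm_num) (by norm_num)).const_mul _
      rw [mul_zero] at hlim
      refine squeeze_zero (fun _ => norm_nonneg _) (fun n => ?_) hlim
      rw [norm_sub_rev]
      exact hrem n p
    exact tendsto_nhds_unique h2 h1
  refine ⟨fun p => ∑' n, e n p, ⟨∑' n : ℕ, (B + 4 * B * B) * (3 / 4 : ℝ) ^ n,
      fun p => tsum_of_norm_bounded (f := fun n => e n p) hsum34.hasSum (heB · p)⟩,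
    fun p => continuous_tsum (hec · p) hsum34 fun n s => heB n (Φ s p), fun p s => ?_⟩
  simp only [hu]
  exact hasDerivAt_tsum hsum34 (fun n y => hde n p y) (fun n y => heB n (Φ y p)) (hds (Φ 0 p)) s

/-- Along orbits, u' = (f' + m' (u ∘ T)) + (m σ) (u' ∘ T). This is an equation of the same kind with
one derivative less, and its multiplier is still at most 1/2 because |σ| ≤ 1. -/
theorem leafClass_of_cohomological (h : IsC1Flow W Φ M L) (hη : η ∈ Icc (0 : ℝ) 1)
    (hT : Intertwines Φ T σ) (hσ : ∀ p, |σ p| ≤ 1) {k : ℕ} :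
    ∀ {f m u : Plane → ℝ} {H : ℝ}, (∀ j < k, LeafClass Φ η j σ) → LeafClass Φ η k f →
    LeafClass Φ η k m → (∀ p, |m p| ≤ 1 / 2) → (∀ p, |u p| ≤ H) →
    (∀ p, Continuous fun s => u (Φ s p)) → (∀ p, u p = f p + m p * u (T p)) →
    LeafClass Φ η k u := by
  induction k with
  | zero =>
    intro f m u H _ hf hm hm2 hH hcont heq
    exact leafClass_zero_of_cohomological hη hT hσ hf hm hm2 hH hcont heq
  | succ k ih =>
    intro f m u H hσk hf hm hm2 hH hcont heq
    -- Order k for u itself is needed before differentiating, since u ∘ T enters the new forcing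
    -- term.
    have hu : LeafClass Φ η k u :=
      ih (fun j hj => hσk j (by omega)) (hf.lower hη) (hm.lower hη) hm2 hH hcont heq
    have hσc := hσk k (by omega)
    obtain ⟨B₁, hB₁, hfB⟩ := h.exists_abs_le hf
    obtain ⟨f', hf', hfk⟩ := h.exists_leafDeriv hf
    obtain ⟨m', hm', hmk⟩ := h.exists_leafDeriv hm
    obtain ⟨B₂, hB₂, hfB'⟩ := h.exists_abs_le hfk
    obtain ⟨B₃, hB₃, hmB'⟩ := h.exists_abs_le hmk
    obtain ⟨u', ⟨H', hH'⟩, hu'c, hu'⟩ := exists_leafDeriv_of_cohomological hT hσ hσc.continuous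
      (B := B₁ + B₂ + B₃) (by positivity) hf' hm' hfk.continuous hmk.continuous
      (fun p => (hfB p).trans (by linarith)) (fun p => (hfB' p).trans (by linarith))
      (fun p => (hmB' p).trans (by linarith)) hm2 hH heq
    refine LeafClass.of_hasDerivAt hH hu' (ih (f := fun p => f' p + m' p * u (T p))
      (m := fun p => m p * σ p) (fun j hj => hσk j (by omega)) ?_ ((hm.lower hη).mul hη hσc)
      (fun p => ?_) hH' hu'c fun p => ?_)
    · exact hfk.add (hmk.mul hη
        (h.leafClass_comp hη hT zero_le_one hσ (fun j hj => hσk j (by omega)) hu))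
    · rw [abs_mul]
      calc |m p| * |σ p| ≤ 1 / 2 * 1 := by gcongr; exacts [hm2 p, hσ p]
        _ = _ := by norm_num
    · have h1 := hu' p 0
      have h2 := (hf' p 0).add ((hm' p 0).mul (hT.hasDerivAt_comp hu' p 0))
      have h3 : (fun s => u (Φ s p)) = (fun s => f (Φ s p)) +
          (fun s => m (Φ s p)) * fun s => u (T (Φ s p)) := funext fun s => heq _
      rw [h3] at h1
      have := h1.unique h2
      simp only [h.map_zero] at this
      rw [this]; ring

/-- A bounded solution, continuous along orbits, of a cohomological equation some iterate of which
is contracting is as smooth along orbits as the coefficients. -/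
theorem leafClass_of_cohomological_iterate (h : IsC1Flow W Φ M L) (hη : η ∈ Icc (0 : ℝ) 1)
    (hT : Intertwines Φ T σ) {k N : ℕ} {f m u : Plane → ℝ} {H : ℝ}
    (hσ : LeafClass Φ η k σ) (hf : LeafClass Φ η k f) (hm : LeafClass Φ η k m)
    (hσN : ∀ p, |cocycle T σ N p| ≤ 1) (hmN : ∀ p, |cocycle T m N p| ≤ 1 / 2)
    (hH : ∀ p, |u p| ≤ H) (hcont : ∀ p, Continuous fun s => u (Φ s p))
    (heq : ∀ p, u p = f p + m p * u (T p)) : LeafClass Φ η k u := by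
  obtain ⟨c, hc, hσc⟩ := h.exists_abs_le hσ
  have hcomp : ∀ {g}, LeafClass Φ η k g → LeafClass Φ η k (fun p => g (T p)) := fun hg =>
    h.leafClass_comp hη hT hc hσc (fun j hj => hσ.of_le hη hj.le) hg
  have hcoc : ∀ {g}, LeafClass Φ η k g → ∀ n, LeafClass Φ η k (cocycle T g n) := by
    intro g hg n
    induction n with
    | zero => exact LeafClass.const 1
    | succ n ih => exact hg.mul hη (hcomp ih)
  have hiter : ∀ n, ∃ fn, LeafClass Φ η k fn ∧
      ∀ p, u p = fn p + cocycle T m n p * u (T^[n] p) := by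
    intro n
    induction n with
    | zero => exact ⟨fun _ => 0, LeafClass.const 0, fun p => by simp [cocycle]⟩
    | succ n ih =>
      obtain ⟨fn, hfn, hn⟩ := ih
      refine ⟨fun p => f p + m p * fn (T p), hf.add (hm.mul hη (hcomp hfn)), fun p => ?_⟩
      rw [heq p, hn (T p), cocycle, Function.iterate_succ_apply]
      ring
  obtain ⟨fN, hfN, hN⟩ := hiter N
  exact h.leafClass_of_cohomological hη (hT.iterate N) hσN
    (fun j hj => (hcoc hσ N).of_le hη hj.le) hfN (hcoc hm N) hmN hH hcont hN

end IsC1Flow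

/-! ### Functions with bounded derivatives and Hölder top derivative -/

/-- `f` is of class `C^k` with bounded derivatives, the one of order `k` being `η`-Hölder. -/
def SmoothBounded {E G : Type*} [NormedAddCommGroup E] [NormedSpace ℝ E]
    [NormedAddCommGroup G] [NormedSpace ℝ G] (η : ℝ) (k : ℕ) (f : E → G) : Prop :=
  ContDiff ℝ k f ∧ ∃ B : ℝ, 0 ≤ B ∧ (∀ j ≤ k, ∀ x, ‖iteratedFDeriv ℝ j f x‖ ≤ B) ∧
    ∀ x y, ‖iteratedFDeriv ℝ k f x - iteratedFDeriv ℝ k f y‖ ≤ B * ‖x - y‖ ^ η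

theorem norm_iteratedFDeriv_fderiv_sub {E G : Type*} [NormedAddCommGroup E] [NormedSpace ℝ E]
    [NormedAddCommGroup G] [NormedSpace ℝ G] (f : E → G) (k : ℕ) (x y : E) :
    ‖iteratedFDeriv ℝ k (fderiv ℝ f) x - iteratedFDeriv ℝ k (fderiv ℝ f) y‖ =
      ‖iteratedFDeriv ℝ (k + 1) f x - iteratedFDeriv ℝ (k + 1) f y‖ := by
  rw [iteratedFDeriv_succ_eq_comp_right, Function.comp_apply, iteratedFDeriv_succ_eq_comp_right,
    Function.comp_apply, ← dist_eq_norm, ← dist_eq_norm]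
  exact ((continuousMultilinearCurryRightEquiv' ℝ k E G).symm.dist_map _ _).symm

namespace SmoothBounded

variable {E G : Type*} [NormedAddCommGroup E] [NormedSpace ℝ E]
  [NormedAddCommGroup G] [NormedSpace ℝ G] {η : ℝ} {k : ℕ} {f : E → G}

theorem fderiv (hf : SmoothBounded η (k + 1) f) : SmoothBounded η k (fderiv ℝ f) := by
  obtain ⟨hc, B, hB, hb, hh⟩ := hf
  refine ⟨hc.fderiv_right (by norm_cast), B, hB, fun j hj x => ?_, fun x y => ?_⟩
  · rw [norm_iteratedFDeriv_fderiv]; exact hb (j + 1) (by omega) x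
  · rw [norm_iteratedFDeriv_fderiv_sub]; exact hh x y

theorem lower (hη : η ∈ Icc (0 : ℝ) 1) (hf : SmoothBounded η (k + 1) f) :
    SmoothBounded η k f := by
  obtain ⟨hc, B, hB, hb, hh⟩ := hf
  refine ⟨hc.of_le (by norm_cast; omega), 2 * B, by positivity,
    fun j hj x => (hb j (by omega) x).trans (by linarith), fun x y => ?_⟩
  refine le_mul_rpow_of_le_of_le_mul hη.1 hη.2 (by linarith) (norm_nonneg _) ?_ ?_
  · refine (norm_sub_le _ _).trans ?_
    linarith [hb k (by omega) x, hb k (by omega) y]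
  · have hd : ∀ z, DifferentiableAt ℝ (iteratedFDeriv ℝ k f) z :=
      hc.differentiable_iteratedFDeriv (by norm_cast; omega)
    have := convex_univ.norm_image_sub_le_of_norm_fderiv_le (𝕜 := ℝ) (fun z _ => hd z)
      (fun z _ => (norm_fderiv_iteratedFDeriv (𝕜 := ℝ) (f := f) (n := k) (x := z)).le.trans
        (hb (k + 1) le_rfl z)) (mem_univ y) (mem_univ x)
    nlinarith [mul_nonneg hB (norm_nonneg (x - y))]

theorem of_le (hη : η ∈ Icc (0 : ℝ) 1) {j : ℕ} (hjk : j ≤ k) (hf : SmoothBounded η k f) :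
    SmoothBounded η j f := by
  induction hjk with
  | refl => exact hf
  | step _ ih => exact ih (hf.lower hη)

end SmoothBounded

/-- The chain rule brings in Df applied to W, so one order for f costs W at one order less. The
target space and the functional vary because the induction passes from f to its derivative. -/
theorem IsC1Flow.leafClass_of_smoothBounded {W : Plane → Plane} {Φ : ℝ → Plane → Plane} {M : ℝ}
    {L : NNReal} {η : ℝ} (h : IsC1Flow W Φ M L) (hη : η ∈ Icc (0 : ℝ) 1) {k : ℕ} :
    ∀ {G : Type} [NormedAddCommGroup G] [NormedSpace ℝ G] {f : Plane → G} (A : G →L[ℝ] ℝ),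
    (∀ j < k, ∀ i, LeafClass Φ η j (fun p => W p i)) → SmoothBounded η k f →
    LeafClass Φ η k (fun p => A (f p)) := by
  have hM : 0 ≤ M := (norm_nonneg _).trans (h.norm_le 0)
  induction k with
  | zero =>
    intro G _ _ f A _ hf
    obtain ⟨hc, B, hB, hb, hh⟩ := hf
    have hb' : ∀ x, ‖f x‖ ≤ B := fun x => by simpa using hb 0 le_rfl x
    have hh' : ∀ x y, ‖f x - f y‖ ≤ B * ‖x - y‖ ^ η := fun x y => by
      refine le_trans (le_of_eq ?_) (hh x y)
      rw [iteratedFDeriv_zero_eq_comp, Function.comp_apply, Function.comp_apply, ← map_sub,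
        LinearIsometryEquiv.norm_map]
    refine ⟨‖A‖ * (B + B * M ^ η), by positivity, fun p =>
      ⟨(A.continuous.comp (hc.continuous.comp (h.continuous_orbit p))).continuousOn,
        fun s _ => ?_, fun s _ s' _ => ?_⟩⟩
    · refine A.le_opNorm_of_le ((hb' _).trans (le_add_of_nonneg_right (by positivity)))
    · rw [← map_sub, mul_assoc]
      refine A.le_opNorm_of_le ((hh' _ _).trans ?_)
      calc B * ‖Φ s p - Φ s' p‖ ^ η ≤ B * (M * |s - s'|) ^ η := by
            gcongr
            · exact hη.1
            · exact h.norm_sub_le p s s'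
        _ = B * M ^ η * |s - s'| ^ η := by
            rw [Real.mul_rpow hM (abs_nonneg _), mul_assoc]
        _ ≤ _ := by gcongr; exact le_add_of_nonneg_left hB
  | succ k ih =>
    intro G _ _ f A hW hf
    have hd := hf.fderiv
    have hW' : ∀ j < k, ∀ i, LeafClass Φ η j (fun p => W p i) := fun j hj => hW j (by omega)
    have hx := ih (A.comp (ContinuousLinearMap.apply ℝ G ex)) hW' hd
    have hy := ih (A.comp (ContinuousLinearMap.apply ℝ G ey)) hW' hd
    obtain ⟨hc, B, hB, hb, -⟩ := hf
    refine LeafClass.of_hasDerivAt (B := ‖A‖ * B) (fun p => ?_) (fun p s => ?_)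
      (((hW k (by omega) 0).mul hη hx).add ((hW k (by omega) 1).mul hη hy))
    · exact A.le_opNorm_of_le (by simpa using hb 0 (by omega) p)
    · have hf' := ((hc.differentiable (by norm_cast)) (Φ s p)).hasFDerivAt.comp_hasDerivAt s
        (h.hasDerivAt p s)
      refine (A.hasFDerivAt.comp_hasDerivAt s hf').congr_deriv ?_
      conv_lhs => rw [eq_smul_ex_add_smul_ey (W (Φ s p))]
      simp

/-! ### Lifting to the plane -/

theorem torusProj_surjective : Function.Surjective torusProj := by
  intro x
  choose y hy using fun i => QuotientAddGroup.mk_surjective (x i)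
  exact ⟨WithLp.toLp 2 y, funext hy⟩

theorem torusProj_add (p q : Plane) : torusProj (p + q) = torusProj p + torusProj q := by
  funext i
  exact AddCircle.coe_add 1 (p i) (q i)

theorem torusProj_sub (p q : Plane) : torusProj (p - q) = torusProj p - torusProj q := by
  funext i
  exact AddCircle.coe_sub 1 (p i) (q i)

/-- The integer vectors of the plane. -/
def IsLatticeVector (q : Plane) : Prop := ∀ i, ∃ n : ℤ, q i = n

theorem torusProj_eq_zero_iff (q : Plane) : torusProj q = 0 ↔ IsLatticeVector q := by
  rw [funext_iff]
  refine forall_congr' fun i => ?_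
  have : torusProj q i = ((q i : ℝ) : AddCircle (1 : ℝ)) := rfl
  rw [this, Pi.zero_apply, AddCircle.coe_eq_zero_iff]
  refine exists_congr fun n => ?_
  rw [zsmul_one, eq_comm]

theorem torusProj_eq_iff (p q : Plane) : torusProj p = torusProj q ↔ IsLatticeVector (p - q) := by
  rw [← torusProj_eq_zero_iff, torusProj_sub, sub_eq_zero]

theorem exists_isLatticeVector_norm_sub_le (p : Plane) :
    ∃ q, IsLatticeVector q ∧ ‖p - q‖ ≤ 2 := by
  refine ⟨WithLp.toLp 2 fun i => (⌊p i⌋ : ℝ), fun i => ⟨⌊p i⌋, rfl⟩, ?_⟩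
  rw [EuclideanSpace.norm_eq, Fin.sum_univ_two]
  refine Real.sqrt_le_iff.2 ⟨by norm_num, ?_⟩
  have h : ∀ i, ‖(p - WithLp.toLp 2 fun i => (⌊p i⌋ : ℝ)) i‖ ≤ 1 := fun i => by
    have : (p - WithLp.toLp 2 fun i => (⌊p i⌋ : ℝ)) i = Int.fract (p i) := rfl
    rw [this, Real.norm_eq_abs, abs_of_nonneg (Int.fract_nonneg _)]
    exact (Int.fract_lt_one _).le
  have := pow_le_one₀ (n := 2) (norm_nonneg _) (h 0)
  have := pow_le_one₀ (n := 2) (norm_nonneg _) (h 1)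
  linarith

/-- A function on the plane which is periodic with respect to the integer lattice. -/
def LatticePeriodic {G : Type*} (f : Plane → G) : Prop :=
  ∀ p q, IsLatticeVector q → f (p + q) = f p

namespace LatticePeriodic

theorem exists_norm_le {G : Type*} [NormedAddCommGroup G] {f : Plane → G}
    (hf : LatticePeriodic f) (hc : Continuous f) :
    ∃ B, 0 ≤ B ∧ ∀ p, ‖f p‖ ≤ B := by
  obtain ⟨B, hB⟩ := (isCompact_closedBall (0 : Plane) 2).exists_bound_of_continuousOn
    hc.continuousOn
  refine ⟨B, (norm_nonneg _).trans (hB 0 (by simp)), fun p => ?_⟩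
  obtain ⟨q, hq, hpq⟩ := exists_isLatticeVector_norm_sub_le p
  have := hf (p - q) q hq
  rw [sub_add_cancel] at this
  rw [this]
  exact hB _ (by simpa using hpq)

variable {G : Type*} [NormedAddCommGroup G] [NormedSpace ℝ G] {f : Plane → G}

theorem iteratedFDeriv (hf : LatticePeriodic f) (j : ℕ) :
    LatticePeriodic (iteratedFDeriv ℝ j f) := by
  intro p q hq
  rw [← iteratedFDeriv_comp_add_right j q p]
  congr 1
  exact funext fun x => hf x q hq

theorem fderiv (hf : LatticePeriodic f) : LatticePeriodic (fderiv ℝ f) := by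
  intro p q hq
  rw [← fderiv_comp_add_right q]
  congr 1
  exact funext fun x => hf x q hq

/-- Every point is a lattice translate of one in a fixed compact ball, so continuity of the
derivatives suffices for global bounds. -/
theorem smoothBounded (hf : LatticePeriodic f) {η : ℝ} {k : ℕ} (hc : ContDiff ℝ k f) {K : ℝ}
    (hK : ∀ x y, ‖_root_.iteratedFDeriv ℝ k f x - _root_.iteratedFDeriv ℝ k f y‖ ≤
      K * ‖x - y‖ ^ η) : SmoothBounded η k f := by
  choose B hB0 hB using fun j : Fin (k + 1) => (hf.iteratedFDeriv j).exists_norm_le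
    (hc.continuous_iteratedFDeriv (by exact_mod_cast Nat.lt_succ_iff.1 j.2))
  have hsum : 0 ≤ ∑ j, B j := Finset.sum_nonneg fun j _ => hB0 j
  refine ⟨hc, |K| + ∑ j, B j, add_nonneg (abs_nonneg _) hsum, fun j hj x => ?_, fun x y => ?_⟩
  · refine (hB ⟨j, by omega⟩ x).trans ?_
    have := Finset.single_le_sum (f := B) (fun j _ => hB0 j) (Finset.mem_univ ⟨j, by omega⟩)
    linarith [abs_nonneg K]
  · refine (hK x y).trans ?_
    gcongr
    linarith [le_abs_self K]

end LatticePeriodic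

theorem latticePeriodic_comp_torusProj {G : Type*} (f : Torus2 → G) :
    LatticePeriodic fun p => f (torusProj p) := by
  intro p q hq
  beta_reduce
  rw [torusProj_add, (torusProj_eq_zero_iff q).2 hq, add_zero]

/-- A continuous plane map with values in the integer lattice is constant. -/
theorem eq_of_isLatticeVector {f : Plane → Plane} (hc : Continuous f)
    (hf : ∀ p, IsLatticeVector (f p)) (p q : Plane) : f p = f q := by
  ext i
  choose n hn using fun p => hf p i
  have hci : Continuous fun p => f p i := (EuclideanSpace.proj (𝕜 := ℝ) i).continuous.comp hc
  have hcn : Continuous n := by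
    rw [Int.isClosedEmbedding_coe_real.isEmbedding.continuous_iff]
    exact hci.congr hn
  rw [hn p, hn q]
  congr 1
  exact PreconnectedSpace.constant inferInstance hcn

/-- The derivative of a lift of a torus map is periodic. -/
theorem latticePeriodic_fderiv_of_lift {f : Torus2 → Torus2} {g : Plane → Plane}
    (hg : ∀ p, torusProj (g p) = f (torusProj p)) (hc : Continuous g) :
    LatticePeriodic (fderiv ℝ g) := by
  intro p q hq
  have hlat : ∀ x, IsLatticeVector (g (x + q) - g x) := by
    intro x
    rw [← torusProj_eq_iff, hg, hg, torusProj_add, (torusProj_eq_zero_iff q).2 hq, add_zero]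
  have hconst : ∀ x, g (x + q) = g x + (g (p + q) - g p) := by
    intro x
    have := eq_of_isLatticeVector (f := fun x => g (x + q) - g x) (by fun_prop) hlat x p
    rw [← this]; abel
  rw [← fderiv_comp_add_right q, funext hconst, fderiv_add_const]

/-! ### Maps preserving the orbits of a flow -/

/-- The factor by which `T` changes the speed of the orbits of `W`. -/
noncomputable def speedFactor (W T : Plane → Plane) (p : Plane) : ℝ :=
  dot (fderiv ℝ T p (W p)) (W (T p)) / ‖W (T p)‖ ^ 2

/-- The factor by which `T` scales the form `cross W` transverse to `W`. -/
noncomputable def transverseFactor (W T : Plane → Plane) (p : Plane) : ℝ :=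
  cross (W (T p)) (fderiv ℝ T p (rot (W p))) / ‖W p‖ ^ 2

/-- The derivative of `T` maps the direction of `W` to the direction of `W`. -/
def PreservesDirection (W T : Plane → Plane) : Prop :=
  ∀ p, fderiv ℝ T p (W p) = speedFactor W T p • W (T p)

theorem Continuous.dot {X : Type*} [TopologicalSpace X] {f g : X → Plane} (hf : Continuous f)
    (hg : Continuous g) : Continuous fun x => dot (f x) (g x) := by
  unfold _root_.dot
  fun_prop

theorem PreservesDirection.cross_fderiv {W T : Plane → Plane} (hT : PreservesDirection W T)
    (h0 : ∀ p, W p ≠ 0) (p v : Plane) :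
    cross (W (T p)) (fderiv ℝ T p v) = transverseFactor W T p * cross (W p) v := by
  have key : ∀ (u z : Plane) (x y c : ℝ), cross u (x • c • u + y • z) = y * cross u z := by
    intro u z x y c
    simp only [cross, PiLp.add_apply, PiLp.smul_apply, smul_eq_mul]
    ring
  conv_lhs => rw [decompose (W p) v (h0 p), map_add, map_smul, map_smul, hT p, key]
  rw [transverseFactor]
  ring

namespace IsC1Flow

open scoped NNReal

variable {W : Plane → Plane} {Φ : ℝ → Plane → Plane} {M : ℝ} {L : ℝ≥0} {T : Plane → Plane}

theorem continuous_speedFactor (h : IsC1Flow W Φ M L) (h0 : ∀ p, W p ≠ 0) (hT : ContDiff ℝ 1 T) :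
    Continuous (speedFactor W T) := by
  have hW := h.contDiff.continuous
  have hWT := hW.comp hT.continuous
  refine (((hT.continuous_fderiv one_ne_zero).clm_apply hW).dot hWT).div (by fun_prop) fun p => ?_
  have := h0 (T p)
  positivity

/-- The time parameter of the image under `T` of an orbit. -/
noncomputable def imageTime (W T : Plane → Plane) (Φ : ℝ → Plane → Plane) (p : Plane) (s : ℝ) : ℝ :=
  ∫ u in (0 : ℝ)..s, speedFactor W T (Φ u p)

theorem hasDerivAt_imageTime (h : IsC1Flow W Φ M L) (h0 : ∀ p, W p ≠ 0) (hT : ContDiff ℝ 1 T)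
    (p : Plane) (s : ℝ) : HasDerivAt (imageTime W T Φ p) (speedFactor W T (Φ s p)) s := by
  have hc : Continuous fun u => speedFactor W T (Φ u p) :=
    (h.continuous_speedFactor h0 hT).comp (h.continuous_orbit p)
  exact intervalIntegral.integral_hasDerivAt_right (hc.intervalIntegrable _ _)
    (hc.stronglyMeasurableAtFilter _ _) hc.continuousAt

/-- Both curves solve y' = σ(Φ_s p) W(y) with the same initial value, and this nonautonomous
equation is Lipschitz in y because σ is bounded. -/
theorem map_orbit (h : IsC1Flow W Φ M L) (h0 : ∀ p, W p ≠ 0) (hT : ContDiff ℝ 1 T)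
    (hd : PreservesDirection W T) {c : ℝ} (hc : ∀ p, |speedFactor W T p| ≤ c) (p : Plane) (s : ℝ) :
    T (Φ s p) = Φ (imageTime W T Φ p s) (T p) := by
  have hc0 : 0 ≤ c := (abs_nonneg _).trans (hc p)
  have key : (fun s => T (Φ s p)) = fun s => Φ (imageTime W T Φ p s) (T p) := by
    refine ODE_solution_unique_univ (v := fun s y => speedFactor W T (Φ s p) • W y)
      (K := c.toNNReal * L) (s := fun _ => univ) (t₀ := 0) (fun s => ?_) (fun s => ⟨?_, trivial⟩)
      (fun s => ⟨?_, trivial⟩) ?_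
    · refine LipschitzWith.lipschitzOnWith (LipschitzWith.of_dist_le_mul fun x y => ?_)
      rw [dist_eq_norm, ← smul_sub, norm_smul, NNReal.coe_mul, Real.coe_toNNReal c hc0, mul_assoc]
      refine mul_le_mul (hc _) ?_ (norm_nonneg _) hc0
      rw [← dist_eq_norm]
      exact h.lipschitz.dist_le_mul x y
    · have := ((hT.differentiable one_ne_zero) (Φ s p)).hasFDerivAt.comp_hasDerivAt s
        (h.hasDerivAt p s)
      exact this.congr_deriv (hd (Φ s p))
    · exact (h.hasDerivAt (T p) (imageTime W T Φ p s)).scomp s (h.hasDerivAt_imageTime h0 hT p s)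
    · simp [imageTime, h.map_zero]
  exact congrFun key s

theorem intertwines (h : IsC1Flow W Φ M L) (h0 : ∀ p, W p ≠ 0) (hT : ContDiff ℝ 1 T)
    (hd : PreservesDirection W T) {c : ℝ} (hc : ∀ p, |speedFactor W T p| ≤ c) :
    Intertwines Φ T (speedFactor W T) := fun p =>
  ⟨imageTime W T Φ p, by simp [imageTime], h.hasDerivAt_imageTime h0 hT p,
    h.map_orbit h0 hT hd hc p⟩

theorem continuous_imageTime (h : IsC1Flow W Φ M L) (h0 : ∀ p, W p ≠ 0) (hT : ContDiff ℝ 1 T)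
    (s : ℝ) : Continuous fun p => imageTime W T Φ p s := by
  refine intervalIntegral.continuous_parametric_intervalIntegral_of_continuous' ?_ 0 s
  exact (h.continuous_speedFactor h0 hT).comp h.continuous_map

theorem norm_map_sub_sub_smul_le (h : IsC1Flow W Φ M L) (y : Plane) (δ : ℝ) :
    ‖Φ δ y - y - δ • W y‖ ≤ L * (M * |δ|) * |δ| := by
  have hM : 0 ≤ M := (norm_nonneg _).trans (h.norm_le 0)
  have hder : ∀ s ∈ uIcc 0 δ, HasDerivWithinAt (fun s => Φ s y - s • W y)
      (W (Φ s y) - W y) (uIcc 0 δ) s := by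
    intro s _
    have := (h.hasDerivAt y s).sub ((hasDerivAt_id s).smul_const (W y))
    exact (this.congr_deriv (by rw [one_smul])).hasDerivWithinAt
  have hb : ∀ s ∈ uIcc 0 δ, ‖W (Φ s y) - W y‖ ≤ L * (M * |δ|) := by
    intro s hs
    have h1 := h.norm_sub_le y s 0
    rw [h.map_zero, sub_zero] at h1
    have h2 : |s| ≤ |δ| := by
      have := abs_sub_left_of_mem_uIcc hs
      simpa using this
    rw [← dist_eq_norm]
    refine (h.lipschitz.dist_le_mul _ _).trans ?_
    rw [dist_eq_norm]
    gcongr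
    exact h1.trans (by gcongr)
  have := (convex_uIcc 0 δ).norm_image_sub_le_of_norm_hasDerivWithin_le hder hb
    left_mem_uIcc right_mem_uIcc
  simp only [h.map_zero, zero_smul, sub_zero, Real.norm_eq_abs] at this
  rw [sub_right_comm]
  exact this

theorem flowJacobian_neg (h : IsC1Flow W Φ M L) (q : Plane) (t : ℝ) :
    flowJacobian W Φ (Φ t q) (-t) * flowJacobian W Φ q t = 1 := by
  rw [flowJacobian, flowJacobian, ← Real.exp_add, Real.exp_eq_one_iff]
  simp only [← h.map_add]
  rw [intervalIntegral.integral_comp_add_left (fun u => divergence W (Φ u q)) t, add_zero,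
    add_neg_cancel, intervalIntegral.integral_symm, neg_add_cancel]

/-- If `A` and `T` differ near `p` by moving along the flow for a small time, then their
derivatives at `p` agree transversally to the flow. -/
theorem cross_fderiv_eq_of_move (h : IsC1Flow W Φ M L) (h0 : ∀ p, W p ≠ 0) {A : Plane → Plane}
    {A' T' : Plane →L[ℝ] Plane} {p : Plane} {δ : Plane → ℝ} (hA : HasFDerivAt A A' p)
    (hT : HasFDerivAt T T' p) (hδ : Tendsto δ (𝓝 p) (𝓝 0)) (hδp : δ p = 0)
    (hAT : ∀ x, A x = Φ (δ x) (T x)) (v : Plane) :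
    cross (W (T p)) (A' v) = cross (W (T p)) (T' v) := by
  set q := T p with hq
  have hAp : A p = q := by rw [hAT, hδp, h.map_zero]
  have hM : 0 ≤ M := (norm_nonneg _).trans (h.norm_le 0)
  have hwq : 0 < ‖W q‖ := norm_pos_iff.2 (h0 q)
  set R : Plane → Plane := fun x => A x - T x - δ x • W q with hR
  have hRle : ∀ x, ‖R x‖ ≤ (L * (M * |δ x|) + L * ‖T x - q‖) * |δ x| := by
    intro x
    have h1 := h.norm_map_sub_sub_smul_le (T x) (δ x)
    have h2 : ‖δ x • (W (T x) - W q)‖ ≤ |δ x| * (L * ‖T x - q‖) := by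
      rw [norm_smul, Real.norm_eq_abs]
      gcongr
      rw [← dist_eq_norm, ← dist_eq_norm]
      exact h.lipschitz.dist_le_mul _ _
    calc ‖R x‖ = ‖(Φ (δ x) (T x) - T x - δ x • W (T x)) + δ x • (W (T x) - W q)‖ := by
          simp only [hR]; rw [hAT x, smul_sub]; congr 1; abel
      _ ≤ _ := (norm_add_le _ _).trans (add_le_add h1 h2)
      _ = _ := by ring
  -- Moving for time δ is δ W(q) up to an error small relative to δ. Only continuity of δ at p is
  -- available here, not differentiability.
  have hRo : R =o[𝓝 p] δ := by
    rw [Asymptotics.isLittleO_iff]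
    intro ε hε
    have hlim : Tendsto (fun x => L * (M * |δ x|) + L * ‖T x - q‖) (𝓝 p) (𝓝 0) := by
      have h1 : Tendsto (fun x => |δ x|) (𝓝 p) (𝓝 0) := by simpa using hδ.abs
      have h2 : Tendsto (fun x => ‖T x - q‖) (𝓝 p) (𝓝 0) := by
        have := hT.continuousAt.tendsto
        rw [tendsto_iff_norm_sub_tendsto_zero] at this
        exact this
      simpa using ((h1.const_mul M).const_mul (L : ℝ)).add (h2.const_mul (L : ℝ))
    filter_upwards [hlim.eventually (gt_mem_nhds hε)] with x hx
    refine (hRle x).trans ?_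
    rw [Real.norm_eq_abs]
    gcongr
  -- Since W(q) ≠ 0, the displacement controls the time: δ W(q) is the difference of A and T minus
  -- R, and half of ‖W(q)‖ |δ| absorbs R.
  have hδO : δ =O[𝓝 p] fun x => x - p := by
    have h1 : (fun x => (A x - A p) - (T x - T p)) =O[𝓝 p] fun x => x - p :=
      hA.isBigO_sub.sub hT.isBigO_sub
    obtain ⟨C, hC⟩ := h1.bound
    refine Asymptotics.IsBigO.of_bound (2 * C / ‖W q‖) ?_
    rw [Asymptotics.isLittleO_iff] at hRo
    filter_upwards [hC, hRo (half_pos hwq)] with x hx hRx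
    have h2 : δ x • W q = ((A x - A p) - (T x - T p)) - R x := by
      simp only [hR, hAp, ← hq]; abel
    have h3 : ‖δ x‖ * ‖W q‖ ≤ C * ‖x - p‖ + ‖W q‖ / 2 * ‖δ x‖ := by
      rw [← norm_smul, h2]
      exact (_root_.norm_sub_le _ _).trans (add_le_add hx hRx)
    rw [div_mul_eq_mul_div, le_div_iff₀ hwq]
    linarith
  have hRo' : R =o[𝓝 p] fun x => x - p := hRo.trans_isBigO hδO
  -- The functional W(q) × · kills the displacement along the flow and leaves only R, which is o(x -
  -- p).
  set ℓ := innerSL ℝ (rot (W q)) with hℓ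
  have hℓW : ℓ (W q) = 0 := by
    rw [hℓ, innerSL_apply_apply, inner_rot_eq_cross, cross]; ring
  have hfR : ∀ x, ℓ (A x - T x) = ℓ (R x) := by
    intro x
    simp only [hR]
    rw [_root_.map_sub ℓ _ (δ x • W q), map_smul, hℓW, smul_zero, sub_zero]
  have hd1 : HasFDerivAt (fun x => ℓ (A x - T x)) (ℓ.comp (A' - T')) p :=
    ℓ.hasFDerivAt.comp p (hA.sub hT)
  have hd2 : HasFDerivAt (fun x => ℓ (A x - T x)) (0 : Plane →L[ℝ] ℝ) p := by
    rw [hasFDerivAt_iff_isLittleO]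
    simp only [hfR]
    have hRp : R p = 0 := by simp [hR, hAp, hδp, ← hq]
    simpa [hRp] using (ℓ.isBigO_comp R (𝓝 p)).trans_isLittleO hRo'
  have := congrArg (fun B : Plane →L[ℝ] ℝ => B v) (hd1.unique hd2)
  simp only [ContinuousLinearMap.comp_apply, sub_apply, zero_apply,
    _root_.map_sub, hℓ, innerSL_apply_apply, inner_rot_eq_cross] at this
  linarith

/-- The Jacobian of the flow along an orbit and along its image under `T` are related by the
transverse factor of `T`. -/
theorem flowJacobian_mul_transverseFactor (h : IsC1Flow W Φ M L) (h0 : ∀ p, W p ≠ 0)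
    (hT : ContDiff ℝ 1 T) (hd : PreservesDirection W T) {c : ℝ}
    (hc : ∀ p, |speedFactor W T p| ≤ c) (p : Plane) (s : ℝ) :
    flowJacobian W Φ p s * transverseFactor W T (Φ s p) =
      transverseFactor W T p * flowJacobian W Φ (T p) (imageTime W T Φ p s) := by
  set t := imageTime W T Φ p s with ht
  have hTd : ∀ x, HasFDerivAt T (fderiv ℝ T x) x := fun x =>
    (hT.differentiable one_ne_zero x).hasFDerivAt
  have hmo := h.map_orbit h0 hT hd hc
  -- With t frozen at its value at p, Φ_(-t) ∘ T ∘ Φ_s differs from `T` by motion along the flow for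
  -- a time that vanishes at p. So both have the same transverse derivative there.
  have hA : HasFDerivAt (fun x => Φ (-t) (T (Φ s x))) ((flowDeriv W Φ (T (Φ s p)) (-t)).comp
      ((fderiv ℝ T (Φ s p)).comp (flowDeriv W Φ p s))) p :=
    (h.hasFDerivAt_flowDeriv h0 (T (Φ s p)) (-t)).comp p
      ((hTd (Φ s p)).comp p (h.hasFDerivAt_flowDeriv h0 p s))
  have hback : Φ (-t) (T (Φ s p)) = T p := by rw [hmo p s, ← ht, h.map_neg_map]
  have key := h.cross_fderiv_eq_of_move h0 hA (hTd p)
    (δ := fun x => imageTime W T Φ x s - t) ?_ (by simp [ht]) (fun x => ?_) (rot (W p))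
  · have h1 := cross_flowDeriv (Φ := Φ) h0 (T (Φ s p))
      (fderiv ℝ T (Φ s p) (flowDeriv W Φ p s (rot (W p)))) (-t)
    rw [hback, hd.cross_fderiv h0, cross_flowDeriv h0] at h1
    rw [ContinuousLinearMap.comp_apply, ContinuousLinearMap.comp_apply, h1, hd.cross_fderiv h0,
      cross_rot_self, hmo p s, ← ht] at key
    have h2 := h.flowJacobian_neg (T p) t
    have h3 : ‖W p‖ ^ 2 ≠ 0 := by have := h0 p; positivity
    have key' : flowJacobian W Φ (Φ t (T p)) (-t) *
        (transverseFactor W T (Φ s p) * flowJacobian W Φ p s) = transverseFactor W T p :=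
      mul_right_cancel₀ h3 (by linear_combination key)
    linear_combination (flowJacobian W Φ (T p) t) * key' -
      (transverseFactor W T (Φ s p) * flowJacobian W Φ p s) * h2
  · have := ((h.continuous_imageTime h0 hT s).tendsto p).sub_const t
    simpa [← ht] using this
  · rw [hmo x s, ← h.map_add, sub_eq_add_neg]

/-- The divergence of the field solves a cohomological equation over `T`. -/
theorem divergence_cohomological (h : IsC1Flow W Φ M L) (h0 : ∀ p, W p ≠ 0)
    (hT : ContDiff ℝ 1 T) (hd : PreservesDirection W T) {c : ℝ}
    (hc : ∀ p, |speedFactor W T p| ≤ c) {J' : Plane → ℝ}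
    (hJ : ∀ p s, HasDerivAt (fun s => transverseFactor W T (Φ s p)) (J' (Φ s p)) s) (p : Plane) :
    divergence W p * transverseFactor W T p + J' p =
      transverseFactor W T p * (speedFactor W T p * divergence W (T p)) := by
  have h1 := (h.hasDerivAt_flowJacobian p 0).mul (hJ p 0)
  have h2 := ((h.hasDerivAt_flowJacobian (T p) (imageTime W T Φ p 0)).comp 0
    (h.hasDerivAt_imageTime h0 hT p 0)).const_mul (transverseFactor W T p)
  have heq : (flowJacobian W Φ p * fun s => transverseFactor W T (Φ s p)) =
      fun s => transverseFactor W T p * (flowJacobian W Φ (T p) ∘ imageTime W T Φ p) s :=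
    funext fun s => h.flowJacobian_mul_transverseFactor h0 hT hd hc p s
  rw [heq] at h1
  have := h1.unique h2
  have hJ0 : ∀ q, flowJacobian W Φ q 0 = 1 := fun q => by simp [flowJacobian]
  have ht0 : imageTime W T Φ p 0 = 0 := by simp [imageTime]
  simp only [ht0, hJ0, h.map_zero, one_mul] at this
  rw [this]; ring

/-! ### Polynomial growth of the Jacobian by renormalization -/

theorem flowJacobian_le_exp {D : ℝ} (hD : ∀ p, |divergence W p| ≤ D) (p : Plane) (s : ℝ) :
    flowJacobian W Φ p s ≤ Real.exp (D * |s|) := by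
  rw [flowJacobian, Real.exp_le_exp]
  refine (le_abs_self _).trans ?_
  have := intervalIntegral.norm_integral_le_of_norm_le_const (a := 0) (b := s) (C := D)
    (f := fun u => divergence W (Φ u p)) (fun u _ => hD _)
  simpa using this

/-- The Jacobian of the flow grows at most polynomially if some iterate of `T` halves times. -/
theorem exists_flowJacobian_le (h : IsC1Flow W Φ M L) (h0 : ∀ p, W p ≠ 0)
    (hT : ContDiff ℝ 1 T) (hd : PreservesDirection W T) {c D c₁ c₂ : ℝ}
    (hc : ∀ p, |speedFactor W T p| ≤ c) (hD : ∀ p, |divergence W p| ≤ D) (hc₁ : 0 < c₁)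
    (hJ₁ : ∀ p, c₁ ≤ |transverseFactor W T p|) (hJ₂ : ∀ p, |transverseFactor W T p| ≤ c₂) {N : ℕ}
    (hN : ∀ p, |cocycle T (speedFactor W T) N p| ≤ 1 / 2) :
    ∃ C β : ℝ, 0 < C ∧ 0 < β ∧ ∀ p s, flowJacobian W Φ p s ≤ C * max 1 |s| ^ β := by
  have hc₂ : 0 < c₂ := hc₁.trans_le ((hJ₁ 0).trans (hJ₂ 0))
  set R := c₂ / c₁ with hR
  have hR1 : 1 ≤ R := (one_le_div hc₁).2 ((hJ₁ 0).trans (hJ₂ 0))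
  have step : ∀ p s, flowJacobian W Φ p s ≤
      R * flowJacobian W Φ (T p) (imageTime W T Φ p s) := by
    intro p s
    have h1 := congrArg abs (h.flowJacobian_mul_transverseFactor h0 hT hd hc p s)
    rw [abs_mul, abs_mul, abs_of_pos (flowJacobian_pos _ _), abs_of_pos (flowJacobian_pos _ _)]
      at h1
    rw [hR, div_mul_eq_mul_div, le_div_iff₀ hc₁]
    calc flowJacobian W Φ p s * c₁ ≤ flowJacobian W Φ p s * |transverseFactor W T (Φ s p)| :=
          mul_le_mul_of_nonneg_left (hJ₁ _) (flowJacobian_pos _ _).le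
      _ = _ := h1
      _ ≤ _ := mul_le_mul_of_nonneg_right (hJ₂ _) (flowJacobian_pos _ _).le
  have iter : ∀ n p, ∃ τ : ℝ → ℝ, τ 0 = 0 ∧
      (∀ s, HasDerivAt τ (cocycle T (speedFactor W T) n (Φ s p)) s) ∧
      ∀ s, flowJacobian W Φ p s ≤ R ^ n * flowJacobian W Φ (T^[n] p) (τ s) := by
    intro n
    induction n with
    | zero => exact fun p => ⟨id, rfl, fun s => hasDerivAt_id s, fun s => by simp⟩
    | succ n ih =>
      intro p
      obtain ⟨τ, hτ0, hτ, hτb⟩ := ih (T p)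
      refine ⟨τ ∘ imageTime W T Φ p, by simp [imageTime, hτ0], fun s => ?_, fun s => ?_⟩
      · refine ((hτ _).comp s (h.hasDerivAt_imageTime h0 hT p s)).congr_deriv ?_
        rw [cocycle, h.map_orbit h0 hT hd hc, mul_comm]
      · rw [Function.iterate_succ_apply, pow_succ', mul_assoc]
        exact (step p s).trans (by gcongr; exact hτb _)
  have halve : ∀ p s, ∃ q s', |s'| ≤ |s| / 2 ∧
      flowJacobian W Φ p s ≤ R ^ N * flowJacobian W Φ q s' := by
    intro p s
    obtain ⟨τ, hτ0, hτ, hτb⟩ := iter N p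
    refine ⟨T^[N] p, τ s, ?_, hτb s⟩
    have := Intertwines.abs_sub_le hN hτ s 0
    rw [hτ0, sub_zero, sub_zero] at this
    linarith
  have hD0 : 0 ≤ D := (abs_nonneg _).trans (hD 0)
  -- The factor 2 makes Q > 1, so the exponent log₂ Q is positive.
  set Q := 2 * R ^ N with hQ
  have hQ1 : 1 < Q := by
    have : 1 ≤ R ^ N := one_le_pow₀ hR1
    linarith
  -- Each halving of the time costs at most Q, and within time 1 the trivial bound exp D remains.
  have pow_bound : ∀ n : ℕ, ∀ p s, |s| ≤ 2 ^ n → flowJacobian W Φ p s ≤ Q ^ n * Real.exp D := by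
    intro n
    induction n with
    | zero =>
      intro p s hs
      refine (flowJacobian_le_exp hD p s).trans ?_
      rw [pow_zero, one_mul, Real.exp_le_exp]
      rw [pow_zero] at hs
      nlinarith
    | succ n ih =>
      intro p s hs
      obtain ⟨q, s', hs', hb⟩ := halve p s
      have h1 := ih q s' (by rw [pow_succ] at hs; linarith)
      calc flowJacobian W Φ p s ≤ R ^ N * flowJacobian W Φ q s' := hb
        _ ≤ Q * flowJacobian W Φ q s' := by
            have := flowJacobian_pos (W := W) (Φ := Φ) q s'
            have : 0 ≤ R ^ N := by positivity
            gcongr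
            linarith
        _ ≤ Q * (Q ^ n * Real.exp D) := by gcongr
        _ = _ := by ring
  refine ⟨Q * Real.exp D, Real.logb 2 Q, by positivity, Real.logb_pos one_lt_two hQ1,
    fun p s => ?_⟩
  set x := max 1 |s| with hx
  have hx1 : 1 ≤ x := le_max_left _ _
  have hx0 : 0 < x := by linarith
  set y := Real.logb 2 x with hy
  have hy0 : 0 ≤ y := Real.logb_nonneg one_lt_two hx1
  have hxy : x = 2 ^ y := (Real.rpow_logb two_pos (by norm_num) hx0).symm
  have hsn : |s| ≤ 2 ^ ⌈y⌉₊ := by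
    calc |s| ≤ x := le_max_right _ _
      _ = 2 ^ y := hxy
      _ ≤ 2 ^ ((⌈y⌉₊ : ℕ) : ℝ) := Real.rpow_le_rpow_of_exponent_le one_le_two (Nat.le_ceil y)
      _ = _ := Real.rpow_natCast _ _
  refine (pow_bound _ p s hsn).trans ?_
  have hQn : Q ^ ⌈y⌉₊ ≤ Q * x ^ Real.logb 2 Q := by
    calc Q ^ ⌈y⌉₊ = Q ^ ((⌈y⌉₊ : ℕ) : ℝ) := (Real.rpow_natCast _ _).symm
      _ ≤ Q ^ (y + 1) := Real.rpow_le_rpow_of_exponent_le hQ1.le (Nat.ceil_lt_add_one hy0).le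
      _ = Q * Q ^ y := by rw [Real.rpow_add (by linarith), Real.rpow_one, mul_comm]
      _ = Q * x ^ Real.logb 2 Q := by
          congr 1
          conv_lhs => rw [← Real.rpow_logb two_pos (by norm_num) (show 0 < Q by linarith)]
          rw [hxy, ← Real.rpow_mul two_pos.le, ← Real.rpow_mul two_pos.le, mul_comm]
  calc Q ^ ⌈y⌉₊ * Real.exp D ≤ Q * x ^ Real.logb 2 Q * Real.exp D := by gcongr
    _ = _ := by ring

end IsC1Flow

/-! ### Regularity along the orbits of an invariant direction field -/

theorem LeafClass.clm_apply_coord {Φ : ℝ → Plane → Plane} {η : ℝ} {k : ℕ} (hη : η ∈ Icc (0 : ℝ) 1)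
    {A : Plane → Plane →L[ℝ] Plane} {u : Plane → Plane} (i : Fin 2)
    (hA : ∀ v, LeafClass Φ η k (fun p => A p v i)) (hu : ∀ i, LeafClass Φ η k (fun p => u p i)) :
    LeafClass Φ η k (fun p => A p (u p) i) := by
  simp only [_root_.clm_apply_coord (A _) (u _)]
  exact ((hu 0).mul hη (hA ex)).add ((hu 1).mul hη (hA ey))

theorem LeafClass.cross {Φ : ℝ → Plane → Plane} {η : ℝ} {k : ℕ} (hη : η ∈ Icc (0 : ℝ) 1)
    {u v : Plane → Plane} (hu : ∀ i, LeafClass Φ η k (fun p => u p i))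
    (hv : ∀ i, LeafClass Φ η k (fun p => v p i)) :
    LeafClass Φ η k (fun p => cross (u p) (v p)) :=
  ((hu 0).mul hη (hv 1)).sub ((hu 1).mul hη (hv 0))

theorem LeafClass.dot {Φ : ℝ → Plane → Plane} {η : ℝ} {k : ℕ} (hη : η ∈ Icc (0 : ℝ) 1)
    {u v : Plane → Plane} (hu : ∀ i, LeafClass Φ η k (fun p => u p i))
    (hv : ∀ i, LeafClass Φ η k (fun p => v p i)) :
    LeafClass Φ η k (fun p => dot (u p) (v p)) :=
  ((hu 0).mul hη (hv 0)).add ((hu 1).mul hη (hv 1))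

theorem LeafClass.rot {Φ : ℝ → Plane → Plane} {η : ℝ} {k : ℕ}
    {u : Plane → Plane} (hu : ∀ i, LeafClass Φ η k (fun p => u p i)) (i : Fin 2) :
    LeafClass Φ η k (fun p => rot (u p) i) := by
  fin_cases i
  · exact (hu 1).neg
  · exact hu 0

open scoped NNReal in
/-- A flow along the direction field contracted by a plane map `T` of class `C^(k+1+η)`, whose
speed is of the same class. -/
structure IsContractedFlow (W : Plane → Plane) (Φ : ℝ → Plane → Plane) (M : ℝ) (L : ℝ≥0)
    (T : Plane → Plane) (η : ℝ) (k : ℕ) (N : ℕ) (c₀ c₁ c : ℝ) : Prop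
    extends IsC1Flow W Φ M L where
  exponent_mem : η ∈ Icc (0 : ℝ) 1
  lower_pos : 0 < c₀
  lower_le : ∀ p, c₀ ≤ ‖W p‖
  map_contDiff : ContDiff ℝ 1 T
  map_smooth : SmoothBounded η k (fderiv ℝ T)
  speed_smooth : SmoothBounded η (k + 1) (fun p => ‖W p‖)
  direction : PreservesDirection W T
  speedFactor_le : ∀ p, |speedFactor W T p| ≤ c
  transverse_pos : 0 < c₁
  le_transverse : ∀ p, c₁ ≤ |transverseFactor W T p|
  cocycle_speed : ∀ p, |cocycle T (speedFactor W T) N p| ≤ 1 / 2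
  cocycle_bending : ∀ p, |cocycle T
    (fun p => speedFactor W T p * speedFactor W T p * (transverseFactor W T p)⁻¹) N p| ≤ 1 / 2

namespace IsContractedFlow

open scoped NNReal

variable {W : Plane → Plane} {Φ : ℝ → Plane → Plane} {M : ℝ} {L : ℝ≥0} {T : Plane → Plane}
  {η : ℝ} {k N : ℕ} {c₀ c₁ c : ℝ}

theorem ne_zero (h : IsContractedFlow W Φ M L T η k N c₀ c₁ c) (p : Plane) : W p ≠ 0 :=
  norm_pos_iff.1 (h.lower_pos.trans_le (h.lower_le p))

theorem toIntertwines (h : IsContractedFlow W Φ M L T η k N c₀ c₁ c) :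
    Intertwines Φ T (speedFactor W T) :=
  h.intertwines h.ne_zero h.map_contDiff h.direction h.speedFactor_le

theorem norm_acceleration_le (h : IsContractedFlow W Φ M L T η k N c₀ c₁ c) (p : Plane) :
    ‖acceleration W p‖ ≤ L * M :=
  (ContinuousLinearMap.le_of_opNorm_le _ (h.norm_fderiv_le p) _).trans
    (mul_le_mul_of_nonneg_left (h.norm_le p) L.2)

theorem abs_coord_le (v : Plane) (i : Fin 2) : |v i| ≤ ‖v‖ := PiLp.norm_apply_le v i

theorem leafClass_field_zero (h : IsContractedFlow W Φ M L T η k N c₀ c₁ c) (i : Fin 2) :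
    LeafClass Φ η 0 (fun p => W p i) := by
  have hM : 0 ≤ M := (norm_nonneg _).trans (h.norm_le 0)
  refine ⟨2 * (M + L * M), by positivity, fun p =>
    CurveClass.of_hasDerivAt_of_bounded h.exponent_mem.1 h.exponent_mem.2 convex_univ
      (by positivity) (fun s _ => ?_) (fun s _ => hasDerivAt_coord (h.hasDerivAt_field p s) i)
      fun s _ => ?_⟩
  · exact ((abs_coord_le _ i).trans (h.norm_le _)).trans (le_add_of_nonneg_right (by positivity))
  · exact ((abs_coord_le _ i).trans (h.norm_acceleration_le _)).trans (le_add_of_nonneg_left hM)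

/-- The field is of class `C^(j+η)` along its orbits. -/
def FieldClass (W : Plane → Plane) (Φ : ℝ → Plane → Plane) (η : ℝ) (j : ℕ) : Prop :=
  ∀ i, LeafClass Φ η j (fun p => W p i)

variable {j : ℕ}

theorem leafClass_smooth (h : IsContractedFlow W Φ M L T η k N c₀ c₁ c) (hW : FieldClass W Φ η j)
    {G : Type} [NormedAddCommGroup G] [NormedSpace ℝ G] {f : Plane → G} (A : G →L[ℝ] ℝ) {l : ℕ}
    (hl : j ≤ l) (hf : SmoothBounded η l f) : LeafClass Φ η j (fun p => A (f p)) :=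
  h.leafClass_of_smoothBounded h.exponent_mem A
    (fun _ hi a => (hW a).of_le h.exponent_mem hi.le) (hf.of_le h.exponent_mem hl)

theorem leafClass_fderiv (h : IsContractedFlow W Φ M L T η k N c₀ c₁ c)
    (hW : FieldClass W Φ η j) (hj : j ≤ k) (v : Plane) (i : Fin 2) :
    LeafClass Φ η j (fun p => fderiv ℝ T p v i) :=
  h.leafClass_smooth hW
    ((EuclideanSpace.proj (𝕜 := ℝ) i).comp (ContinuousLinearMap.apply ℝ Plane v)) hj h.map_smooth

theorem leafClass_norm (h : IsContractedFlow W Φ M L T η k N c₀ c₁ c)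
    (hW : FieldClass W Φ η j) (hj : j ≤ k + 1) : LeafClass Φ η j (fun p => ‖W p‖) :=
  h.leafClass_smooth hW (ContinuousLinearMap.id ℝ ℝ) hj h.speed_smooth

theorem leafClass_inv_normSq (h : IsContractedFlow W Φ M L T η k N c₀ c₁ c)
    (hW : FieldClass W Φ η j) (hj : j ≤ k + 1) : LeafClass Φ η j (fun p => (‖W p‖ ^ 2)⁻¹) := by
  have hρ := h.leafClass_norm hW hj
  have hc := h.lower_pos
  simp only [pow_two]
  refine (hρ.mul h.exponent_mem hρ).inv h.exponent_mem (c := c₀ * c₀) (by positivity) fun p => ?_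
  rw [abs_mul, abs_norm]
  exact mul_le_mul (h.lower_le p) (h.lower_le p) hc.le (norm_nonneg _)

theorem leafClass_fderiv_norm (h : IsContractedFlow W Φ M L T η k N c₀ c₁ c)
    (hW : FieldClass W Φ η j) (hj : j ≤ k) {u : Plane → Plane}
    (hu : ∀ i, LeafClass Φ η j (fun p => u p i)) :
    LeafClass Φ η j (fun p => fderiv ℝ (fun p => ‖W p‖) p (u p)) := by
  have hx := fun v => h.leafClass_smooth hW (ContinuousLinearMap.apply ℝ ℝ v) hj
    h.speed_smooth.fderiv
  have heq : (fun p => fderiv ℝ (fun p => ‖W p‖) p (u p)) = fun p =>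
      u p 0 * fderiv ℝ (fun p => ‖W p‖) p ex + u p 1 * fderiv ℝ (fun p => ‖W p‖) p ey := by
    funext p
    conv_lhs => rw [eq_smul_ex_add_smul_ey (u p)]
    simp
  rw [heq]
  exact ((hu 0).mul h.exponent_mem (hx ex)).add ((hu 1).mul h.exponent_mem (hx ey))

theorem leafClass_comp_map (h : IsContractedFlow W Φ M L T η k N c₀ c₁ c)
    (hσ : ∀ i < j, LeafClass Φ η i (speedFactor W T)) {f : Plane → ℝ} (hf : LeafClass Φ η j f) :
    LeafClass Φ η j (fun p => f (T p)) :=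
  h.leafClass_comp h.exponent_mem h.toIntertwines ((abs_nonneg _).trans (h.speedFactor_le 0))
    h.speedFactor_le hσ hf

/-- σ contains W ∘ T, whose order j needs σ only at orders below j; hence strong induction. -/
theorem leafClass_speedFactor (h : IsContractedFlow W Φ M L T η k N c₀ c₁ c)
    (hW : FieldClass W Φ η j) (hj : j ≤ k) : LeafClass Φ η j (speedFactor W T) := by
  induction j using Nat.strong_induction_on with
  | _ j ih =>
    have hη := h.exponent_mem
    have hσ : ∀ i < j, LeafClass Φ η i (speedFactor W T) := fun i hi =>
      ih i hi (fun a => (hW a).of_le hη hi.le) (by omega)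
    exact (LeafClass.dot hη
      (fun i => LeafClass.clm_apply_coord hη i (fun v => h.leafClass_fderiv hW hj v i) hW)
      (fun i => h.leafClass_comp_map hσ (hW i))).mul hη
      (h.leafClass_comp_map hσ (h.leafClass_inv_normSq hW (by omega)))

theorem leafClass_comp_map_of_fieldClass (h : IsContractedFlow W Φ M L T η k N c₀ c₁ c)
    (hW : FieldClass W Φ η j) (hj : j ≤ k) {f : Plane → ℝ} (hf : LeafClass Φ η j f) :
    LeafClass Φ η j (fun p => f (T p)) :=
  h.leafClass_comp_map (fun _ hi => (h.leafClass_speedFactor hW hj).of_le h.exponent_mem hi.le) hf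

theorem leafClass_transverseFactor (h : IsContractedFlow W Φ M L T η k N c₀ c₁ c)
    (hW : FieldClass W Φ η j) (hj : j ≤ k) : LeafClass Φ η j (transverseFactor W T) :=
  (LeafClass.cross h.exponent_mem (fun i => h.leafClass_comp_map_of_fieldClass hW hj (hW i))
    (fun i => LeafClass.clm_apply_coord h.exponent_mem i (fun v => h.leafClass_fderiv hW hj v i)
      (LeafClass.rot hW))).mul h.exponent_mem (h.leafClass_inv_normSq hW (by omega))

theorem leafClass_inv_transverseFactor (h : IsContractedFlow W Φ M L T η k N c₀ c₁ c)
    (hW : FieldClass W Φ η j) (hj : j ≤ k) :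
    LeafClass Φ η j (fun p => (transverseFactor W T p)⁻¹) :=
  (h.leafClass_transverseFactor hW hj).inv h.exponent_mem h.transverse_pos h.le_transverse

theorem transverseFactor_ne_zero (h : IsContractedFlow W Φ M L T η k N c₀ c₁ c) (p : Plane) :
    transverseFactor W T p ≠ 0 :=
  abs_pos.1 (h.transverse_pos.trans_le (h.le_transverse p))

theorem hasDerivAt_cross {u v : ℝ → Plane} {u' v' : Plane} {s : ℝ} (hu : HasDerivAt u u' s)
    (hv : HasDerivAt v v' s) :
    HasDerivAt (fun s => cross (u s) (v s)) (cross u' (v s) + cross (u s) v') s := by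
  refine (((hasDerivAt_coord hu 0).mul (hasDerivAt_coord hv 1)).sub
    ((hasDerivAt_coord hu 1).mul (hasDerivAt_coord hv 0))).congr_deriv ?_
  simp only [cross]; ring

/-- The bending of the orbits solves a cohomological equation over `T`. -/
theorem bending_cohomological (h : IsContractedFlow W Φ M L T η k N c₀ c₁ c)
    (hT : ContDiff ℝ 2 T) (p : Plane) :
    cross (W (T p)) (fderiv ℝ (fderiv ℝ T) p (W p) (W p)) +
      transverseFactor W T p * bending W p =
      speedFactor W T p * speedFactor W T p * bending W (T p) := by
  have hTd : ∀ x, HasFDerivAt T (fderiv ℝ T x) x := fun x =>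
    (hT.differentiable two_ne_zero x).hasFDerivAt
  have hTd2 : HasFDerivAt (fderiv ℝ T) (fderiv ℝ (fderiv ℝ T) (Φ 0 p)) (Φ 0 p) :=
    ((hT.fderiv_right (m := 1) (by norm_num)).differentiable one_ne_zero _).hasFDerivAt
  have h1 : HasDerivAt (fun s => W (T (Φ s p)))
      (fderiv ℝ W (T (Φ 0 p)) (fderiv ℝ T (Φ 0 p) (W (Φ 0 p)))) 0 :=
    ((h.contDiff.differentiable one_ne_zero _).hasFDerivAt).comp_hasDerivAt 0
      ((hTd _).comp_hasDerivAt 0 (h.hasDerivAt p 0))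
  have hDT : HasDerivAt (fun s => fderiv ℝ T (Φ s p))
      (fderiv ℝ (fderiv ℝ T) (Φ 0 p) (W (Φ 0 p))) 0 :=
    hTd2.comp_hasDerivAt 0 (h.hasDerivAt p 0)
  have h2 : HasDerivAt (fun s => fderiv ℝ T (Φ s p) (W (Φ s p)))
      (fderiv ℝ (fderiv ℝ T) (Φ 0 p) (W (Φ 0 p)) (W (Φ 0 p)) +
        fderiv ℝ T (Φ 0 p) (acceleration W (Φ 0 p))) 0 :=
    hDT.clm_apply (h.hasDerivAt_field p 0)
  have h3 := hasDerivAt_cross h1 h2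
  -- Preservation of the direction holds along the whole orbit, so the cross product can be
  -- differentiated. The second derivative of `T` and the bending at both points appear.
  have hzero : (fun s => cross (W (T (Φ s p))) (fderiv ℝ T (Φ s p) (W (Φ s p)))) =
      fun _ => (0 : ℝ) := by
    funext s
    rw [h.direction.cross_fderiv h.ne_zero, cross]; ring
  rw [hzero] at h3
  have h4 := h3.unique (hasDerivAt_const 0 (0 : ℝ))
  rw [h.map_zero, h.direction p, map_smul] at h4
  have h5 := h.direction.cross_fderiv h.ne_zero p (acceleration W p)
  have h6 : ∀ (a b u v : Plane) (x : ℝ), cross (x • a) (x • b) + cross b (u + v) =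
      cross b u + cross b v - x * x * cross b a := by
    intro a b u v x
    simp only [cross, PiLp.add_apply, PiLp.smul_apply, smul_eq_mul]; ring
  rw [h6, h5] at h4
  rw [bending, bending]
  have h7 : acceleration W (T p) = fderiv ℝ W (T p) (W (T p)) := rfl
  rw [h7]
  linarith

theorem abs_bending_le (h : IsContractedFlow W Φ M L T η k N c₀ c₁ c) (p : Plane) :
    |bending W p| ≤ M * (L * M) :=
  (abs_cross_le _ _).trans (mul_le_mul (h.norm_le p) (h.norm_acceleration_le p) (norm_nonneg _)
    ((norm_nonneg _).trans (h.norm_le p)))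

/-- Solving `bending_cohomological` for K gives the multiplier σ²/J. The forcing contains D²T, which
has only k - 1 derivatives; this is the source of the restriction on j. -/
theorem leafClass_bending (h : IsContractedFlow W Φ M L T η k N c₀ c₁ c)
    (hW : FieldClass W Φ η j) (hj : j + 1 ≤ k) : LeafClass Φ η j (bending W) := by
  have hη := h.exponent_mem
  have hσ := h.leafClass_speedFactor hW (by omega)
  have hJ := h.leafClass_inv_transverseFactor hW (by omega)
  obtain ⟨k, rfl⟩ : ∃ l, k = l + 1 := ⟨k - 1, by omega⟩
  have hT2 : ContDiff ℝ 2 T := by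
    have h1 : ContDiff ℝ 1 (fderiv ℝ T) := h.map_smooth.1.of_le (by norm_cast; omega)
    rw [show (2 : WithTop ℕ∞) = 1 + 1 by norm_num, contDiff_succ_iff_fderiv]
    exact ⟨h.map_contDiff.differentiable one_ne_zero, by simp, h1⟩
  have hD2 : ∀ u v i, LeafClass Φ η j (fun p => fderiv ℝ (fderiv ℝ T) p u v i) := by
    intro u v i
    let A₁ : (Plane →L[ℝ] Plane →L[ℝ] Plane) →L[ℝ] Plane →L[ℝ] Plane :=
      ContinuousLinearMap.apply ℝ (Plane →L[ℝ] Plane) u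
    let A₂ : (Plane →L[ℝ] Plane) →L[ℝ] ℝ :=
      (EuclideanSpace.proj (𝕜 := ℝ) i).comp (ContinuousLinearMap.apply ℝ Plane v)
    exact h.leafClass_smooth hW (A₂.comp A₁) (l := k) (by omega) h.map_smooth.fderiv
  have hDW : ∀ v i, LeafClass Φ η j (fun p => fderiv ℝ (fderiv ℝ T) p (W p) v i) := by
    intro v i
    have heq : (fun p => fderiv ℝ (fderiv ℝ T) p (W p) v i) = fun p =>
        W p 0 * fderiv ℝ (fderiv ℝ T) p ex v i + W p 1 * fderiv ℝ (fderiv ℝ T) p ey v i := by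
      funext p
      conv_lhs => rw [eq_smul_ex_add_smul_ey (W p)]
      simp
    rw [heq]
    exact ((hW 0).mul hη (hD2 ex v i)).add ((hW 1).mul hη (hD2 ey v i))
  have hforce : LeafClass Φ η j (fun p => -(cross (W (T p))
      (fderiv ℝ (fderiv ℝ T) p (W p) (W p)) * (transverseFactor W T p)⁻¹)) :=
    ((LeafClass.cross hη (fun i => h.leafClass_comp_map_of_fieldClass hW (by omega) (hW i))
      (fun i => LeafClass.clm_apply_coord hη i (fun v => hDW v i) hW)).mul hη hJ).neg
  refine h.leafClass_of_cohomological_iterate hη h.toIntertwines (N := N) hσ hforce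
    ((hσ.mul hη hσ).mul hη hJ) (fun p => (h.cocycle_speed p).trans (by norm_num))
    h.cocycle_bending h.abs_bending_le
    (fun p => h.continuous_bending.comp (h.continuous_orbit p)) fun p => ?_
  have := h.bending_cohomological hT2 p
  have hne := h.transverseFactor_ne_zero p
  field_simp
  linarith

/-- Half the derivative of ‖W‖², computed in two ways. It lets the regularity of the speed replace
that of W in the direction of W. -/
theorem dot_fderiv_field (h : IsContractedFlow W Φ M L T η k N c₀ c₁ c) (p v : Plane) :
    dot (W p) (fderiv ℝ W p v) = ‖W p‖ * fderiv ℝ (fun p => ‖W p‖) p v := by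
  have hd : DifferentiableAt ℝ (fun p => ‖W p‖) p :=
    h.speed_smooth.1.differentiable (by norm_cast) p
  have h1 := (h.contDiff.differentiable one_ne_zero p).hasFDerivAt.norm_sq
  have h2 := hd.hasFDerivAt.pow 2
  have := congrArg (fun A : Plane →L[ℝ] ℝ => A v) (h1.unique h2)
  simp [inner_eq_dot (W p)] at this
  linarith

/-- The bootstrap step. In the frame (W, rot W) the acceleration has one coefficient given by the
speed and one by the bending, both of class j along orbits. -/
theorem fieldClass_succ (h : IsContractedFlow W Φ M L T η k N c₀ c₁ c)
    (hW : FieldClass W Φ η j) (hj : j + 1 ≤ k) : FieldClass W Φ η (j + 1) := by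
  have hη := h.exponent_mem
  have hK := h.leafClass_bending hW hj
  have hI := h.leafClass_inv_normSq hW (by omega)
  have hu : LeafClass Φ η j (fun p => ‖W p‖ * fderiv ℝ (fun p => ‖W p‖) p (W p)) :=
    (h.leafClass_norm hW (by omega)).mul hη (h.leafClass_fderiv_norm hW (by omega) hW)
  intro i
  refine LeafClass.of_hasDerivAt (g := fun p => acceleration W p i) (B := M)
    (fun p => (abs_coord_le _ i).trans (h.norm_le p))
    (fun p s => hasDerivAt_coord (h.hasDerivAt_field p s) i) ?_
  have heq : (fun p => acceleration W p i) = fun p =>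
      ‖W p‖ * fderiv ℝ (fun p => ‖W p‖) p (W p) * (‖W p‖ ^ 2)⁻¹ * W p i +
        bending W p * (‖W p‖ ^ 2)⁻¹ * rot (W p) i := by
    funext p
    conv_lhs => rw [decompose (W p) (acceleration W p) (h.ne_zero p)]
    rw [← h.dot_fderiv_field]
    rfl
  rw [heq]
  exact ((hu.mul hη hI).mul hη (hW i)).add ((hK.mul hη hI).mul hη (LeafClass.rot hW i))

theorem fieldClass (h : IsContractedFlow W Φ M L T η k N c₀ c₁ c) : FieldClass W Φ η k := by
  have : ∀ j ≤ k, FieldClass W Φ η j := by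
    intro j
    induction j with
    | zero => exact fun _ => h.leafClass_field_zero
    | succ j ih => exact fun hj => h.fieldClass_succ (ih (by omega)) hj
  exact this k le_rfl

theorem abs_divergence_le (h : IsContractedFlow W Φ M L T η k N c₀ c₁ c) (p : Plane) :
    |divergence W p| ≤ 2 * L := by
  have hb : ∀ v i, ‖v‖ = 1 → |fderiv ℝ W p v i| ≤ L := by
    intro v i hv
    refine (abs_coord_le _ i).trans ?_
    have := ContinuousLinearMap.le_of_opNorm_le _ (h.norm_fderiv_le p) v
    rwa [hv, mul_one] at this
  have hx : ‖ex‖ = 1 := by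
    rw [EuclideanSpace.norm_eq, Fin.sum_univ_two]; simp [ex]
  have hy : ‖ey‖ = 1 := by
    rw [EuclideanSpace.norm_eq, Fin.sum_univ_two]; simp [ey]
  refine (abs_add_le _ _).trans ?_
  linarith [hb ex 0 hx, hb ey 1 hy]

/-- The forcing term -J'/J costs one derivative of J. The loss is harmless, as the Jacobian is
recovered from div W by integration. -/
theorem leafClass_divergence (h : IsContractedFlow W Φ M L T η (k + 1) N c₀ c₁ c) :
    LeafClass Φ η k (divergence W) := by
  have hη := h.exponent_mem
  have hW := h.fieldClass
  have hW' : FieldClass W Φ η k := fun i => (hW i).lower hη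
  obtain ⟨J', hJ', hJk⟩ := h.exists_leafDeriv (h.leafClass_transverseFactor hW le_rfl)
  have hσ := h.leafClass_speedFactor hW' (by omega)
  refine h.leafClass_of_cohomological_iterate hη h.toIntertwines (N := N) hσ
    (hJk.mul hη (h.leafClass_inv_transverseFactor hW' (by omega))).neg hσ
    (fun p => (h.cocycle_speed p).trans (by norm_num)) h.cocycle_speed h.abs_divergence_le
    (fun p => h.continuous_divergence.comp (h.continuous_orbit p)) fun p => ?_
  have := h.divergence_cohomological h.ne_zero h.map_contDiff h.direction h.speedFactor_le hJ' p
  have hne := h.transverseFactor_ne_zero p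
  field_simp
  linarith

theorem shear_eq (h : IsContractedFlow W Φ M L T η k N c₀ c₁ c) (p : Plane) :
    shear W p = (‖W p‖ * fderiv ℝ (fun p => ‖W p‖) p (rot (W p)) + bending W p) *
      (‖W p‖ ^ 2)⁻¹ := by
  rw [← h.dot_fderiv_field, shear, div_eq_mul_inv]
  congr 2
  simp only [dot]; ring

/-- By `shear_eq` the shear involves DW only through the differential of the speed and the bending.
-/
theorem leafClass_shear (h : IsContractedFlow W Φ M L T η (k + 1) N c₀ c₁ c) :
    LeafClass Φ η k (shear W) := by
  have hη := h.exponent_mem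
  have hW : FieldClass W Φ η k := fun i => (h.fieldClass i).lower hη
  rw [funext h.shear_eq]
  exact (((h.leafClass_norm hW (by omega)).mul hη
    (h.leafClass_fderiv_norm hW (by omega) (LeafClass.rot hW))).add
    (h.leafClass_bending hW le_rfl)).mul hη (h.leafClass_inv_normSq hW (by omega))

theorem abs_shear_le (h : IsContractedFlow W Φ M L T η k N c₀ c₁ c) (p : Plane) :
    |shear W p| ≤ (L * M * M + M * (L * M)) * (c₀ ^ 2)⁻¹ := by
  have hM : 0 ≤ M := (norm_nonneg _).trans (h.norm_le p)
  have hc := h.lower_pos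
  rw [shear, abs_div, div_eq_mul_inv, abs_pow, abs_norm]
  have h1 : |dot (fderiv ℝ W p (rot (W p))) (W p)| ≤ L * M * M := by
    refine (abs_dot_le _ _).trans (mul_le_mul ?_ (h.norm_le p) (norm_nonneg _) (by positivity))
    refine (ContinuousLinearMap.le_of_opNorm_le _ (h.norm_fderiv_le p) _).trans ?_
    rw [norm_rot]
    exact mul_le_mul_of_nonneg_left (h.norm_le p) L.2
  refine mul_le_mul ((abs_add_le _ _).trans (add_le_add h1 (h.abs_bending_le p))) ?_
    (by positivity) (by positivity)
  exact inv_anti₀ (by positivity) (pow_le_pow_left₀ hc.le (h.lower_le p) 2)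

end IsContractedFlow

/-! ### Polynomial bounds for the derivative of the flow -/

section PolyClass

variable {E : Type*} [NormedAddCommGroup E] [NormedSpace ℝ E]

/-- A family of curves growing at most polynomially, uniformly over the family. -/
def PolyBound (f : Plane → ℝ → E) : Prop :=
  ∃ C β : ℝ, 0 ≤ C ∧ 0 ≤ β ∧ ∀ p t, 0 < t → ∀ s ∈ Icc 0 t, ‖f p s‖ ≤ C * max 1 t ^ β

/-- A family of curves whose `C^(k+η)` norm on `(0, t)` grows at most polynomially in `t`. -/
def PolyClass (η : ℝ) (k : ℕ) (f : Plane → ℝ → E) : Prop :=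
  ∃ C β : ℝ, 0 ≤ C ∧ 0 ≤ β ∧ ∀ p t, 0 < t → CurveClass η k (C * max 1 t ^ β) (Ioo 0 t) (f p)

theorem rpow_max_le_rpow_max {t β β' : ℝ} (h : β ≤ β') : max 1 t ^ β ≤ max 1 t ^ β' :=
  Real.rpow_le_rpow_of_exponent_le (le_max_left _ _) h

theorem rpow_max_nonneg (t β : ℝ) : 0 ≤ max 1 t ^ β :=
  Real.rpow_nonneg (zero_le_one.trans (le_max_left _ _)) β

theorem rpow_max_add (t β β' : ℝ) : max 1 t ^ (β + β') = max 1 t ^ β * max 1 t ^ β' :=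
  Real.rpow_add (zero_lt_one.trans_le (le_max_left _ _)) β β'

theorem add_rpow_max_le {C C' t β β' : ℝ} (hC : 0 ≤ C) (hC' : 0 ≤ C') (hβ : 0 ≤ β) (hβ' : 0 ≤ β') :
    C * max 1 t ^ β + C' * max 1 t ^ β' ≤ (C + C') * max 1 t ^ (β + β') := by
  rw [add_mul]
  exact add_le_add (mul_le_mul_of_nonneg_left (rpow_max_le_rpow_max (by linarith)) hC)
    (mul_le_mul_of_nonneg_left (rpow_max_le_rpow_max (by linarith)) hC')

theorem PolyBound.mul {f g : Plane → ℝ → ℝ} (hf : PolyBound f) (hg : PolyBound g) :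
    PolyBound fun p s => f p s * g p s := by
  obtain ⟨C, β, hC, hβ, hf⟩ := hf
  obtain ⟨C', β', hC', hβ', hg⟩ := hg
  refine ⟨C * C', β + β', by positivity, by positivity, fun p t ht s hs => ?_⟩
  rw [norm_mul, rpow_max_add]
  calc ‖f p s‖ * ‖g p s‖ ≤ (C * max 1 t ^ β) * (C' * max 1 t ^ β') :=
        mul_le_mul (hf p t ht s hs) (hg p t ht s hs) (norm_nonneg _)
          (mul_nonneg hC (rpow_max_nonneg _ _))
    _ = _ := by ring

theorem polyBound_of_bounded {f : Plane → ℝ → ℝ} {B : ℝ} (hf : ∀ p s, ‖f p s‖ ≤ B) :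
    PolyBound f :=
  ⟨B, 0, (norm_nonneg _).trans (hf 0 0), le_rfl, fun p t _ s _ => by simpa using hf p s⟩

/-- The primitives of a family of curves of polynomial growth have polynomial growth. -/
theorem PolyBound.of_hasDerivAt {f g : Plane → ℝ → E} (hg : PolyBound g)
    (h0 : ∀ p, f p 0 = 0) (hfg : ∀ p s, HasDerivAt (f p) (g p s) s) : PolyBound f := by
  obtain ⟨C, β, hC, hβ, hg⟩ := hg
  refine ⟨C, β + 1, hC, by positivity, fun p t ht s hs => ?_⟩
  have key : ∀ x ∈ Icc 0 s, ‖f p x - f p 0‖ ≤ C * max 1 t ^ β * (x - 0) := by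
    refine norm_image_sub_le_of_norm_deriv_right_le_segment
      (fun x _ => (hfg p x).continuousAt.continuousWithinAt)
      (fun x _ => (hfg p x).hasDerivWithinAt) fun x hx => ?_
    exact hg p t ht x ⟨hx.1, hx.2.le.trans hs.2⟩
  have := key s ⟨hs.1, le_rfl⟩
  rw [h0, sub_zero, sub_zero] at this
  refine this.trans ?_
  rw [rpow_max_add, Real.rpow_one, ← mul_assoc]
  refine mul_le_mul_of_nonneg_left (hs.2.trans (le_max_right _ _))
    (mul_nonneg hC (rpow_max_nonneg _ _))

namespace PolyClass

variable {η : ℝ} {k : ℕ}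

theorem add {f g : Plane → ℝ → E} (hf : PolyClass η k f) (hg : PolyClass η k g) :
    PolyClass η k fun p s => f p s + g p s := by
  obtain ⟨C, β, hC, hβ, hf⟩ := hf
  obtain ⟨C', β', hC', hβ', hg⟩ := hg
  exact ⟨C + C', β + β', by positivity, by positivity, fun p t ht =>
    ((hf p t ht).add (hg p t ht)).mono (add_rpow_max_le hC hC' hβ hβ')⟩

theorem smul (hη : η ∈ Icc (0 : ℝ) 1) {f : Plane → ℝ → ℝ} {g : Plane → ℝ → E}
    (hf : PolyClass η k f) (hg : PolyClass η k g) : PolyClass η k fun p s => f p s • g p s := by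
  obtain ⟨C, β, hC, hβ, hf⟩ := hf
  obtain ⟨C', β', hC', hβ', hg⟩ := hg
  refine ⟨2 * 4 ^ k * (C * C'), β + β', by positivity, by positivity, fun p t ht =>
    (CurveClass.smul hη.1 hη.2 (convex_Ioo 0 t) (mul_nonneg hC (rpow_max_nonneg _ _))
      (mul_nonneg hC' (rpow_max_nonneg _ _)) (hf p t ht) (hg p t ht)).mono (le_of_eq ?_)⟩
  rw [rpow_max_add]; ring

theorem mul (hη : η ∈ Icc (0 : ℝ) 1) {f g : Plane → ℝ → ℝ} (hf : PolyClass η k f)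
    (hg : PolyClass η k g) : PolyClass η k fun p s => f p s * g p s := smul hη hf hg

theorem of_leafClass {Φ : ℝ → Plane → Plane} {f : Plane → ℝ} (hf : LeafClass Φ η k f) :
    PolyClass η k fun p s => f (Φ s p) := by
  obtain ⟨B, hB, hf⟩ := hf
  exact ⟨B, 0, hB, le_rfl, fun p t _ => ((hf p).mono_set (subset_univ _)).mono (by simp)⟩

theorem const {g : Plane → E} {B : ℝ} (hg : ∀ p, ‖g p‖ ≤ B) :
    PolyClass η k fun p (_ : ℝ) => g p :=
  ⟨B, 0, (norm_nonneg _).trans (hg 0), le_rfl, fun p t _ =>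
    (CurveClass.const (g p)).mono (by simpa using hg p)⟩

theorem zero_of_hasDerivAt (hη : η ∈ Icc (0 : ℝ) 1) {f g : Plane → ℝ → E} (hf : PolyBound f)
    (hg : PolyBound g) (hfg : ∀ p s, HasDerivAt (f p) (g p s) s) : PolyClass η 0 f := by
  obtain ⟨C, β, hC, hβ, hf⟩ := hf
  obtain ⟨C', β', hC', hβ', hg⟩ := hg
  refine ⟨2 * (C + C'), β + β', by positivity, by positivity, fun p t ht => ?_⟩
  rw [mul_assoc]
  have hle := add_rpow_max_le (t := t) hC hC' hβ hβ'
  have h1 := mul_nonneg hC (rpow_max_nonneg t β)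
  have h2 := mul_nonneg hC' (rpow_max_nonneg t β')
  exact CurveClass.of_hasDerivAt_of_bounded hη.1 hη.2 (convex_Ioo 0 t) (by linarith)
    (fun s hs => (hf p t ht s (Ioo_subset_Icc_self hs)).trans (by linarith))
    (fun s _ => hfg p s) (fun s hs => (hg p t ht s (Ioo_subset_Icc_self hs)).trans (by linarith))

theorem succ_of_hasDerivAt {f g : Plane → ℝ → E} (hf : PolyBound f) (hg : PolyClass η k g)
    (hfg : ∀ p s, HasDerivAt (f p) (g p s) s) : PolyClass η (k + 1) f := by
  obtain ⟨C, β, hC, hβ, hf⟩ := hf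
  obtain ⟨C', β', hC', hβ', hg⟩ := hg
  refine ⟨C + C', β + β', by positivity, by positivity, fun p t ht => ?_⟩
  have hle := add_rpow_max_le (t := t) hC hC' hβ hβ'
  have h1 := mul_nonneg hC (rpow_max_nonneg t β)
  have h2 := mul_nonneg hC' (rpow_max_nonneg t β')
  exact ⟨fun s hs => (hf p t ht s (Ioo_subset_Icc_self hs)).trans (by linarith), g p,
    fun s _ => hfg p s, (hg p t ht).mono (by linarith)⟩

end PolyClass

end PolyClass

namespace IsContractedFlow

open scoped NNReal

variable {W : Plane → Plane} {Φ : ℝ → Plane → Plane} {M : ℝ} {L : ℝ≥0} {T : Plane → Plane}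
  {η : ℝ} {k N : ℕ} {c₀ c₁ c : ℝ}

theorem polyBound_flowJacobian (h : IsContractedFlow W Φ M L T η k N c₀ c₁ c) :
    PolyBound (flowJacobian W Φ) := by
  obtain ⟨c₂, -, hc₂⟩ := h.exists_abs_le (h.leafClass_transverseFactor h.fieldClass le_rfl)
  obtain ⟨C, β, hC, hβ, hb⟩ := h.exists_flowJacobian_le h.ne_zero h.map_contDiff h.direction
    h.speedFactor_le h.abs_divergence_le h.transverse_pos h.le_transverse hc₂ h.cocycle_speed
  refine ⟨C, β, hC.le, hβ.le, fun p t _ s hs => ?_⟩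
  rw [Real.norm_eq_abs, abs_of_pos (IsC1Flow.flowJacobian_pos p s)]
  refine (hb p s).trans ?_
  gcongr
  rw [abs_of_nonneg hs.1]
  exact hs.2

/-- Bootstrap in Jac' = Jac · div W, starting from the polynomial bound. -/
theorem polyClass_flowJacobian (h : IsContractedFlow W Φ M L T η k N c₀ c₁ c) {j : ℕ}
    (hj : j ≤ k) : PolyClass η j (flowJacobian W Φ) := by
  have hη := h.exponent_mem
  induction j with
  | zero =>
    exact PolyClass.zero_of_hasDerivAt hη h.polyBound_flowJacobian
      (h.polyBound_flowJacobian.mul (polyBound_of_bounded fun p s => h.abs_divergence_le (Φ s p)))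
      h.hasDerivAt_flowJacobian
  | succ j ih =>
    obtain ⟨k, rfl⟩ : ∃ l, k = l + 1 := ⟨k - 1, by omega⟩
    exact PolyClass.succ_of_hasDerivAt h.polyBound_flowJacobian
      ((ih (by omega)).mul hη
        (PolyClass.of_leafClass (h.leafClass_divergence.of_le hη (by omega))))
      h.hasDerivAt_flowJacobian

theorem norm_normSq_le (h : IsContractedFlow W Φ M L T η k N c₀ c₁ c) (p : Plane) :
    ‖‖W p‖ ^ 2‖ ≤ M ^ 2 := by
  rw [norm_pow, norm_norm]
  exact pow_le_pow_left₀ (norm_nonneg _) (h.norm_le p) 2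

theorem norm_inv_normSq_le (h : IsContractedFlow W Φ M L T η k N c₀ c₁ c) (p : Plane) :
    ‖(‖W p‖ ^ 2)⁻¹‖ ≤ (c₀ ^ 2)⁻¹ := by
  have hc := h.lower_pos
  rw [norm_inv, norm_pow, norm_norm]
  exact inv_anti₀ (by positivity) (pow_le_pow_left₀ hc.le (h.lower_le p) 2)

theorem polyBound_flowNormal (h : IsContractedFlow W Φ M L T η k N c₀ c₁ c) :
    PolyBound (flowNormal W Φ) :=
  (h.polyBound_flowJacobian.mul (polyBound_of_bounded fun p _ => h.norm_normSq_le p)).mul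
    (polyBound_of_bounded fun p s => h.norm_inv_normSq_le (Φ s p))

theorem polyClass_flowNormal (h : IsContractedFlow W Φ M L T η k N c₀ c₁ c) {j : ℕ}
    (hj : j ≤ k) : PolyClass η j (flowNormal W Φ) :=
  ((h.polyClass_flowJacobian hj).mul h.exponent_mem (PolyClass.const h.norm_normSq_le)).mul
    h.exponent_mem (PolyClass.of_leafClass (h.leafClass_inv_normSq
      (fun i => (h.fieldClass i).of_le h.exponent_mem hj) (by omega)))

theorem polyClass_flowShear (h : IsContractedFlow W Φ M L T η k N c₀ c₁ c) :
    PolyClass η k (flowShear W Φ) := by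
  have hη := h.exponent_mem
  have hder := h.hasDerivAt_flowShear h.ne_zero
  have hb : PolyBound fun p s => flowNormal W Φ p s * shear W (Φ s p) :=
    h.polyBound_flowNormal.mul (polyBound_of_bounded fun p s => h.abs_shear_le (Φ s p))
  have hS : PolyBound (flowShear W Φ) := hb.of_hasDerivAt (fun p => by simp [flowShear]) hder
  cases k with
  | zero => exact PolyClass.zero_of_hasDerivAt hη hS hb hder
  | succ k =>
    exact PolyClass.succ_of_hasDerivAt hS ((h.polyClass_flowNormal (by omega)).mul hη
      (PolyClass.of_leafClass h.leafClass_shear)) hder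

theorem norm_smulRight_le (h : IsContractedFlow W Φ M L T η k N c₀ c₁ c) (p u v : Plane)
    (hu : ‖u‖ ≤ M) :
    ‖((‖W p‖ ^ 2)⁻¹ • innerSL ℝ u).smulRight v‖ ≤ (c₀ ^ 2)⁻¹ * M * ‖v‖ := by
  rw [ContinuousLinearMap.norm_smulRight_apply, norm_smul, innerSL_apply_norm]
  have := h.norm_inv_normSq_le p
  gcongr

/-- Separates scalar curves in s from operators depending only on p, so that the calculus of scalar
multiples applies. -/
theorem flowDeriv_eq (W : Plane → Plane) (Φ : ℝ → Plane → Plane) (p : Plane) (s : ℝ) :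
    flowDeriv W Φ p s =
      W (Φ s p) 0 • ((‖W p‖ ^ 2)⁻¹ • innerSL ℝ (W p)).smulRight ex +
      W (Φ s p) 1 • ((‖W p‖ ^ 2)⁻¹ • innerSL ℝ (W p)).smulRight ey +
      (flowShear W Φ p s * W (Φ s p) 0 + flowNormal W Φ p s * rot (W (Φ s p)) 0) •
        ((‖W p‖ ^ 2)⁻¹ • innerSL ℝ (rot (W p))).smulRight ex +
      (flowShear W Φ p s * W (Φ s p) 1 + flowNormal W Φ p s * rot (W (Φ s p)) 1) •
        ((‖W p‖ ^ 2)⁻¹ • innerSL ℝ (rot (W p))).smulRight ey := by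
  ext1 v
  refine plane_ext ?_ ?_
  all_goals
    simp only [flowDeriv, add_apply, smul_apply, ContinuousLinearMap.smulRight_apply,
      PiLp.add_apply, PiLp.smul_apply, smul_eq_mul, ex, ey]
    simp
    ring

theorem polyClass_flowDeriv (h : IsContractedFlow W Φ M L T η k N c₀ c₁ c) :
    PolyClass η k (flowDeriv W Φ) := by
  have hη := h.exponent_mem
  have hW : ∀ i, PolyClass η k fun p s => W (Φ s p) i := fun i =>
    PolyClass.of_leafClass (h.fieldClass i)
  have hR : ∀ i, PolyClass η k fun p s => rot (W (Φ s p)) i := fun i =>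
    PolyClass.of_leafClass (LeafClass.rot h.fieldClass i)
  have h1 : ∀ v, PolyClass η k fun p (_ : ℝ) =>
      ((‖W p‖ ^ 2)⁻¹ • innerSL ℝ (W p)).smulRight v := fun v =>
    PolyClass.const fun p => h.norm_smulRight_le p (W p) v (h.norm_le p)
  have h2 : ∀ v, PolyClass η k fun p (_ : ℝ) =>
      ((‖W p‖ ^ 2)⁻¹ • innerSL ℝ (rot (W p))).smulRight v := fun v =>
    PolyClass.const fun p => h.norm_smulRight_le p (rot (W p)) v
      (by rw [norm_rot]; exact h.norm_le p)
  have h3 : ∀ i, PolyClass η k fun p s =>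
      flowShear W Φ p s * W (Φ s p) i + flowNormal W Φ p s * rot (W (Φ s p)) i := fun i =>
    (h.polyClass_flowShear.mul hη (hW i)).add ((h.polyClass_flowNormal le_rfl).mul hη (hR i))
  have heq : flowDeriv W Φ = fun p s => _ := funext fun p => funext fun s => flowDeriv_eq W Φ p s
  rw [heq]
  exact ((((hW 0).smul hη (h1 ex)).add ((hW 1).smul hη (h1 ey))).add
    ((h3 0).smul hη (h2 ex))).add ((h3 1).smul hη (h2 ey))

end IsContractedFlow

/-! ### Anosov diffeomorphisms in the universal cover -/

open scoped NNReal in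
/-- A flow on the torus generated by a `C^1` vector field lifts to the plane. -/
theorem exists_lift_flow {V : Torus2 → Plane} {φ : Flow ℝ Torus2} (hφ : IsFlowGeneratedBy φ V)
    (hV : ContDiff ℝ 1 fun p => V (torusProj p)) :
    ∃ (Φ : ℝ → Plane → Plane) (M : ℝ) (L : ℝ≥0), IsC1Flow (fun p => V (torusProj p)) Φ M L ∧
      ∀ s p, torusProj (Φ s p) = φ s (torusProj p) := by
  choose γ hγ using hφ
  have hper := latticePeriodic_comp_torusProj V
  obtain ⟨M, -, hM⟩ := hper.exists_norm_le hV.continuous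
  obtain ⟨L, hL0, hL⟩ := hper.fderiv.exists_norm_le (hV.continuous_fderiv one_ne_zero)
  have hproj : ∀ s p, torusProj (γ (torusProj p) s - γ (torusProj p) 0 + p) =
      φ s (torusProj p) := by
    intro s p
    rw [torusProj_add, torusProj_sub, (hγ _ s).1, (hγ _ 0).1, φ.map_zero_apply, sub_add_cancel]
  -- The chosen lift of an orbit may start at another preimage; translating it by a lattice vector
  -- makes it start at p.
  refine ⟨fun s p => γ (torusProj p) s - γ (torusProj p) 0 + p, M, ⟨L, hL0⟩,
    ⟨hV, hM, ?_, fun p => by simp, fun p s => ?_⟩, hproj⟩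
  · exact lipschitzWith_of_nnnorm_fderiv_le (hV.differentiable one_ne_zero) fun x => hL x
  · rw [hproj]
    exact ((hγ (torusProj p) s).2.sub_const _).add_const _

/-- Two nontrivial complementary subspaces of the plane are lines. -/
theorem mem_span_of_isCompl {A B : Submodule ℝ Plane} (hA : A ≠ ⊥) (hB : B ≠ ⊥)
    (hAB : IsCompl A B) {v w : Plane} (hv : v ∈ A) (hv0 : v ≠ 0) (hw : w ∈ A) :
    ∃ c : ℝ, w = c • v := by
  have hsum := Submodule.finrank_add_eq_of_isCompl hAB
  rw [finrank_euclideanSpace, Fintype.card_fin] at hsum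
  have h1 : 1 ≤ Module.finrank ℝ A := Submodule.one_le_finrank_iff.2 hA
  have h2 : 1 ≤ Module.finrank ℝ B := Submodule.one_le_finrank_iff.2 hB
  have hA1 : Module.finrank ℝ A = 1 := by omega
  obtain ⟨c, hc⟩ := (finrank_eq_one_iff_of_nonzero' (⟨v, hv⟩ : A)
    (by simpa using hv0)).1 hA1 ⟨w, hw⟩
  exact ⟨c, (congrArg Subtype.val hc).symm⟩

/-- Reduces the bending multiplier σ²/J to the cocycles of σ and J, which hyperbolicity controls
separately. -/
theorem cocycle_mul_mul_inv (T : Plane → Plane) (a b : Plane → ℝ) (n : ℕ) (p : Plane) :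
    cocycle T (fun p => a p * a p * (b p)⁻¹) n p =
      cocycle T a n p * cocycle T a n p * (cocycle T b n p)⁻¹ := by
  induction n generalizing p with
  | zero => simp [cocycle]
  | succ n ih => simp only [cocycle, ih, mul_inv]; ring

theorem contDiff_iterate {g : Plane → Plane} (hg : ContDiff ℝ 1 g) (n : ℕ) :
    ContDiff ℝ 1 (g^[n]) := by
  induction n with
  | zero => exact contDiff_id
  | succ n ih => rw [Function.iterate_succ]; exact ih.comp hg

theorem fderiv_iterate_succ {g : Plane → Plane} (hg : ContDiff ℝ 1 g) (n : ℕ) (p : Plane) :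
    fderiv ℝ (g^[n + 1]) p = (fderiv ℝ (g^[n]) (g p)).comp (fderiv ℝ g p) := by
  rw [Function.iterate_succ]
  exact fderiv_comp p ((contDiff_iterate hg n).differentiable one_ne_zero _)
    (hg.differentiable one_ne_zero p)

namespace PreservesDirection

variable {W g : Plane → Plane}

theorem fderiv_iterate (hd : PreservesDirection W g) (hg : ContDiff ℝ 1 g) (n : ℕ) (p : Plane) :
    fderiv ℝ (g^[n]) p (W p) = cocycle g (speedFactor W g) n p • W (g^[n] p) := by
  induction n generalizing p with
  | zero => simp [cocycle]
  | succ n ih =>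
    rw [fderiv_iterate_succ hg, ContinuousLinearMap.comp_apply, hd p, map_smul, ih (g p), smul_smul,
      cocycle, Function.iterate_succ_apply]

theorem cross_fderiv_iterate (hd : PreservesDirection W g) (hg : ContDiff ℝ 1 g)
    (h0 : ∀ p, W p ≠ 0) (n : ℕ) (p v : Plane) :
    cross (W (g^[n] p)) (fderiv ℝ (g^[n]) p v) =
      cocycle g (transverseFactor W g) n p * cross (W p) v := by
  induction n generalizing p v with
  | zero => simp [cocycle]
  | succ n ih =>
    rw [fderiv_iterate_succ hg, ContinuousLinearMap.comp_apply, Function.iterate_succ_apply,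
      ih (g p), hd.cross_fderiv h0, cocycle]
    ring

end PreservesDirection

section Lift

variable {r : ℝ} {F : Torus2 ≃ Torus2} {Es Eu : Torus2 → Submodule ℝ Plane} {g : Plane → Plane}

theorem torusProj_iterate {f : Torus2 → Torus2} (hg : ∀ p, torusProj (g p) = f (torusProj p))
    (n : ℕ) (p : Plane) : torusProj (g^[n] p) = f^[n] (torusProj p) :=
  (Function.Semiconj.iterate_right (f := torusProj) hg n) p

theorem hasTorusFDerivAt_iterate {f : Torus2 → Torus2}
    (hg : ∀ p, torusProj (g p) = f (torusProj p)) (hgc : ContDiff ℝ 1 g) (n : ℕ) (p : Plane) :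
    HasTorusFDerivAt (f^[n]) (fderiv ℝ (g^[n]) p) (torusProj p) :=
  ⟨p, g^[n], rfl, Eventually.of_forall (torusProj_iterate hg n),
    ((contDiff_iterate hgc n).differentiable one_ne_zero p).hasFDerivAt⟩

theorem hasTorusFDerivAt_lift {f : Torus2 → Torus2}
    (hg : ∀ p, torusProj (g p) = f (torusProj p)) (hgc : ContDiff ℝ 1 g) (p : Plane) :
    HasTorusFDerivAt f (fderiv ℝ g p) (torusProj p) :=
  hasTorusFDerivAt_iterate hg hgc 1 p

theorem IsAnosov.fderiv_iterate_mem_unstable (hF : IsAnosov r F Es Eu)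
    (hg : ∀ p, torusProj (g p) = F (torusProj p)) (hgc : ContDiff ℝ 1 g) (n : ℕ) {p u : Plane}
    (hu : u ∈ Eu (torusProj p)) :
    fderiv ℝ (g^[n]) p u ∈ Eu (torusProj (g^[n] p)) := by
  induction n generalizing p u with
  | zero => simpa using hu
  | succ n ih =>
    rw [fderiv_iterate_succ hgc, ContinuousLinearMap.comp_apply, Function.iterate_succ_apply]
    refine ih ?_
    rw [hg, ← hF.map_unstable _ _ (hasTorusFDerivAt_lift hg hgc p)]
    exact Submodule.mem_map_of_mem hu

theorem IsAnosov.preservesDirection (hF : IsAnosov r F Es Eu)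
    (hg : ∀ p, torusProj (g p) = F (torusProj p)) (hgc : ContDiff ℝ 1 g) {V : Torus2 → Plane}
    (hV0 : ∀ x, V x ≠ 0) (hVs : ∀ x, V x ∈ Es x) :
    PreservesDirection (fun p => V (torusProj p)) g := by
  intro p
  have hmem : fderiv ℝ g p (V (torusProj p)) ∈ Es (torusProj (g p)) := by
    rw [hg, ← hF.map_stable _ _ (hasTorusFDerivAt_lift hg hgc p)]
    exact Submodule.mem_map_of_mem (hVs _)
  obtain ⟨c, hc⟩ := mem_span_of_isCompl (hF.stable_ne_bot _) (hF.unstable_ne_bot _)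
    (hF.isCompl _) (hVs (torusProj (g p))) (hV0 _) hmem
  have hne : ‖V (torusProj (g p))‖ ^ 2 ≠ 0 := by have := hV0 (torusProj (g p)); positivity
  have hdot : ∀ (c : ℝ) (u : Plane), dot (c • u) u = c * ‖u‖ ^ 2 := by
    intro c u
    rw [← dot_self]
    simp only [dot, PiLp.smul_apply, smul_eq_mul]; ring
  rw [speedFactor, hc, hdot, mul_div_cancel_right₀ _ hne]

/-- The unstable directions are uniformly transverse to the stable field. -/
theorem IsAnosov.exists_le_abs_cross (hF : IsAnosov r F Es Eu)
    (hg : ∀ p, torusProj (g p) = F (torusProj p)) (hgc : ContDiff ℝ 1 g) {V : Torus2 → Plane}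
    (hVs : ∀ x, V x ∈ Es x) {c₀ : ℝ} (hc₀ : 0 < c₀) (hVc : ∀ x, c₀ ≤ ‖V x‖) :
    ∃ c > 0, ∀ p, ∀ u ∈ Eu (torusProj p), c * ‖u‖ ≤ |cross (V (torusProj p)) u| := by
  obtain ⟨C, lam, hC, hlam, hyp⟩ := hF.hyperbolic
  -- With this n, unstable vectors are stretched by at least C + 1, and stable ones by at most C.
  obtain ⟨n, hn⟩ : ∃ n : ℕ, C * (C + 1) ≤ lam ^ n := by
    obtain ⟨n, hn⟩ := pow_unbounded_of_one_lt (C * (C + 1)) hlam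
    exact ⟨n, hn.le⟩
  obtain ⟨S, hS0, hS⟩ := (latticePeriodic_fderiv_of_lift (torusProj_iterate hg n)
    (contDiff_iterate hgc n).continuous).exists_norm_le
    ((contDiff_iterate hgc n).continuous_fderiv one_ne_zero)
  refine ⟨c₀ / (S + 1), by positivity, fun p u hu => ?_⟩
  obtain ⟨h1, h2⟩ := hyp n _ _ (hasTorusFDerivAt_iterate hg hgc n p)
  set A := fderiv ℝ (g^[n]) p with hA
  set w := V (torusProj p) with hw
  have hwc : c₀ ≤ ‖w‖ := hVc _
  have hw0 : w ≠ 0 := norm_pos_iff.1 (hc₀.trans_le hwc)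
  have hwpos : 0 < ‖w‖ := norm_pos_iff.2 hw0
  have hlow : (C + 1) * ‖u‖ ≤ ‖A u‖ := by
    refine le_trans ?_ (h2 u hu)
    gcongr
    rw [inv_mul_eq_div, le_div_iff₀ hC]
    linarith
  have hAw : ‖A w‖ ≤ C * ‖w‖ := by
    refine (h1 w (hVs _)).trans ?_
    have : lam⁻¹ ^ n ≤ 1 := pow_le_one₀ (by positivity) (inv_le_one_of_one_le₀ hlam.le)
    have : C * lam⁻¹ ^ n ≤ C := mul_le_of_le_one_right hC.le this
    gcongr
  have hAr : ‖A (rot w)‖ ≤ S * ‖w‖ := by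
    rw [← norm_rot w]
    exact ContinuousLinearMap.le_of_opNorm_le _ (hS p) _
  -- The part of u along w contributes at most C ‖u‖, so the remaining ‖u‖ must come from the
  -- transverse part: this bounds the angle from below without continuity of `Eu`.
  have hup : ‖A u‖ ≤ C * ‖u‖ + S * (|cross w u| / ‖w‖) := by
    conv_lhs => rw [decompose w u hw0, map_add, map_smul, map_smul]
    refine (norm_add_le _ _).trans (add_le_add ?_ ?_)
    · rw [norm_smul, norm_div, norm_pow, norm_norm, Real.norm_eq_abs]
      calc |dot w u| / ‖w‖ ^ 2 * ‖A w‖ ≤ ‖w‖ * ‖u‖ / ‖w‖ ^ 2 * (C * ‖w‖) := by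
            gcongr
            exact abs_dot_le w u
        _ = C * ‖u‖ := by field_simp
    · rw [norm_smul, norm_div, norm_pow, norm_norm, Real.norm_eq_abs]
      calc |cross w u| / ‖w‖ ^ 2 * ‖A (rot w)‖ ≤ |cross w u| / ‖w‖ ^ 2 * (S * ‖w‖) := by gcongr
        _ = _ := by field_simp
  have hfin : ‖u‖ ≤ S * (|cross w u| / ‖w‖) := by linarith
  have h3 : S * (|cross w u| / ‖w‖) ≤ (S + 1) * (|cross w u| / c₀) := by gcongr; linarith
  rw [div_mul_eq_mul_div, div_le_iff₀ (by positivity)]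
  have h4 : ‖u‖ ≤ (S + 1) * |cross w u| / c₀ := by rw [mul_div_assoc]; exact hfin.trans h3
  rw [le_div_iff₀ hc₀] at h4
  linarith

/-- The transverse cocycle of an Anosov map is bounded below. -/
theorem IsAnosov.exists_le_abs_cocycle (hF : IsAnosov r F Es Eu)
    (hg : ∀ p, torusProj (g p) = F (torusProj p)) (hgc : ContDiff ℝ 1 g) {V : Torus2 → Plane}
    (hVs : ∀ x, V x ∈ Es x) {c₀ M : ℝ} (hc₀ : 0 < c₀) (hVc : ∀ x, c₀ ≤ ‖V x‖)
    (hVM : ∀ x, ‖V x‖ ≤ M) :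
    ∃ c > 0, ∀ n p, c ≤ |cocycle g (transverseFactor (fun p => V (torusProj p)) g) n p| := by
  have hV0 : ∀ x, V x ≠ 0 := fun x => norm_pos_iff.1 (hc₀.trans_le (hVc x))
  have hd := hF.preservesDirection hg hgc hV0 hVs
  obtain ⟨c, hc, hcr⟩ := hF.exists_le_abs_cross hg hgc hVs hc₀ hVc
  obtain ⟨C, lam, hC, hlam, hyp⟩ := hF.hyperbolic
  have hM : 0 < M := hc₀.trans_le ((hVc 0).trans (hVM 0))
  refine ⟨c * C⁻¹ / M, by positivity, fun n p => ?_⟩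
  -- An unstable vector tests the cocycle: its image is not short, and is uniformly transverse to
  -- the field.
  obtain ⟨u, hu, hu0⟩ := Submodule.exists_mem_ne_zero_of_ne_bot (hF.unstable_ne_bot (torusProj p))
  have hupos : 0 < ‖u‖ := norm_pos_iff.2 hu0
  have h1 := (hyp n _ _ (hasTorusFDerivAt_iterate hg hgc n p)).2 u hu
  have h2 := hcr _ _ (hF.fderiv_iterate_mem_unstable hg hgc n hu)
  have h3 := hd.cross_fderiv_iterate hgc (fun p => hV0 _) n p u
  rw [h3, abs_mul] at h2
  set J := |cocycle g (transverseFactor (fun p => V (torusProj p)) g) n p| with hJ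
  have h4 : |cross (V (torusProj p)) u| ≤ M * ‖u‖ :=
    (abs_cross_le _ _).trans (by gcongr; exact hVM _)
  have h5 : C⁻¹ * ‖u‖ ≤ ‖fderiv ℝ (g^[n]) p u‖ := by
    refine le_trans ?_ h1
    gcongr
    exact le_mul_of_one_le_right (by positivity) (one_le_pow₀ hlam.le)
  rw [div_le_iff₀ hM]
  refine le_of_mul_le_mul_right ?_ hupos
  calc c * C⁻¹ * ‖u‖ = c * (C⁻¹ * ‖u‖) := by ring
    _ ≤ c * ‖fderiv ℝ (g^[n]) p u‖ := by gcongr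
    _ ≤ J * |cross (V (torusProj p)) u| := h2
    _ ≤ J * (M * ‖u‖) := by gcongr
    _ = _ := by ring

/-- The speed cocycle of an Anosov map tends to zero uniformly. -/
theorem IsAnosov.exists_cocycle_speedFactor_le (hF : IsAnosov r F Es Eu)
    (hg : ∀ p, torusProj (g p) = F (torusProj p)) (hgc : ContDiff ℝ 1 g) {V : Torus2 → Plane}
    (hVs : ∀ x, V x ∈ Es x) {c₀ M : ℝ} (hc₀ : 0 < c₀) (hVc : ∀ x, c₀ ≤ ‖V x‖)
    (hVM : ∀ x, ‖V x‖ ≤ M) {ε : ℝ} (hε : 0 < ε) :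
    ∃ n, ∀ p, |cocycle g (speedFactor (fun p => V (torusProj p)) g) n p| ≤ ε := by
  have hV0 : ∀ x, V x ≠ 0 := fun x => norm_pos_iff.1 (hc₀.trans_le (hVc x))
  have hd := hF.preservesDirection hg hgc hV0 hVs
  obtain ⟨C, lam, hC, hlam, hyp⟩ := hF.hyperbolic
  have hM : 0 < M := hc₀.trans_le ((hVc 0).trans (hVM 0))
  obtain ⟨n, hn⟩ := exists_pow_lt_of_lt_one (show 0 < ε * c₀ / (C * M) by positivity)
    (inv_lt_one_of_one_lt₀ hlam)
  refine ⟨n, fun p => ?_⟩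
  have h1 := (hyp n _ _ (hasTorusFDerivAt_iterate hg hgc n p)).1 _ (hVs _)
  rw [hd.fderiv_iterate hgc n p, norm_smul, Real.norm_eq_abs] at h1
  refine le_of_mul_le_mul_right ?_ hc₀
  rw [lt_div_iff₀ (by positivity)] at hn
  calc _ ≤ _ := mul_le_mul_of_nonneg_left (hVc (torusProj (g^[n] p))) (abs_nonneg _)
    _ ≤ _ := h1
    _ ≤ C * lam⁻¹ ^ n * M := by gcongr; exact hVM _
    _ ≤ ε * c₀ := by linarith

end Lift

/-! ### The main estimate -/

open scoped NNReal in
/-- The lifted flow of a stable field of an Anosov diffeomorphism is contracted by the lift of the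
diffeomorphism. -/
theorem IsAnosov.exists_isContractedFlow {r : ℝ} (hr : 1 ≤ r) {F : Torus2 ≃ Torus2}
    {Es Eu : Torus2 → Submodule ℝ Plane} (hF : IsAnosov r F Es Eu) {V : Torus2 → Plane}
    (hVnorm : IsTorusHolderFun r (fun x => ‖V x‖)) (hV0 : ∀ x, V x ≠ 0) (hVs : ∀ x, V x ∈ Es x)
    {Φ : ℝ → Plane → Plane} {M : ℝ} {L : ℝ≥0}
    (hΦ : IsC1Flow (fun p => V (torusProj p)) Φ M L) :
    ∃ (T : Plane → Plane) (N : ℕ) (c₀ c₁ c : ℝ), IsContractedFlow (fun p => V (torusProj p)) Φ M L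
      T (r - 1 - ⌊r - 1⌋₊) ⌊r - 1⌋₊ N c₀ c₁ c := by
  set k := ⌊r - 1⌋₊ with hk
  -- Class C^r thus leaves k derivatives and the same Hölder exponent for DT.
  have hfloor : ⌊r⌋₊ = k + 1 := by
    rw [hk, ← Nat.floor_add_one (by linarith), sub_add_cancel]
  have hexp : r - (⌊r⌋₊ : ℝ) = r - 1 - k := by rw [hfloor]; push_cast; ring
  have hη : r - 1 - k ∈ Icc (0 : ℝ) 1 := by
    have h1 := Nat.floor_le (show 0 ≤ r - 1 by linarith)
    have h2 := Nat.lt_floor_add_one (r - 1)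
    exact ⟨by linarith, by linarith⟩
  obtain ⟨g, hg, hgs⟩ := hF.smooth
  obtain ⟨hgk, K, hK⟩ := hgs
  rw [hexp, hfloor] at hK
  rw [hfloor] at hgk
  have hgc : ContDiff ℝ 1 g := hgk.of_le (by norm_cast; omega)
  obtain ⟨hρk, K', hK'⟩ := hVnorm
  rw [hexp, hfloor] at hK'
  rw [hfloor] at hρk
  have hVper := latticePeriodic_comp_torusProj V
  have hd := hF.preservesDirection hg hgc hV0 hVs
  have hnorm : Continuous fun p => ‖V (torusProj p)‖ := hρk.continuous
  obtain ⟨B, hB0, hB⟩ := (latticePeriodic_comp_torusProj fun x => ‖V x‖⁻¹).exists_norm_le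
    (hnorm.inv₀ fun p => norm_ne_zero_iff.2 (hV0 _))
  set c₀ := (B + 1)⁻¹ with hc₀
  have hc₀pos : 0 < c₀ := by positivity
  have hVc : ∀ x, c₀ ≤ ‖V x‖ := by
    intro x
    obtain ⟨p, rfl⟩ := torusProj_surjective x
    have h1 := hB p
    rw [norm_inv, norm_norm] at h1
    have h2 : 0 < ‖V (torusProj p)‖ := norm_pos_iff.2 (hV0 _)
    exact inv_le_of_inv_le₀ h2 (h1.trans (by linarith))
  have hVM : ∀ x, ‖V x‖ ≤ M := by
    intro x
    obtain ⟨p, rfl⟩ := torusProj_surjective x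
    exact hΦ.norm_le p
  have hM : 0 < M := hc₀pos.trans_le ((hVc 0).trans (hVM 0))
  have hDper := latticePeriodic_fderiv_of_lift hg hgc.continuous
  obtain ⟨S, hS0, hS⟩ := hDper.exists_norm_le (hgc.continuous_fderiv one_ne_zero)
  obtain ⟨c₁, hc₁, hJ⟩ := hF.exists_le_abs_cocycle hg hgc hVs hc₀pos hVc hVM
  -- The threshold serves both contractions: 1/2 for σ, and (1/2) c₁ / c₁ for σ²/J.
  obtain ⟨N, hN⟩ := hF.exists_cocycle_speedFactor_le hg hgc hVs hc₀pos hVc hVM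
    (show 0 < min (1 / 2) c₁ by positivity)
  refine ⟨g, N, c₀, c₁, S * M / c₀, { hΦ with
    exponent_mem := hη
    lower_pos := hc₀pos
    lower_le := fun p => hVc _
    map_contDiff := hgc
    map_smooth := hDper.smoothBounded (hgk.fderiv_right (by norm_cast)) (K := K) fun x y => ?_
    speed_smooth := (latticePeriodic_comp_torusProj fun x => ‖V x‖).smoothBounded hρk hK'
    direction := hd
    speedFactor_le := fun p => ?_
    transverse_pos := hc₁
    le_transverse := fun p => ?_
    cocycle_speed := fun p => (hN p).trans (min_le_left _ _)
    cocycle_bending := fun p => ?_ }⟩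
  · rw [norm_iteratedFDeriv_fderiv_sub]
    exact hK x y
  · have h1 := congrArg norm (hd p)
    rw [norm_smul, Real.norm_eq_abs] at h1
    rw [le_div_iff₀ hc₀pos]
    calc _ ≤ _ := mul_le_mul_of_nonneg_left (hVc (torusProj (g p))) (abs_nonneg _)
      _ = _ := h1.symm
      _ ≤ S * ‖V (torusProj p)‖ := ContinuousLinearMap.le_of_opNorm_le _ (hS p) _
      _ ≤ S * M := by gcongr; exact hVM _
  · simpa [cocycle] using hJ 1 p
  · rw [cocycle_mul_mul_inv, abs_mul, abs_mul, abs_inv]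
    set y := |cocycle g (speedFactor (fun p => V (torusProj p)) g) N p|
    have hy1 : y ≤ 1 / 2 := (hN p).trans (min_le_left _ _)
    have hy2 : y ≤ c₁ := (hN p).trans (min_le_right _ _)
    have hJp := hJ N p
    calc _ ≤ 1 / 2 * c₁ * c₁⁻¹ := by
          refine mul_le_mul (mul_le_mul hy1 hy2 (abs_nonneg _) (by norm_num))
            (inv_anti₀ hc₁ hJp) (by positivity) (by positivity)
      _ = 1 / 2 := by field_simp

theorem lemma4p1 (α r : ℝ) (hα : 0 < α) (hr : 1 + α < r)
    (F : Torus2 ≃ Torus2) (Es Eu : Torus2 → Submodule ℝ Plane) (hF : IsAnosov r F Es Eu)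
    (V : Torus2 → Plane) (hV : IsTorusHolderFun (1 + α) V)
    (hVnorm : IsTorusHolderFun r (fun x => ‖V x‖))
    (hV0 : ∀ x, V x ≠ 0) (hVs : ∀ x, V x ∈ Es x)
    (φ : Flow ℝ Torus2) (hφ : IsFlowGeneratedBy φ V) :
    ∃ C β : ℝ, 0 < C ∧ 0 < β ∧ ∀ x : Torus2, ∃ ξ : ℝ → (Plane →L[ℝ] Plane),
      (∀ s, HasTorusFDerivAt (φ s) (ξ s) x ∧ IsUnit (ξ s)) ∧
      ∀ t : ℝ, 0 < t →
        ContDiffOn ℝ (⌊r - 1⌋₊ : ℕ) ξ (Set.Ioo 0 t) ∧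
        holderNormOn (r - 1) (Set.Ioo 0 t) ξ ≤ ENNReal.ofReal (C * max 1 t ^ β) := by
  have hV1 : ContDiff ℝ 1 fun p => V (torusProj p) := by
    refine hV.1.of_le ?_
    have : 1 ≤ ⌊1 + α⌋₊ := Nat.le_floor (by push_cast; linarith)
    exact_mod_cast this
  obtain ⟨Φ, M, L, hΦ, hproj⟩ := exists_lift_flow hφ hV1
  obtain ⟨T, N, c₀, c₁, c, h⟩ :=
    hF.exists_isContractedFlow (by linarith) hVnorm hV0 hVs hΦ
  obtain ⟨C, β, hC, hβ, hpoly⟩ := h.polyClass_flowDeriv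
  set S : ℝ := ∑ j ∈ Finset.range (⌊r - 1⌋₊ + 1), 2 ^ (⌊r - 1⌋₊ - j) + 1 with hS
  have hSpos : 0 < S := by positivity
  -- S collects the weights of the norm and one unit for the Hölder seminorm; the added ones make
  -- both constants strictly positive.
  refine ⟨S * (C + 1), β + 1, by positivity, by positivity, fun x => ?_⟩
  obtain ⟨p, rfl⟩ := torusProj_surjective x
  refine ⟨flowDeriv (fun p => V (torusProj p)) Φ p, fun s => ⟨?_, ?_⟩, fun t ht => ⟨?_, ?_⟩⟩
  · exact ⟨p, Φ s, rfl, Eventually.of_forall (hproj s), h.hasFDerivAt_flowDeriv h.ne_zero p s⟩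
  · exact IsC1Flow.isUnit_flowDeriv h.ne_zero p s
  · exact (hpoly p t ht).contDiffOn isOpen_Ioo
  · have hB : 0 ≤ C * max 1 t ^ β := mul_nonneg hC (rpow_max_nonneg _ _)
    refine (holderNormOn_le_of_curveClass isOpen_Ioo hB (hpoly p t ht)).trans
      (ENNReal.ofReal_le_ofReal ?_)
    rw [mul_assoc]
    refine mul_le_mul_of_nonneg_left ?_ hSpos.le
    exact mul_le_mul (by linarith) (rpow_max_le_rpow_max (by linarith)) (rpow_max_nonneg _ _)
      (by linarith)
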